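/- **Setting.** Let $\Omega=\mathbb T^2\times(0,1)$, with coordinates $(x_1,x_2,x_3)$, $\Gamma=\{x_3=1\}$, $e(x)=x$, $D=(\partial_1,\partial_2,\partial_3)$, $\bar\partial=(\partial_1,\partial_2)$, $F,_k=\partial F/\partial x_k$, and let $\|\cdot\|_k$ be the norm of $H^k(\Omega)$; repeated Latin indices are summed from $1$ to $3$. Let $\rho_0$ be a smooth function on $\mathbb T^2\times[0,1]$ with $\rho_0=0$ on $\Gamma$ and $\rho_0(x)\ge c\,(1-x_3)$ for some $c>0$ (for example $\rho_0=1-x_3$). A smooth solution on $[0,T]$ is a map $\eta$, smooth on $[0,T]\times\overline\Omega$ (with $\eta-e$ periodic in $x_1,x_2$), such that, with $v=\eta_t$, $J=\det D\eta$, $A=[D\eta]^{-1}$, $a=JA$, $$\rho_0 v^i_t+a^k_i(\rho_0^2J^{-2}),_k=0\ \text{ in }\Omega\times(0,T],\qquad (\eta,v)=(e,u_0)\ \text{ at }t=0 .$$ Let $(\operatorname{curl}u)_i=\varepsilon_{ijk}u^k,_j$, $(\operatorname{curl}_\eta u)_i=\varepsilon_{ijk}A^s_ju^k,_s$, and $$\begin{aligned}E(t)={}&\sum_{a=0}^4\|\partial_t^{2a}\eta(t)\|_{4-a}^2+\sum_{a=0}^4\Big[\|\rho_0\bar\partial^{4-a}\partial_t^{2a}D\eta(t)\|_0^2+\|\sqrt{\rho_0}\,\bar\partial^{4-a}\partial_t^{2a}v(t)\|_0^2\Big]\\&+\sum_{a=0}^3\|\rho_0\partial_t^{2a}J^{-2}(t)\|_{4-a}^2+\|\operatorname{curl}_\eta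 v(t)\|_3^2+\|\rho_0\bar\partial^4\operatorname{curl}_\eta v(t)\|_0^2 .\end{aligned}$$ **Proposition (curl estimates).** For every such $\rho_0$ there are polynomials $P_0,P$ such that for every $K$ there is a constant $C>0$ with the following property. Let $T>0$ and let $\eta$ be a smooth solution on $[0,T]$ with $$\tfrac12\le J\le\tfrac32\ \text{ on }\Omega\times[0,T]\qquad\text{and}\qquad \sum_{b=0}^{3}\|\partial_t^{2b}v(0)\|_{3-b}^2\le K .$$ Then $\sup_{t\in[0,T]}E(t)<\infty$ and, with $M_0=P_0(E(0))$, for all $t\in(0,T)$, $$\sum_{a=0}^3\|\operatorname{curl}\partial_t^{2a}\eta(t)\|_{3-a}^2+\sum_{l=0}^4\|\rho_0\,\bar\partial^{4-l}\operatorname{curl}\partial_t^{2l}\eta(t)\|_0^2\le M_0+C\,T\,P\Big(\sup_{t\in[0,T]}E(t)\Big).$$ -/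

import Mathlib

open Set MeasureTheory
open scoped ContDiff

noncomputable section

namespace PhysVac

/-- Points and vectors of three-dimensional space, in coordinates. The coordinates `x₁, x₂, x₃` are
`x 0, x 1, x 2`. The volume on this type is Lebesgue measure. -/
abbrev Pt : Type := Fin 3 → ℝ

/-- The lift to `ℝ³` of the reference domain `Ω = 𝕋² × (0,1)`. -/
def slab : Set Pt := {x | x 2 ∈ Ioo (0 : ℝ) 1}

/-- The lift to `ℝ³` of the closed reference domain `𝕋² × [0,1]`. -/
def closedSlab : Set Pt := {x | x 2 ∈ Icc (0 : ℝ) 1}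

/-- One period cell of `Ω`; integrals over `Ω` are integrals over this cell. -/
def cell : Set Pt := {x | ∀ i, x i ∈ Ioo (0 : ℝ) 1}

/-- The unit vector in the `k`-th coordinate direction. -/
def unitVec (k : Fin 3) : Pt := Pi.single k 1

/-- The two horizontal directions `x₁, x₂` among the three coordinate directions. -/
def hor (α : Fin 2) : Fin 3 := Fin.castSucc α

/-- The partial derivative `F,_k = ∂F/∂x_k`. -/
def pd (k : Fin 3) (F : Pt → ℝ) (x : Pt) : ℝ := fderiv ℝ F x (unitVec k)

/-- The partial derivative of multi-index `a = (a₁, a₂, a₃)`. -/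
def mpd (a : Fin 3 → ℕ) (F : Pt → ℝ) : Pt → ℝ :=
  (pd 0)^[a 0] ((pd 1)^[a 1] ((pd 2)^[a 2] F))

/-- The `m`-th time derivative of a time-dependent scalar function. -/
def dt (m : ℕ) (F : ℝ → Pt → ℝ) (t : ℝ) (x : Pt) : ℝ := iteratedDeriv m (fun s => F s x) t

/-- The `m`-th time derivative of a time-dependent vector field. -/
def dtv (m : ℕ) (η : ℝ → Pt → Pt) (t : ℝ) (x : Pt) : Pt :=
  fun i => dt m (fun s y => η s y i) t x

/-- The squared Sobolev norm `‖F‖²_k`: the sum over all multi-indices `|a| ≤ k` of the squared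
`L²(Ω)` norms of the derivatives. -/
def sobSq (k : ℕ) (F : Pt → ℝ) : ℝ :=
  ∑ j ∈ Finset.range (k + 1), ∑ a ∈ Finset.piAntidiag (Finset.univ : Finset (Fin 3)) j,
    ∫ x in cell, (mpd a F x) ^ 2

/-- `‖F‖²_k` for a vector field. -/
def sobSqV (k : ℕ) (F : Pt → Pt) : ℝ := ∑ i, sobSq k (fun x => F x i)

/-- The squared weighted norm `‖w ∂̄^m F‖²_0`, where `∂̄ = (∂/∂x₁, ∂/∂x₂)` is the horizontal gradient
and `∂̄^m F` is the array of all `m`-fold horizontal derivatives. -/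
def tanSq (w : Pt → ℝ) : ℕ → (Pt → ℝ) → ℝ
  | 0, F => ∫ x in cell, (w x * F x) ^ 2
  | m + 1, F => ∑ α : Fin 2, tanSq w m (pd (hor α) F)

/-- `‖w ∂̄^m F‖²_0` for a vector field. -/
def tanSqV (w : Pt → ℝ) (m : ℕ) (F : Pt → Pt) : ℝ := ∑ i, tanSq w m (fun x => F x i)

/-- The permutation symbol `ε_{ijk}`. -/
def eps (i j k : Fin 3) : ℝ :=
  (((j : ℕ) : ℝ) - ((i : ℕ) : ℝ)) * (((k : ℕ) : ℝ) - ((i : ℕ) : ℝ)) *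
    (((k : ℕ) : ℝ) - ((j : ℕ) : ℝ)) / 2

/-- `(curl u)_i = ε_{ijk} u^k,_j`. -/
def curl (u : Pt → Pt) (x : Pt) : Pt :=
  fun i => ∑ j, ∑ k, eps i j k * pd j (fun y => u y k) x

/-- The Lagrangian velocity `v = ∂_t η`. -/
def vel (η : ℝ → Pt → Pt) : ℝ → Pt → Pt := dtv 1 η

/-- The deformation tensor `Dη`: row `i`, column `j` holds `η^i,_j`. -/
def defTensor (η : ℝ → Pt → Pt) (t : ℝ) (x : Pt) : Matrix (Fin 3) (Fin 3) ℝ :=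
  Matrix.of fun i j => pd j (fun y => η t y i) x

/-- `J = det Dη`. -/
def jac (η : ℝ → Pt → Pt) (t : ℝ) (x : Pt) : ℝ := (defTensor η t x).det

/-- `A = [Dη]⁻¹`; the entry `A^k_i` is `invDef η t x k i`. -/
def invDef (η : ℝ → Pt → Pt) (t : ℝ) (x : Pt) : Matrix (Fin 3) (Fin 3) ℝ := (defTensor η t x)⁻¹

/-- `a = J A`; the entry `a^k_i` is `cof η t x k i`. -/
def cof (η : ℝ → Pt → Pt) (t : ℝ) (x : Pt) : Matrix (Fin 3) (Fin 3) ℝ :=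
  jac η t x • invDef η t x

/-- The function `J⁻²`. -/
def jacInvSq (η : ℝ → Pt → Pt) (t : ℝ) (x : Pt) : ℝ := ((jac η t x) ^ 2)⁻¹

/-- The Lagrangian curl `(curl_η u)_i = ε_{ijk} A^s_j u^k,_s` at time `t` of a vector field `u`. -/
def lagCurl (η : ℝ → Pt → Pt) (t : ℝ) (u : Pt → Pt) (x : Pt) : Pt :=
  fun i => ∑ j, ∑ k, ∑ s, eps i j k * invDef η t x s j * pd s (fun y => u y k) x

/-- Admissible initial densities on `𝕋² × [0,1]`: smooth up to the boundary, vanishing on the vacuum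
boundary `Γ = {x₃ = 1}` and bounded below by a positive multiple of the distance to `Γ` (in particular
positive away from `Γ`). -/
structure IsInitialDensity (ρ₀ : Pt → ℝ) : Prop where
  smooth : ContDiff ℝ ∞ ρ₀
  periodic : ∀ x ∈ closedSlab, ∀ α : Fin 2, ρ₀ (x + unitVec (hor α)) = ρ₀ x
  vanishes : ∀ x : Pt, x 2 = 1 → ρ₀ x = 0
  lower : ∃ c : ℝ, 0 < c ∧ ∀ x ∈ closedSlab, c * (1 - x 2) ≤ ρ₀ x

/-- `η` is a solution, smooth up to the boundary on `[0,T] × 𝕋² × [0,1]`, of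
`ρ₀ v_t^i + a^k_i (ρ₀² J⁻²),_k = 0` in `Ω × (0,T]`, `(η, v) = (e, u₀)` at `t = 0`.
Smoothness up to the boundary is expressed through a smooth extension to `ℝ × ℝ³`; only the values on
`[0,T] × ℝ² × [0,1]` are constrained and only those values enter the quantities below. The flow map of
the torus is given by its lift, which commutes with the unit horizontal translations. -/
structure IsSmoothSolution (ρ₀ : Pt → ℝ) (T : ℝ) (u₀ : Pt → Pt) (η : ℝ → Pt → Pt) : Prop where
  smooth : ContDiff ℝ ∞ (fun p : ℝ × Pt => η p.1 p.2)
  periodic : ∀ t ∈ Icc 0 T, ∀ x ∈ closedSlab, ∀ α : Fin 2,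
    η t (x + unitVec (hor α)) = η t x + unitVec (hor α)
  momentum : ∀ t ∈ Ioc 0 T, ∀ x ∈ slab, ∀ i : Fin 3,
    ρ₀ x * dtv 1 (vel η) t x i
      + ∑ k, cof η t x k i * pd k (fun y => ρ₀ y ^ 2 * jacInvSq η t y) x = 0
  initial_position : ∀ x ∈ closedSlab, η 0 x = x
  initial_velocity : ∀ x ∈ closedSlab, vel η 0 x = u₀ x

/-- The higher-order energy function `E(t)`. -/
def energy (ρ₀ : Pt → ℝ) (η : ℝ → Pt → Pt) (t : ℝ) : ℝ :=
  (∑ a ∈ Finset.range 5, sobSqV (4 - a) (dtv (2 * a) η t))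
  + (∑ a ∈ Finset.range 5,
      ((∑ j, tanSqV ρ₀ (4 - a) (fun x i => pd j (fun y => dtv (2 * a) η t y i) x))
        + tanSqV (fun x => Real.sqrt (ρ₀ x)) (4 - a) (dtv (2 * a) (vel η) t)))
  + (∑ a ∈ Finset.range 4, sobSq (4 - a) (fun x => ρ₀ x * dt (2 * a) (jacInvSq η) t x))
  + sobSqV 3 (lagCurl η t (vel η t))
  + tanSqV ρ₀ 4 (lagCurl η t (vel η t))

/-- The left-hand side of the curl estimate:
`∑_{a=0}^{3} ‖curl ∂_t^{2a} η‖²_{3-a} + ∑_{l=0}^{4} ‖ρ₀ ∂̄^{4-l} curl ∂_t^{2l} η‖²_0`. -/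
def curlNorms (ρ₀ : Pt → ℝ) (η : ℝ → Pt → Pt) (t : ℝ) : ℝ :=
  (∑ a ∈ Finset.range 4, sobSqV (3 - a) (curl (dtv (2 * a) η t)))
  + ∑ l ∈ Finset.range 5, tanSqV ρ₀ (4 - l) (curl (dtv (2 * l) η t))

/-- The size `∑_{b=0}^{3} ‖∂_t^{2b} v(0)‖²_{3-b}` of the velocity and its time derivatives at the
initial time. -/
def initialSize (η : ℝ → Pt → Pt) : ℝ :=
  ∑ b ∈ Finset.range 4, sobSqV (3 - b) (dtv (2 * b) (vel η) 0)

end PhysVac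

end

noncomputable section

namespace PhysVac

/-! Multiplying the momentum equation by η^i,_l and dividing by ρ₀ > 0 gives η^i,_l η_tt^i = -2
(ρ₀/J),_l. The left side is therefore a gradient, its curl vanishes, and the Cauchy invariants
η^i,_k v^i,_l - η^i,_l v^i,_k do not depend on time (`sd_none_cauchyInv`). Up to sign they are the
components of curl u₀, which E(0) controls because curl_η v = curl v at t = 0, where Dη = I.

Let D^L be an iterated derivative, and let B_L = Σ_i (η^i,_k D^L η^i,_l - η^i,_l D^L η^i,_k)
(`brk`). Applying D^L to the invariants yields B with one extra time derivative, plus products in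
which Dη itself is differentiated at least once. These products are of lower order, so the
extra-derivative bracket is bounded in L² although D^L v^i,_k alone is not. Hence ∂_t B_L is bounded
and B_L(t) = B_L(0) + O(t). To pass from B_L to the curl, the factor D^L Dη is frozen at time t and
the other factor is moved from time t to time 0, where it is the identity. This again costs O(t).
The result is curl D^L η(t) = curl D^L η(0) + O(t), which is `eventually_integral_curl_le`.

Orders are counted parabolically: 1 for time, 2 for space. The energy bounds D^L η in L² for order
at most 8 when the number of time derivatives is even. For an odd number one integrates in time from
t = 0, where the bound K on v enters. Products are estimated with H¹ ⊂ L⁶, H² ⊂ L^∞ and an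
anisotropic product inequality, all derived on the unit cell from a Loomis-Whitney inequality and a
Morrey estimate.

The weighted estimate also needs ρ₀ D^L Dη in L² for horizontal L of order 7. Such L has an odd
number of time derivatives, so the energy does not contain this quantity. Time integration reduces
the question to t = 0. There the entries with a horizontal last index come from the √ρ₀ terms,
antisymmetric combinations come from the Cauchy invariants, and the remaining entry ρ₀ D^L η^3,_3
reduces to h = D^L(ρ₀ J). Modulo bounded errors h = ρ₀ div D^L η, and the differentiated momentum
equation gives ρ₀ ∇h = c h with bounded c. Integration by parts with weights that vanish at the two
horizontal faces then bounds h in L² (`elliptic_estimate`).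

All bounds must be polynomial in Λ = 1 + |K| + sup E, uniformly over all solutions. `Tame` therefore
speaks of families indexed by an arbitrary type, which is instantiated by all solutions with two
marked times. The argument is run for T ≤ 1; for T > 1 the curl norms are trivially at most a
constant times T sup E. -/

/-- The coordinate directions of space-time; `none` is the time direction. -/
def dir : Option (Fin 3) → ℝ × Pt
  | none => (1, 0)
  | some k => (0, unitVec k)

/-- The partial derivative of a space-time function in a coordinate direction. -/
def sd (j : Option (Fin 3)) (F : ℝ × Pt → ℝ) (p : ℝ × Pt) : ℝ := fderiv ℝ F p (dir j)

/-- The iterated space-time derivative along a list of directions. -/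
def sdL (L : List (Option (Fin 3))) (F : ℝ × Pt → ℝ) : ℝ × Pt → ℝ := L.foldr sd F

/-- The parabolic order of a list of directions: time counts once and space twice. -/
def ord : List (Option (Fin 3)) → ℕ
  | [] => 0
  | none :: L => ord L + 1
  | some _ :: L => ord L + 2

/-- Lists of time and horizontal directions. -/
def IsHor (L : List (Option (Fin 3))) : Prop := ∀ j ∈ L, j ≠ some 2

@[simp] theorem sdL_nil (F : ℝ × Pt → ℝ) : sdL [] F = F := rfl

@[simp] theorem sdL_cons (j : Option (Fin 3)) (L : List (Option (Fin 3))) (F : ℝ × Pt → ℝ) :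
    sdL (j :: L) F = sd j (sdL L F) := rfl

theorem sdL_append (L L' : List (Option (Fin 3))) (F : ℝ × Pt → ℝ) :
    sdL (L ++ L') F = sdL L (sdL L' F) := by
  simp [sdL, List.foldr_append]

@[simp] theorem ord_nil : ord [] = 0 := rfl
@[simp] theorem ord_cons_none (L : List (Option (Fin 3))) : ord (none :: L) = ord L + 1 := rfl
@[simp] theorem ord_cons_some (k : Fin 3) (L : List (Option (Fin 3))) :
    ord (some k :: L) = ord L + 2 := rfl

theorem ord_append (L L' : List (Option (Fin 3))) : ord (L ++ L') = ord L + ord L' := by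
  induction L with
  | nil => simp
  | cons j L ih => cases j <;> simp [ih] <;> omega

theorem ord_eq_count (L : List (Option (Fin 3))) :
    ord L = L.count none + 2 * (L.count (some 0) + L.count (some 1) + L.count (some 2)) := by
  induction L with
  | nil => simp
  | cons j L ih =>
    rcases j with _ | k
    · simp [ih]; omega
    · fin_cases k <;> simp [ih] <;> omega

/-! ### Calculus of iterated space-time derivatives -/

theorem sd_contDiffOn {U : Set (ℝ × Pt)} (hU : IsOpen U) {F : ℝ × Pt → ℝ}
    (hF : ContDiffOn ℝ ∞ F U) (j : Option (Fin 3)) : ContDiffOn ℝ ∞ (sd j F) U := by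
  have h := hF.fderiv_of_isOpen hU (m := ∞) (by simp)
  exact h.clm_apply contDiffOn_const

theorem sdL_contDiffOn {U : Set (ℝ × Pt)} (hU : IsOpen U) {F : ℝ × Pt → ℝ}
    (hF : ContDiffOn ℝ ∞ F U) (L : List (Option (Fin 3))) : ContDiffOn ℝ ∞ (sdL L F) U := by
  induction L with
  | nil => simpa
  | cons j L ih => exact sd_contDiffOn hU ih j

theorem sd_contDiff {F : ℝ × Pt → ℝ} (hF : ContDiff ℝ ∞ F) (j : Option (Fin 3)) :
    ContDiff ℝ ∞ (sd j F) :=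
  contDiffOn_univ.1 (sd_contDiffOn isOpen_univ (contDiffOn_univ.2 hF) j)

theorem sdL_contDiff {F : ℝ × Pt → ℝ} (hF : ContDiff ℝ ∞ F) (L : List (Option (Fin 3))) :
    ContDiff ℝ ∞ (sdL L F) :=
  contDiffOn_univ.1 (sdL_contDiffOn isOpen_univ (contDiffOn_univ.2 hF) L)

theorem contDiff_differentiable {E : Type*} [NormedAddCommGroup E] [NormedSpace ℝ E] {F : E → ℝ}
    (hF : ContDiff ℝ ∞ F) : Differentiable ℝ F := hF.differentiable (by simp)

theorem sd_add {F G : ℝ × Pt → ℝ} (hF : ContDiff ℝ ∞ F) (hG : ContDiff ℝ ∞ G)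
    (j : Option (Fin 3)) : sd j (F + G) = sd j F + sd j G := by
  ext p
  simp [sd, fderiv_add (contDiff_differentiable hF p) (contDiff_differentiable hG p)]

theorem sd_sub {F G : ℝ × Pt → ℝ} (hF : ContDiff ℝ ∞ F) (hG : ContDiff ℝ ∞ G)
    (j : Option (Fin 3)) : sd j (F - G) = sd j F - sd j G := by
  ext p
  simp [sd, fderiv_sub (contDiff_differentiable hF p) (contDiff_differentiable hG p)]

theorem sd_smul {F : ℝ × Pt → ℝ} (hF : ContDiff ℝ ∞ F) (c : ℝ)
    (j : Option (Fin 3)) : sd j (c • F) = c • sd j F := by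
  ext p
  simp [sd, fderiv_const_smul (contDiff_differentiable hF p)]

theorem sd_mul {F G : ℝ × Pt → ℝ} (hF : ContDiff ℝ ∞ F) (hG : ContDiff ℝ ∞ G)
    (j : Option (Fin 3)) : sd j (F * G) = sd j F * G + F * sd j G := by
  ext p
  simp [sd, fderiv_mul (contDiff_differentiable hF p) (contDiff_differentiable hG p)]
  ring

theorem sdL_add {F G : ℝ × Pt → ℝ} (hF : ContDiff ℝ ∞ F) (hG : ContDiff ℝ ∞ G)
    (L : List (Option (Fin 3))) : sdL L (F + G) = sdL L F + sdL L G := by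
  induction L with
  | nil => rfl
  | cons j L ih => simp [ih, sd_add (sdL_contDiff hF L) (sdL_contDiff hG L)]

theorem sdL_sub {F G : ℝ × Pt → ℝ} (hF : ContDiff ℝ ∞ F) (hG : ContDiff ℝ ∞ G)
    (L : List (Option (Fin 3))) : sdL L (F - G) = sdL L F - sdL L G := by
  induction L with
  | nil => rfl
  | cons j L ih => simp [ih, sd_sub (sdL_contDiff hF L) (sdL_contDiff hG L)]

theorem sdL_smul {F : ℝ × Pt → ℝ} (hF : ContDiff ℝ ∞ F) (c : ℝ)
    (L : List (Option (Fin 3))) : sdL L (c • F) = c • sdL L F := by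
  induction L with
  | nil => rfl
  | cons j L ih => simp [ih, sd_smul (sdL_contDiff hF L)]

theorem sdL_zero (L : List (Option (Fin 3))) : sdL L 0 = 0 := by
  induction L with
  | nil => rfl
  | cons j L ih => ext p; simp [ih, sd]

theorem contDiff_finset_sum {ι : Type*} {E : Type*} [NormedAddCommGroup E] [NormedSpace ℝ E]
    {s : Finset ι} {F : ι → E → ℝ}
    (hF : ∀ i, ContDiff ℝ ∞ (F i)) : ContDiff ℝ ∞ (∑ i ∈ s, F i) := by
  have : (∑ i ∈ s, F i) = fun p => ∑ i ∈ s, F i p := by ext; simp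
  rw [this]
  exact ContDiff.sum fun i _ => hF i

theorem sdL_sum {ι : Type*} (s : Finset ι) {F : ι → ℝ × Pt → ℝ}
    (hF : ∀ i, ContDiff ℝ ∞ (F i)) (L : List (Option (Fin 3))) :
    sdL L (∑ i ∈ s, F i) = ∑ i ∈ s, sdL L (F i) := by
  classical
  induction s using Finset.induction_on with
  | empty => simp [sdL_zero]
  | insert a s ha ih =>
    rw [Finset.sum_insert ha, Finset.sum_insert ha, sdL_add (hF a) (contDiff_finset_sum hF), ih]

theorem two_le_infty : (2 : WithTop ℕ∞) ≤ ∞ := by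
  change ((2 : ℕ∞) : WithTop ℕ∞) ≤ ((⊤ : ℕ∞) : WithTop ℕ∞)
  exact WithTop.coe_le_coe.2 le_top

/-- Pointwise smoothness suffices here because `sd_accel_symm` applies the result to ρ₀/J, which is
smooth only where J ≠ 0. -/
theorem sd_comm_of_contDiffAt {F : ℝ × Pt → ℝ} {p : ℝ × Pt} (hF : ContDiffAt ℝ ∞ F p)
    (j k : Option (Fin 3)) : sd j (sd k F) p = sd k (sd j F) p := by
  have key : ∀ j k, sd j (sd k F) p = fderiv ℝ (fderiv ℝ F) p (dir j) (dir k) := by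
    intro j k
    have h : DifferentiableAt ℝ (fderiv ℝ F) p :=
      (hF.fderiv_right (m := 1) (by norm_num; exact two_le_infty)).differentiableAt (by simp)
    change fderiv ℝ (fun q => fderiv ℝ F q (dir k)) p (dir j) = _
    rw [fderiv_clm_apply h (differentiableAt_const _)]
    simp
  rw [key, key]
  exact (hF.isSymmSndFDerivAt (by simpa using two_le_infty)) (dir j) (dir k)

theorem sd_comm {F : ℝ × Pt → ℝ} (hF : ContDiff ℝ ∞ F) (j k : Option (Fin 3)) :
    sd j (sd k F) = sd k (sd j F) := funext fun _ => sd_comm_of_contDiffAt hF.contDiffAt j k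

theorem sdL_perm {F : ℝ × Pt → ℝ} (hF : ContDiff ℝ ∞ F) {L L' : List (Option (Fin 3))}
    (h : L.Perm L') : sdL L F = sdL L' F := by
  induction h with
  | nil => rfl
  | cons j _ ih => simp [ih]
  | swap j k L => exact sd_comm (sdL_contDiff hF L) _ _
  | trans _ _ ih₁ ih₂ => exact ih₁.trans ih₂

/-! ### The Leibniz rule and its extreme terms -/

/-- The ways of distributing a list of directions over two factors. -/
def splits : List (Option (Fin 3)) → List (List (Option (Fin 3)) × List (Option (Fin 3)))
  | [] => [([], [])]
  | j :: L => (splits L).map (fun b => (j :: b.1, b.2)) ++ (splits L).map (fun b => (b.1, j :: b.2))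

/-- The distributions in which the first factor receives at least one direction. -/
def splitsL : List (Option (Fin 3)) → List (List (Option (Fin 3)) × List (Option (Fin 3)))
  | [] => []
  | j :: L => (splits L).map (fun b => (j :: b.1, b.2)) ++ (splitsL L).map (fun b => (b.1, j :: b.2))

/-- The distributions in which both factors receive at least one direction. -/
def splitsLR : List (Option (Fin 3)) → List (List (Option (Fin 3)) × List (Option (Fin 3)))
  | [] => []
  | [_] => []
  | j :: L => ([j], L) :: (L, [j]) ::
      ((splitsLR L).map (fun b => (j :: b.1, b.2)) ++ (splitsLR L).map (fun b => (b.1, j :: b.2)))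

theorem splits_perm_splitsL (L : List (Option (Fin 3))) :
    (splits L).Perm (([], L) :: splitsL L) := by
  induction L with
  | nil => simp [splits, splitsL]
  | cons j L ih =>
    have h := ih.map (fun b => (b.1, j :: b.2))
    rw [List.map_cons] at h
    exact (h.append_left _).trans List.perm_middle

/-- Separates the two terms in which a single factor carries all derivatives. For the empty list
these two terms coincide, hence the assumption. -/
theorem splits_perm_splitsLR (L : List (Option (Fin 3))) (hL : L ≠ []) :
    (splits L).Perm (([], L) :: (L, []) :: splitsLR L) := by
  induction L with
  | nil => simp at hL
  | cons j L ih =>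
    rcases L with _ | ⟨k, L⟩
    · simpa [splits, splitsLR] using List.Perm.swap _ _ []
    · have ih := ih (by simp)
      have h₁ := ih.map (fun b => (j :: b.1, b.2))
      have h₂ := ih.map (fun b => (b.1, j :: b.2))
      rw [List.map_cons, List.map_cons] at h₁ h₂
      refine (h₁.append h₂).trans ?_
      rw [← Multiset.coe_eq_coe]
      simp only [splitsLR, ← Multiset.coe_add, ← Multiset.cons_coe, ← Multiset.singleton_add]
      abel

theorem ord_of_mem_splits {L : List (Option (Fin 3))} {b} (hb : b ∈ splits L) :
    ord b.1 + ord b.2 = ord L := by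
  induction L generalizing b with
  | nil => simp [splits] at hb; simp [hb]
  | cons j L ih =>
    simp only [splits, List.mem_append, List.mem_map] at hb
    rcases hb with ⟨c, hc, rfl⟩ | ⟨c, hc, rfl⟩ <;> have := ih hc <;> cases j <;> simp <;> omega

theorem isHor_of_mem_splits {L : List (Option (Fin 3))} {b} (hb : b ∈ splits L) (hL : IsHor L) :
    IsHor b.1 ∧ IsHor b.2 := by
  induction L generalizing b with
  | nil => simp [splits] at hb; simp [hb, IsHor]
  | cons j L ih =>
    simp only [splits, List.mem_append, List.mem_map] at hb
    simp only [IsHor, List.mem_cons, forall_eq_or_imp] at hL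
    rcases hb with ⟨c, hc, rfl⟩ | ⟨c, hc, rfl⟩ <;> have := ih hc hL.2 <;>
      simp only [IsHor, List.mem_cons, forall_eq_or_imp] at this ⊢ <;> tauto

theorem ord_pos {L : List (Option (Fin 3))} (hL : L ≠ []) : 0 < ord L := by
  rcases L with _ | ⟨_ | _, L⟩
  · simp at hL
  all_goals simp

theorem mem_splitsL {L : List (Option (Fin 3))} {b} (hb : b ∈ splitsL L) :
    b ∈ splits L ∧ 0 < ord b.1 := by
  refine ⟨(splits_perm_splitsL L).mem_iff.2 (by simp [hb]), ?_⟩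
  suffices b.1 ≠ [] from ord_pos this
  induction L generalizing b with
  | nil => simp [splitsL] at hb
  | cons j L ih =>
    simp only [splitsL, List.mem_append, List.mem_map] at hb
    rcases hb with ⟨c, hc, rfl⟩ | ⟨c, hc, rfl⟩
    · simp
    · exact ih (b := c) hc

theorem mem_splitsLR {L : List (Option (Fin 3))} {b} (hb : b ∈ splitsLR L) :
    b ∈ splits L ∧ 0 < ord b.1 ∧ 0 < ord b.2 := by
  have hL : L ≠ [] := by rintro rfl; simp [splitsLR] at hb
  refine ⟨(splits_perm_splitsLR L hL).mem_iff.2 (by simp [hb]), ?_⟩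
  suffices b.1 ≠ [] ∧ b.2 ≠ [] from ⟨ord_pos this.1, ord_pos this.2⟩
  clear hL
  induction L generalizing b with
  | nil => simp [splitsLR] at hb
  | cons j L ih =>
    rcases L with _ | ⟨k, L⟩
    · simp [splitsLR] at hb
    · simp only [splitsLR, List.mem_cons, List.mem_append, List.mem_map] at hb
      rcases hb with rfl | rfl | ⟨c, hc, rfl⟩ | ⟨c, hc, rfl⟩
      · simp
      · simp
      · exact ⟨by simp, (ih hc).2⟩
      · exact ⟨(ih hc).1, by simp⟩

/-- The Leibniz sum over a list of distributions. -/
def leibSum (S : List (List (Option (Fin 3)) × List (Option (Fin 3)))) (F G : ℝ × Pt → ℝ) :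
    ℝ × Pt → ℝ :=
  (S.map fun b => sdL b.1 F * sdL b.2 G).sum

theorem leibSum_append (S S') (F G : ℝ × Pt → ℝ) :
    leibSum (S ++ S') F G = leibSum S F G + leibSum S' F G := by
  simp [leibSum]

theorem leibSum_contDiff {F G : ℝ × Pt → ℝ} (hF : ContDiff ℝ ∞ F) (hG : ContDiff ℝ ∞ G) (S) :
    ContDiff ℝ ∞ (leibSum S F G) := by
  induction S with
  | nil => exact contDiff_const
  | cons b S ih =>
    have : leibSum (b :: S) F G = sdL b.1 F * sdL b.2 G + leibSum S F G := by simp [leibSum]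
    rw [this]
    exact ((sdL_contDiff hF _).mul (sdL_contDiff hG _)).add ih

theorem sd_leibSum {F G : ℝ × Pt → ℝ} (hF : ContDiff ℝ ∞ F) (hG : ContDiff ℝ ∞ G) (S)
    (j : Option (Fin 3)) :
    sd j (leibSum S F G) = leibSum (S.map (fun b => (j :: b.1, b.2))) F G
      + leibSum (S.map (fun b => (b.1, j :: b.2))) F G := by
  induction S with
  | nil => simp [leibSum]; exact sdL_zero [j]
  | cons b S ih =>
    have h : ∀ (b) (S), leibSum (b :: S) F G = sdL b.1 F * sdL b.2 G + leibSum S F G := by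
      intros; simp [leibSum]
    have hm : ContDiff ℝ ∞ (sdL b.1 F * sdL b.2 G) := (sdL_contDiff hF _).mul (sdL_contDiff hG _)
    rw [h, sd_add hm (leibSum_contDiff hF hG S), ih,
      sd_mul (sdL_contDiff hF _) (sdL_contDiff hG _), List.map_cons, List.map_cons, h, h]
    simp only [sdL_cons]
    abel

theorem sdL_mul {F G : ℝ × Pt → ℝ} (hF : ContDiff ℝ ∞ F) (hG : ContDiff ℝ ∞ G)
    (L : List (Option (Fin 3))) : sdL L (F * G) = leibSum (splits L) F G := by
  induction L with
  | nil => simp [splits, leibSum]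
  | cons j L ih => rw [sdL_cons, ih, sd_leibSum hF hG, splits, leibSum_append]

theorem sdL_mul_left {F G : ℝ × Pt → ℝ} (hF : ContDiff ℝ ∞ F) (hG : ContDiff ℝ ∞ G)
    (L : List (Option (Fin 3))) : sdL L (F * G) = F * sdL L G + leibSum (splitsL L) F G := by
  rw [sdL_mul hF hG, leibSum, ((splits_perm_splitsL L).map _).sum_eq]
  simp [leibSum]

theorem sdL_mul_leftRight {F G : ℝ × Pt → ℝ} (hF : ContDiff ℝ ∞ F) (hG : ContDiff ℝ ∞ G)
    (L : List (Option (Fin 3))) (hL : L ≠ []) :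
    sdL L (F * G) = F * sdL L G + sdL L F * G + leibSum (splitsLR L) F G := by
  rw [sdL_mul hF hG, leibSum, ((splits_perm_splitsLR L hL).map _).sum_eq]
  simp [leibSum, add_assoc]

/-! ### Time slices -/

/-- The open set U is kept general for two uses: quantities that are smooth only where J ≠ 0, and
functions that agree only on the lift of Ω. -/
theorem pd_eq_sd {U : Set (ℝ × Pt)} (hU : IsOpen U) {F : ℝ × Pt → ℝ}
    (hF : ContDiffOn ℝ ∞ F U) {t : ℝ} {g : Pt → ℝ} (hg : ∀ y, (t, y) ∈ U → g y = F (t, y))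
    (k : Fin 3) (y : Pt) (hy : (t, y) ∈ U) : pd k g y = sd (some k) F (t, y) := by
  have h₁ : g =ᶠ[nhds y] fun z => F (t, z) := by
    have : ∀ᶠ z in nhds y, (t, z) ∈ U :=
      (Continuous.prodMk_right t).continuousAt.eventually (hU.mem_nhds hy)
    exact this.mono hg
  have h₂ : HasFDerivAt F (fderiv ℝ F (t, y)) (t, y) :=
    ((hF.contDiffAt (hU.mem_nhds hy)).differentiableAt (by simp)).hasFDerivAt
  have h₃ : HasFDerivAt (fun z : Pt => (t, z)) (ContinuousLinearMap.inr ℝ ℝ Pt) y :=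
    hasFDerivAt_prodMk_right t y
  have h₄ := h₂.comp y h₃
  rw [pd, h₁.fderiv_eq, sd]
  erw [h₄.fderiv]
  simp [dir]

theorem deriv_eq_sd {U : Set (ℝ × Pt)} (hU : IsOpen U) {F : ℝ × Pt → ℝ}
    (hF : ContDiffOn ℝ ∞ F U) {x : Pt} {g : ℝ → ℝ} (hg : ∀ s, (s, x) ∈ U → g s = F (s, x))
    (s : ℝ) (hs : (s, x) ∈ U) : deriv g s = sd none F (s, x) := by
  have h₁ : g =ᶠ[nhds s] fun z => F (z, x) := by
    have : ∀ᶠ z in nhds s, (z, x) ∈ U :=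
      (Continuous.prodMk_left x).continuousAt.eventually (hU.mem_nhds hs)
    exact this.mono hg
  have h₂ : HasFDerivAt F (fderiv ℝ F (s, x)) (s, x) :=
    ((hF.contDiffAt (hU.mem_nhds hs)).differentiableAt (by simp)).hasFDerivAt
  have h₃ : HasDerivAt (fun z : ℝ => (z, x)) ((1 : ℝ), (0 : Pt)) s :=
    (hasDerivAt_id s).prodMk (hasDerivAt_const s x)
  have h₄ := h₂.comp_hasDerivAt s h₃
  rw [h₁.deriv_eq]
  exact h₄.deriv

theorem hasDerivAt_sd {F : ℝ × Pt → ℝ} (hF : ContDiff ℝ ∞ F) (s : ℝ) (x : Pt) :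
    HasDerivAt (fun s => F (s, x)) (sd none F (s, x)) s := by
  have h₂ := (contDiff_differentiable hF (s, x)).hasFDerivAt
  exact h₂.comp_hasDerivAt s ((hasDerivAt_id s).prodMk (hasDerivAt_const s x))

theorem dt_eq_sdL {U : Set (ℝ × Pt)} (hU : IsOpen U) {F : ℝ × Pt → ℝ}
    (hF : ContDiffOn ℝ ∞ F U) {f : ℝ → Pt → ℝ} (hf : ∀ s y, (s, y) ∈ U → f s y = F (s, y))
    (m : ℕ) (s : ℝ) (x : Pt) (hs : (s, x) ∈ U) :
    dt m f s x = sdL (List.replicate m none) F (s, x) := by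
  induction m generalizing s with
  | zero => simp [dt, hf s x hs]
  | succ m ih =>
    rw [dt, iteratedDeriv_succ]
    exact deriv_eq_sd hU (sdL_contDiffOn hU hF _) (fun s hs => ih s hs) s hs

theorem iterate_pd_eq_sdL {U : Set (ℝ × Pt)} (hU : IsOpen U) {F : ℝ × Pt → ℝ}
    (hF : ContDiffOn ℝ ∞ F U) {t : ℝ} {g : Pt → ℝ} (hg : ∀ y, (t, y) ∈ U → g y = F (t, y))
    (k : Fin 3) (n : ℕ) (y : Pt) (hy : (t, y) ∈ U) :
    (pd k)^[n] g y = sdL (List.replicate n (some k)) F (t, y) := by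
  induction n generalizing y with
  | zero => simp [hg y hy]
  | succ n ih =>
    rw [Function.iterate_succ_apply']
    exact pd_eq_sd hU (sdL_contDiffOn hU hF _) ih k y hy

/-- The list of directions that belongs to a spatial multi-index. -/
def mlist (a : Fin 3 → ℕ) : List (Option (Fin 3)) :=
  List.replicate (a 0) (some 0) ++ (List.replicate (a 1) (some 1) ++ List.replicate (a 2) (some 2))

theorem mpd_eq_sdL {U : Set (ℝ × Pt)} (hU : IsOpen U) {F : ℝ × Pt → ℝ}
    (hF : ContDiffOn ℝ ∞ F U) {t : ℝ} {g : Pt → ℝ} (hg : ∀ y, (t, y) ∈ U → g y = F (t, y))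
    (a : Fin 3 → ℕ) (y : Pt) (hy : (t, y) ∈ U) :
    mpd a g y = sdL (mlist a) F (t, y) := by
  rw [mpd, mlist, sdL_append, sdL_append]
  have h₂ := sdL_contDiffOn hU hF (List.replicate (a 2) (some 2))
  exact iterate_pd_eq_sdL hU (sdL_contDiffOn hU h₂ _)
    (iterate_pd_eq_sdL hU h₂ (iterate_pd_eq_sdL hU hF hg 2 (a 2)) 1 (a 1)) 0 (a 0) y hy

/-- The multi-index of the spatial directions in a list. -/
def mcount (L : List (Option (Fin 3))) (k : Fin 3) : ℕ := L.count (some k)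

/-- By symmetry of derivatives every word can be brought to the order used in the energy: time
derivatives innermost, then a spatial multi-index. -/
theorem perm_canonical (L : List (Option (Fin 3))) :
    L.Perm (mlist (mcount L) ++ List.replicate (L.count none) none) := by
  rw [List.perm_iff_count]
  rintro (_ | k)
  · simp [mlist, List.count_replicate]
  · fin_cases k <;> simp [mlist, mcount, List.count_replicate]

theorem ord_mlist (a : Fin 3 → ℕ) : ord (mlist a) = 2 * ∑ k, a k := by
  rw [ord_eq_count]; simp [mlist, List.count_replicate, Fin.sum_univ_three]

theorem ord_replicate_none (m : ℕ) : ord (List.replicate m none) = m := by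
  rw [ord_eq_count]; simp [List.count_replicate]

/-- The list of space-time directions of a list of horizontal directions. -/
def hlist (l : List (Fin 2)) : List (Option (Fin 3)) := l.map fun α => some (hor α)

theorem hlist_append (l l' : List (Fin 2)) : hlist (l ++ l') = hlist l ++ hlist l' := by
  simp [hlist]

theorem isHor_hlist (l : List (Fin 2)) : IsHor (hlist l) := by
  intro j hj
  simp only [hlist, List.mem_map] at hj
  obtain ⟨α, -, rfl⟩ := hj
  fin_cases α <;> simp [hor]

theorem ord_hlist (l : List (Fin 2)) : ord (hlist l) = 2 * l.length := by
  induction l with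
  | nil => rfl
  | cons α l ih =>
    have : hlist (α :: l) = some (hor α) :: hlist l := rfl
    rw [this, ord_cons_some, ih, List.length_cons]; ring

theorem isHor_append {L L' : List (Option (Fin 3))} (h : IsHor L) (h' : IsHor L') :
    IsHor (L ++ L') := by
  intro j hj
  rcases List.mem_append.1 hj with hj | hj
  exacts [h j hj, h' j hj]

theorem isHor_replicate_none (m : ℕ) : IsHor (List.replicate m none) := by
  intro j hj
  simp [List.eq_of_mem_replicate hj]

theorem isHor_cons_hor {L : List (Option (Fin 3))} (h : IsHor L) (α : Fin 2) :
    IsHor (some (hor α) :: L) :=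
  isHor_append (isHor_hlist [α]) h

theorem isHor_cons_none {L : List (Option (Fin 3))} (h : IsHor L) : IsHor (none :: L) :=
  isHor_append (isHor_replicate_none 1) h

theorem IsHor.perm_canonical {L : List (Option (Fin 3))} (h : IsHor L) :
    ∃ l : List (Fin 2), L.Perm (hlist l ++ List.replicate (L.count none) none) := by
  have h2 : L.count (some 2) = 0 := List.count_eq_zero.2 fun hm => h _ hm rfl
  refine ⟨List.replicate (L.count (some 0)) 0 ++ List.replicate (L.count (some 1)) 1, ?_⟩
  rw [List.perm_iff_count]
  rintro (_ | k)
  · simp [hlist, List.count_replicate]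
  · fin_cases k <;> simp [hlist, hor, List.count_replicate, h2]

/-! ### Comparison of the norms with derivatives along words -/

theorem setIntegral_sq_nonneg (s : Set Pt) (g : Pt → ℝ) : 0 ≤ ∫ x in s, g x ^ 2 :=
  integral_nonneg fun _ => sq_nonneg _

theorem tanSq_nonneg (w : Pt → ℝ) (m : ℕ) (g : Pt → ℝ) : 0 ≤ tanSq w m g := by
  induction m generalizing g with
  | zero => exact setIntegral_sq_nonneg _ fun x => w x * g x
  | succ m ih => exact Finset.sum_nonneg fun α _ => ih _

theorem sobSq_nonneg (k : ℕ) (g : Pt → ℝ) : 0 ≤ sobSq k g :=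
  Finset.sum_nonneg fun _ _ => Finset.sum_nonneg fun _ _ => setIntegral_sq_nonneg _ _

theorem measurableSet_cell : MeasurableSet cell := by
  have : cell = ⋂ i, (fun x : Pt => x i) ⁻¹' Ioo (0 : ℝ) 1 := by ext; simp [cell]
  rw [this]
  exact MeasurableSet.iInter fun i => measurable_pi_apply i measurableSet_Ioo

theorem le_tanSq {U : Set (ℝ × Pt)} (hU : IsOpen U) {F : ℝ × Pt → ℝ}
    (hF : ContDiffOn ℝ ∞ F U) {t : ℝ} (hc : ∀ y ∈ cell, (t, y) ∈ U) {g : Pt → ℝ}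
    (hg : ∀ y, (t, y) ∈ U → g y = F (t, y)) (w : Pt → ℝ) (m : ℕ) (l : List (Fin 2))
    (hl : l.length = m) :
    ∫ x in cell, (w x * sdL (hlist l) F (t, x)) ^ 2 ≤ tanSq w m g := by
  induction m generalizing g F l with
  | zero =>
    obtain rfl := List.length_eq_zero_iff.1 hl
    refine le_of_eq (setIntegral_congr_fun measurableSet_cell fun x hx => ?_)
    simp [hlist, hg x (hc x hx)]
  | succ m ih =>
    rcases List.eq_nil_or_concat l with rfl | ⟨l', α, rfl⟩
    · simp at hl
    · have := ih (sd_contDiffOn hU hF (some (hor α)))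
        (fun y hy => pd_eq_sd hU hF hg (hor α) y hy) l' (by simpa using hl)
      rw [tanSq]
      refine le_trans (le_of_eq ?_) (this.trans
        (Finset.single_le_sum (f := fun α => tanSq w m (pd (hor α) g))
          (fun α _ => tanSq_nonneg w m _) (Finset.mem_univ α)))
      rw [List.concat_eq_append, hlist_append, sdL_append]
      rfl

/-- The factor 2 ^ m counts the words of length m in the two horizontal directions. -/
theorem tanSq_le {U : Set (ℝ × Pt)} (hU : IsOpen U) {F : ℝ × Pt → ℝ}
    (hF : ContDiffOn ℝ ∞ F U) {t : ℝ} (hc : ∀ y ∈ cell, (t, y) ∈ U) {g : Pt → ℝ}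
    (hg : ∀ y, (t, y) ∈ U → g y = F (t, y)) (w : Pt → ℝ) (m : ℕ) {B : ℝ}
    (hB : ∀ l : List (Fin 2), l.length = m →
      ∫ x in cell, (w x * sdL (hlist l) F (t, x)) ^ 2 ≤ B) : tanSq w m g ≤ 2 ^ m * B := by
  induction m generalizing g F with
  | zero =>
    refine le_trans (le_of_eq ?_) ((hB [] rfl).trans (by simp))
    refine setIntegral_congr_fun measurableSet_cell fun x hx => ?_
    simp [hlist, hg x (hc x hx)]
  | succ m ih =>
    rw [tanSq]
    have : ∀ α : Fin 2, tanSq w m (pd (hor α) g) ≤ 2 ^ m * B := fun α =>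
      ih (sd_contDiffOn hU hF (some (hor α))) (fun y hy => pd_eq_sd hU hF hg (hor α) y hy)
        fun l hl => by
          refine le_trans (le_of_eq ?_) (hB (l ++ [α]) (by simp [hl]))
          rw [hlist_append, sdL_append]
          rfl
    calc _ ≤ ∑ _α : Fin 2, 2 ^ m * B := Finset.sum_le_sum fun α _ => this α
      _ = 2 ^ (m + 1) * B := by simp; ring

theorem le_sobSq {U : Set (ℝ × Pt)} (hU : IsOpen U) {F : ℝ × Pt → ℝ}
    (hF : ContDiffOn ℝ ∞ F U) {t : ℝ} (hc : ∀ y ∈ cell, (t, y) ∈ U) {g : Pt → ℝ}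
    (hg : ∀ y, (t, y) ∈ U → g y = F (t, y)) (k : ℕ) (a : Fin 3 → ℕ) (ha : ∑ i, a i ≤ k) :
    ∫ x in cell, (sdL (mlist a) F (t, x)) ^ 2 ≤ sobSq k g := by
  have h₁ : ∫ x in cell, (sdL (mlist a) F (t, x)) ^ 2 = ∫ x in cell, (mpd a g x) ^ 2 :=
    setIntegral_congr_fun measurableSet_cell fun x hx => by
      simp [mpd_eq_sdL hU hF hg a x (hc x hx)]
  rw [h₁, sobSq]
  refine le_trans ?_ (Finset.single_le_sum (f := fun j =>
    ∑ a ∈ Finset.piAntidiag (Finset.univ : Finset (Fin 3)) j, ∫ x in cell, (mpd a g x) ^ 2)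
    (fun j _ => Finset.sum_nonneg fun _ _ => setIntegral_sq_nonneg _ _)
    (Finset.mem_range.2 (Nat.lt_succ_of_le ha)))
  exact Finset.single_le_sum (f := fun a => ∫ x in cell, (mpd a g x) ^ 2)
    (fun _ _ => setIntegral_sq_nonneg _ _) (by simp)

/-- The number of multi-indices of order at most `k`. -/
def sobCard (k : ℕ) : ℝ :=
  ∑ j ∈ Finset.range (k + 1), ((Finset.piAntidiag (Finset.univ : Finset (Fin 3)) j).card : ℝ)

theorem sobCard_nonneg (k : ℕ) : 0 ≤ sobCard k := Finset.sum_nonneg fun _ _ => by positivity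

theorem sobSq_le {U : Set (ℝ × Pt)} (hU : IsOpen U) {F : ℝ × Pt → ℝ}
    (hF : ContDiffOn ℝ ∞ F U) {t : ℝ} (hc : ∀ y ∈ cell, (t, y) ∈ U) {g : Pt → ℝ}
    (hg : ∀ y, (t, y) ∈ U → g y = F (t, y)) (k : ℕ) {B : ℝ}
    (hB : ∀ a : Fin 3 → ℕ, ∑ i, a i ≤ k → ∫ x in cell, (sdL (mlist a) F (t, x)) ^ 2 ≤ B) :
    sobSq k g ≤ sobCard k * B := by
  rw [sobSq, sobCard, Finset.sum_mul]
  refine Finset.sum_le_sum fun j hj => ?_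
  rw [← nsmul_eq_mul]
  refine Finset.sum_le_card_nsmul _ _ _ fun a ha => ?_
  refine le_trans (le_of_eq ?_) (hB a ?_)
  · exact setIntegral_congr_fun measurableSet_cell fun x hx => by
      simp [mpd_eq_sdL hU hF hg a x (hc x hx)]
  · have := (Finset.mem_piAntidiag.1 ha).1
    rw [this]
    exact Nat.lt_succ_iff.1 (Finset.mem_range.1 hj)

/-! ### Identities that hold in the slab -/

theorem sdL_eqOn_zero {O : Set (ℝ × Pt)} (hO : IsOpen O) {F : ℝ × Pt → ℝ}
    (h : ∀ p ∈ O, F p = 0) (L : List (Option (Fin 3))) : ∀ p ∈ O, sdL L F p = 0 := by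
  induction L with
  | nil => exact h
  | cons j L ih =>
    intro p hp
    have : sdL L F =ᶠ[nhds p] fun _ => 0 := Filter.mem_of_superset (hO.mem_nhds hp) ih
    simp [sd, this.fderiv_eq]

theorem isOpen_slab : IsOpen slab := isOpen_Ioo.preimage (continuous_apply 2)

theorem closure_slab : closedSlab ⊆ closure slab := by
  have : closure ((fun x : Pt => x 2) ⁻¹' Ioo (0 : ℝ) 1) = (fun x : Pt => x 2) ⁻¹' closure (Ioo 0 1) :=
    ((isOpenMap_eval 2).preimage_closure_eq_closure_preimage (continuous_apply 2) _).symm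
  intro x hx
  rw [closure_Ioo (by norm_num)] at this
  change x ∈ closure ((fun x : Pt => x 2) ⁻¹' Ioo (0 : ℝ) 1)
  rw [this]
  exact hx

theorem cell_subset_slab : cell ⊆ slab := fun _ hx => hx 2

theorem slab_subset_closedSlab : slab ⊆ closedSlab := fun _ hx => Ioo_subset_Icc_self hx

/-- Derivatives of a function that vanishes on an open set vanish there, and by continuity on the
closure. This carries every consequence of the momentum equation to t = 0, where the equation is not
assumed, and to the boundary faces. -/
theorem sdL_eq_zero_of_slab {T : ℝ} (hT : 0 < T) {F : ℝ × Pt → ℝ} (hF : ContDiff ℝ ∞ F)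
    (h : ∀ t ∈ Ioo 0 T, ∀ x ∈ slab, F (t, x) = 0) (L : List (Option (Fin 3))) :
    ∀ t ∈ Icc 0 T, ∀ x ∈ closedSlab, sdL L F (t, x) = 0 := by
  intro t ht x hx
  have h₁ := sdL_eqOn_zero (isOpen_Ioo.prod isOpen_slab) (F := F)
    (fun p hp => h p.1 hp.1 p.2 hp.2) L
  have h₂ : (t, x) ∈ closure (Ioo 0 T ×ˢ slab) := by
    rw [closure_prod_eq, closure_Ioo hT.ne]
    exact ⟨ht, closure_slab hx⟩
  have h₃ : IsClosed {p | sdL L F p = 0} :=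
    isClosed_eq (sdL_contDiff hF L).continuous continuous_const
  exact closure_minimal h₁ h₃ h₂

theorem sdL_translate (F : ℝ × Pt → ℝ) (e : Pt) (L : List (Option (Fin 3))) :
    sdL L (fun p => F (p.1, p.2 + e)) = fun p => sdL L F (p.1, p.2 + e) := by
  have h : ∀ G : ℝ × Pt → ℝ, (fun p : ℝ × Pt => G (p.1, p.2 + e)) = fun p => G (p + (0, e)) := by
    intro G; ext p; congr 1; ext <;> simp
  rw [h, h]
  induction L with
  | nil => rfl
  | cons j L ih =>
    ext p
    simp only [sdL_cons, ih, sd]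
    rw [fderiv_comp_add_right]

theorem sdL_const (c : ℝ) {L : List (Option (Fin 3))} (hL : L ≠ []) :
    sdL L (fun _ => c) = 0 := by
  obtain ⟨j, L, rfl⟩ := List.exists_cons_of_ne_nil hL
  have : ∀ L : List (Option (Fin 3)), ∃ c', sdL L (fun _ => c) = fun _ => c' := by
    intro L
    induction L with
    | nil => exact ⟨c, rfl⟩
    | cons j L ih => obtain ⟨c', h⟩ := ih; exact ⟨0, by ext; simp [h, sd]⟩
  obtain ⟨c', h⟩ := this L
  ext; simp [h, sd]

/-! ### Integration over the period cell -/

theorem cell_eq_pi : cell = Set.univ.pi fun _ => Ioo (0 : ℝ) 1 := by ext; simp [cell]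

theorem volume_restrict_cell :
    (volume.restrict cell : Measure Pt) = Measure.pi fun _ => volume.restrict (Ioo (0 : ℝ) 1) := by
  rw [cell_eq_pi, volume_pi, Measure.restrict_pi_pi]

theorem isProbabilityMeasure_Ioo : IsProbabilityMeasure (volume.restrict (Ioo (0 : ℝ) 1)) :=
  ⟨by simp⟩

theorem isProbabilityMeasure_cell : IsProbabilityMeasure (volume.restrict cell : Measure Pt) := by
  have := isProbabilityMeasure_Ioo
  rw [volume_restrict_cell]
  infer_instance

theorem cell_subset_Icc : cell ⊆ Icc (0 : Pt) 1 := fun _ hx =>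
  ⟨fun i => (hx i).1.le, fun i => (hx i).2.le⟩

theorem integrableOn_cell {f : Pt → ℝ} (hf : Continuous f) : IntegrableOn f cell :=
  (hf.continuousOn.integrableOn_compact isCompact_Icc).mono_set cell_subset_Icc

theorem setIntegral_cell_mono {f g : Pt → ℝ} (hf : Continuous f) (hg : Continuous g)
    (h : ∀ x ∈ cell, f x ≤ g x) : ∫ x in cell, f x ≤ ∫ x in cell, g x :=
  setIntegral_mono_on (integrableOn_cell hf) (integrableOn_cell hg) measurableSet_cell h

theorem setIntegral_cell_const (c : ℝ) : ∫ _ in cell, c = c := by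
  have := isProbabilityMeasure_cell
  simp [measureReal_def, cell_eq_pi, volume_pi]

theorem pd_contDiff {g : Pt → ℝ} (hg : ContDiff ℝ ∞ g) (k : Fin 3) : ContDiff ℝ ∞ (pd k g) :=
  (hg.fderiv_right (m := ∞) (by simp)).clm_apply contDiff_const

theorem cauchySchwarz_cell {a b : Pt → ℝ} (ha : Continuous a) (hb : Continuous b) :
    (∫ x in cell, a x * b x) ^ 2 ≤ (∫ x in cell, a x ^ 2) * ∫ x in cell, b x ^ 2 := by
  have h : ∀ l : ℝ, 0 ≤ (∫ x in cell, b x ^ 2) * (l * l) + (2 * ∫ x in cell, a x * b x) * l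
      + ∫ x in cell, a x ^ 2 := by
    intro l
    have h₁ : ∫ x in cell, (a x + l * b x) ^ 2 = (∫ x in cell, b x ^ 2) * (l * l)
        + (2 * ∫ x in cell, a x * b x) * l + ∫ x in cell, a x ^ 2 := by
      rw [← integral_mul_const, ← integral_const_mul, ← integral_mul_const, ← integral_add,
        ← integral_add]
      · congr 1; ext x; ring
      all_goals exact integrableOn_cell (by fun_prop)
    rw [← h₁]
    exact setIntegral_sq_nonneg _ _
  have := discrim_le_zero h
  rw [discrim] at this
  nlinarith

/-! ### Sobolev inequalities on the cell -/

theorem hasDerivAt_slice {g : Pt → ℝ} (hg : ContDiff ℝ ∞ g) (x : Pt) (i : Fin 3) (s : ℝ) :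
    HasDerivAt (fun s => g (Function.update x i s)) (pd i g (Function.update x i s)) s :=
  ((contDiff_differentiable hg _).hasFDerivAt).comp_hasDerivAt s (hasDerivAt_update x i s)

/-- The value of a function at a point of the unit interval is at most the integral of the function
plus the integral of the modulus of its derivative. -/
theorem le_integral_add_abs_deriv {φ φ' : ℝ → ℝ} (h : ∀ s, HasDerivAt φ (φ' s) s)
    (hφ' : Continuous φ') {s : ℝ} (hs : s ∈ Ioo (0 : ℝ) 1) :
    φ s ≤ ∫ r in Ioo (0 : ℝ) 1, (φ r + |φ' r|) := by
  have hφ : Continuous φ := continuous_iff_continuousAt.2 fun s => (h s).continuousAt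
  have hint : ∀ {f : ℝ → ℝ}, Continuous f → IntegrableOn f (Ioo (0 : ℝ) 1) := fun hf =>
    (hf.continuousOn.integrableOn_compact isCompact_Icc).mono_set Ioo_subset_Icc_self
  have h₁ : ∀ r ∈ Ioo (0 : ℝ) 1, φ s - ∫ u in Ioo (0 : ℝ) 1, |φ' u| ≤ φ r := by
    intro r hr
    have h₂ : ∫ u in r..s, φ' u = φ s - φ r :=
      intervalIntegral.integral_eq_sub_of_hasDerivAt (fun u _ => h u)
        (hφ'.intervalIntegrable _ _)
    have h₃ : |∫ u in r..s, φ' u| ≤ ∫ u in Ioo (0 : ℝ) 1, |φ' u| := by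
      rw [← Real.norm_eq_abs]
      refine intervalIntegral.norm_integral_le_integral_norm_uIoc.trans ?_
      refine setIntegral_mono_set (hint hφ'.abs) (ae_of_all _ fun _ => abs_nonneg _) ?_
      refine LE.le.eventuallyLE fun u hu => ?_
      rw [uIoc, mem_Ioc] at hu
      exact ⟨lt_of_le_of_lt (le_min hr.1.le hs.1.le) hu.1, lt_of_le_of_lt hu.2 (max_lt hr.2 hs.2)⟩
    have := le_abs_self (∫ u in r..s, φ' u)
    linarith
  have h₄ : ∫ _ in Ioo (0 : ℝ) 1, (φ s - ∫ u in Ioo (0 : ℝ) 1, |φ' u|) ≤ ∫ r in Ioo (0 : ℝ) 1, φ r :=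
    setIntegral_mono_on (hint continuous_const) (hint hφ) measurableSet_Ioo h₁
  rw [integral_add (hint hφ) (hint hφ'.abs)]
  simp at h₄
  linarith

/-- This replaces the value of g by an integral along the line in direction i, the form of factor
that the Loomis-Whitney argument requires. No boundary condition is needed, since the function
itself appears next to its derivative. -/
theorem slice_le_lintegral {g f : Pt → ℝ} (hg : ContDiff ℝ ∞ g) (hf : Continuous f) (i : Fin 3)
    (h : ∀ x, g x + |pd i g x| ≤ f x) (hf0 : ∀ x, 0 ≤ f x) {x : Pt} (hx : x ∈ cell) :
    ENNReal.ofReal (g x)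
      ≤ ∫⁻ s in Ioo (0 : ℝ) 1, ENNReal.ofReal (f (Function.update x i s)) := by
  have hu : Continuous fun s : ℝ => Function.update x i s := continuous_const.update i continuous_id
  have h₁ := le_integral_add_abs_deriv (hasDerivAt_slice hg x i)
    ((pd_contDiff hg i).continuous.comp hu) (hx i)
  rw [Function.update_eq_self] at h₁
  have hint : ∀ {f : ℝ → ℝ}, Continuous f → IntegrableOn f (Ioo (0 : ℝ) 1) := fun hf =>
    (hf.continuousOn.integrableOn_compact isCompact_Icc).mono_set Ioo_subset_Icc_self
  rw [← ofReal_integral_eq_lintegral_ofReal (f := fun s => f (Function.update x i s))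
    (hint (hf.comp hu)) (ae_of_all _ fun _ => hf0 _)]
  refine ENNReal.ofReal_le_ofReal (h₁.trans ?_)
  refine integral_mono (hint ?_) (hint (hf.comp hu)) fun s => h _
  exact (hg.continuous.comp hu).add ((pd_contDiff hg i).continuous.comp hu).abs

/-- A Loomis-Whitney inequality on the cell. -/
theorem loomisWhitney_cell {Φ : Fin 3 → Pt → ℝ} {f G : Pt → ℝ} (hΦ : ∀ i, ContDiff ℝ ∞ (Φ i))
    (hf : Continuous f) (hG : Continuous G) (hΦ0 : ∀ i x, 0 ≤ Φ i x) (hG0 : ∀ x, 0 ≤ G x)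
    (h : ∀ i x, Φ i x + |pd i (Φ i) x| ≤ f x) (hGΦ : ∀ x, G x ^ 2 ≤ ∏ i, Φ i x) :
    (∫ x in cell, G x) ^ 2 ≤ (∫ x in cell, f x) ^ 3 := by
  have := isProbabilityMeasure_Ioo
  have hf0 : ∀ x, 0 ≤ f x := fun x => (add_nonneg (hΦ0 0 x) (abs_nonneg _)).trans (h 0 x)
  -- In dimension 3 the grid-lines inequality has exponent 3/2, and each line integral enters to the
  -- power 1/(3 - 1) = 1/2.
  have hp : Real.HolderConjugate (Fintype.card (Fin 3)) (3 / 2) := by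
    rw [Real.holderConjugate_iff]; norm_num
  have key := lintegral_prod_lintegral_pow_le (fun _ : Fin 3 => volume.restrict (Ioo (0 : ℝ) 1)) hp
    (f := fun x => ENNReal.ofReal (f x)) (by fun_prop)
  rw [← volume_restrict_cell] at key
  have h₁ : ∫⁻ x in cell, ENNReal.ofReal (G x) ≤ (∫⁻ x in cell, ENNReal.ofReal (f x)) ^ (3 / 2 : ℝ) := by
    refine le_trans (setLIntegral_mono' measurableSet_cell fun x hx => ?_) key
    have h₂ : ENNReal.ofReal (G x) ≤ ∏ i, (ENNReal.ofReal (Φ i x)) ^ (1 / 2 : ℝ) := by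
      have h₃ : G x ≤ ∏ i, (Φ i x) ^ (1 / 2 : ℝ) := by
        rw [Real.finsetProd_rpow _ _ (fun i _ => hΦ0 i x), ← Real.sqrt_eq_rpow]
        exact Real.le_sqrt_of_sq_le (hGΦ x)
      refine (ENNReal.ofReal_le_ofReal h₃).trans (le_of_eq ?_)
      rw [ENNReal.ofReal_prod_of_nonneg fun i _ => Real.rpow_nonneg (hΦ0 i x) _]
      refine Finset.prod_congr rfl fun i _ => ?_
      rw [ENNReal.ofReal_rpow_of_nonneg (hΦ0 i x) (by norm_num)]
    refine h₂.trans (Finset.prod_le_prod' fun i _ => ?_)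
    have h₄ : (1 : ℝ) / ((Fintype.card (Fin 3) : ℝ) - 1) = 1 / 2 := by norm_num
    rw [h₄]
    exact ENNReal.rpow_le_rpow (slice_le_lintegral (hΦ i) hf i (h i) hf0 hx) (by norm_num)
  rw [← ofReal_integral_eq_lintegral_ofReal (integrableOn_cell hG) (ae_of_all _ hG0),
    ← ofReal_integral_eq_lintegral_ofReal (integrableOn_cell hf) (ae_of_all _ hf0),
    ENNReal.ofReal_rpow_of_nonneg (integral_nonneg hf0) (by norm_num),
    ENNReal.ofReal_le_ofReal_iff (Real.rpow_nonneg (integral_nonneg hf0) _)] at h₁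
  have h₅ : 0 ≤ ∫ x in cell, f x := integral_nonneg hf0
  calc (∫ x in cell, G x) ^ 2 ≤ ((∫ x in cell, f x) ^ (3 / 2 : ℝ)) ^ 2 :=
        pow_le_pow_left₀ (integral_nonneg hG0) h₁ 2
    _ = (∫ x in cell, f x) ^ 3 := by
        rw [← Real.rpow_natCast, ← Real.rpow_mul h₅, ← Real.rpow_natCast]; norm_num

/-- The squared `H¹` norm. -/
def hOne (g : Pt → ℝ) : ℝ := (∫ x in cell, g x ^ 2) + ∑ k, ∫ x in cell, pd k g x ^ 2

theorem hOne_nonneg (g : Pt → ℝ) : 0 ≤ hOne g :=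
  add_nonneg (setIntegral_sq_nonneg _ _) (Finset.sum_nonneg fun _ _ => setIntegral_sq_nonneg _ _)

theorem pd_pow {g : Pt → ℝ} (hg : ContDiff ℝ ∞ g) (n : ℕ) (k : Fin 3) (x : Pt) :
    pd k (fun x => g x ^ n) x = n * g x ^ (n - 1) * pd k g x := by
  rw [pd, fderiv_fun_pow n (contDiff_differentiable hg x)]
  simp [pd, mul_assoc]

/-- The Sobolev embedding of `H¹` into `L⁶` on the cell. -/
theorem integral_pow_six_le {g : Pt → ℝ} (hg : ContDiff ℝ ∞ g) :
    ∫ x in cell, g x ^ 6 ≤ 64 ^ 3 * hOne g ^ 3 := by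
  have hc : Continuous g := hg.continuous
  have hd : ∀ k, Continuous (pd k g) := fun k => (pd_contDiff hg k).continuous
  set b : Pt → ℝ := fun x => |g x| + 4 * ∑ k, |pd k g x| with hb
  have hbc : Continuous b := by fun_prop
  -- With Φ_i = g⁴ for all i one has G = g⁶ and G² = Φ₀Φ₁Φ₂. Since ∂g⁴ = 4g³∂g, the dominating
  -- function is |g|³ times a quantity whose square is controlled by H¹.
  have hLW := loomisWhitney_cell (Φ := fun _ x => g x ^ 4) (f := fun x => |g x| ^ 3 * b x)
    (G := fun x => g x ^ 6) (fun _ => hg.pow 4) (by fun_prop) (by fun_prop)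
    (fun _ x => by positivity) (fun x => by positivity) (by
      intro i x
      rw [pd_pow hg, hb, abs_mul, abs_mul, abs_pow]
      have h₁ : |pd i g x| ≤ ∑ k, |pd k g x| :=
        Finset.single_le_sum (f := fun k => |pd k g x|) (fun _ _ => abs_nonneg _) (Finset.mem_univ i)
      have h₂ : g x ^ 4 = |g x| ^ 3 * |g x| := by
        rw [← pow_succ, Even.pow_abs (by decide)]
      have h₃ := mul_le_mul_of_nonneg_left h₁ (pow_nonneg (abs_nonneg (g x)) 3)
      simp only [h₂, Nat.cast_ofNat, Nat.abs_ofNat, Nat.add_one_sub_one]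
      nlinarith) (fun x => by simp; ring_nf; rfl)
  have hCS := cauchySchwarz_cell (a := fun x => |g x| ^ 3) (b := b) (by fun_prop) hbc
  have h6 : ∀ x, (|g x| ^ 3) ^ 2 = g x ^ 6 := fun x => by
    rw [← pow_mul, Even.pow_abs (by decide)]
  simp only [h6] at hCS
  have hB : ∫ x in cell, b x ^ 2 ≤ 64 * hOne g := by
    have h₁ : 64 * hOne g = ∫ x in cell, (64 * (g x ^ 2 + ∑ k, pd k g x ^ 2)) := by
      rw [integral_const_mul, integral_add (integrableOn_cell (by fun_prop))
        (integrableOn_cell (by fun_prop)), integral_finsetSum _ fun k _ =>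
        integrableOn_cell (f := fun x => pd k g x ^ 2) (by fun_prop), hOne]
    rw [h₁]
    refine setIntegral_cell_mono (by fun_prop) (by fun_prop) fun x _ => ?_
    simp only [hb, Fin.sum_univ_three, ← sq_abs (g x), ← sq_abs (pd _ g x)]
    nlinarith [sq_nonneg (4 * |g x| - |pd 0 g x|), sq_nonneg (4 * |g x| - |pd 1 g x|),
      sq_nonneg (4 * |g x| - |pd 2 g x|), sq_nonneg (|pd 0 g x| - |pd 1 g x|),
      sq_nonneg (|pd 0 g x| - |pd 2 g x|), sq_nonneg (|pd 1 g x| - |pd 2 g x|)]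
  set N := ∫ x in cell, g x ^ 6 with hN
  set M := ∫ x in cell, |g x| ^ 3 * b x with hM
  have hN0 : 0 ≤ N := integral_nonneg fun x => by positivity
  have hH0 := hOne_nonneg g
  have hM2 : M ^ 2 ≤ N * (64 * hOne g) := hCS.trans (mul_le_mul_of_nonneg_left hB hN0)
  -- Loomis-Whitney gives N² ≤ M³ and Cauchy-Schwarz gives M² ≤ 64 N · `hOne g`. Together they bound
  -- N⁴ by N³ times the desired right side, and N³ is cancelled when N ≠ 0.
  have hN4 : N ^ 4 ≤ N ^ 3 * (64 ^ 3 * hOne g ^ 3) := by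
    calc N ^ 4 = (N ^ 2) ^ 2 := by ring
      _ ≤ (M ^ 3) ^ 2 := pow_le_pow_left₀ (by positivity) hLW 2
      _ = (M ^ 2) ^ 3 := by ring
      _ ≤ (N * (64 * hOne g)) ^ 3 := pow_le_pow_left₀ (by positivity) hM2 3
      _ = _ := by ring
  rcases hN0.eq_or_lt with h0 | h0
  · rw [← h0]; positivity
  · have : N ^ 3 * N ≤ N ^ 3 * (64 ^ 3 * hOne g ^ 3) := by rw [← pow_succ]; exact hN4
    exact le_of_mul_le_mul_left this (by positivity)

/-- The product of a function with horizontal derivatives in `L²` and a function in `H¹` is in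
`L²`. -/
theorem integral_hor_mul_le {h g : Pt → ℝ} (hh : ContDiff ℝ ∞ h) (hg : ContDiff ℝ ∞ g) :
    (∫ x in cell, (h x * g x) ^ 2) ^ 2 ≤
      (2 * (∫ x in cell, h x ^ 2) + (∫ x in cell, pd 0 h x ^ 2) + (∫ x in cell, pd 1 h x ^ 2)
        + (1 + ∫ x in cell, h x ^ 2) + 5 * (∫ x in cell, g x ^ 6) + 10 * hOne g) ^ 3 := by
  have hhc := hh.continuous
  have hgc := hg.continuous
  have hhd : ∀ k, Continuous (pd k h) := fun k => (pd_contDiff hh k).continuous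
  have hgd : ∀ k, Continuous (pd k g) := fun k => (pd_contDiff hg k).continuous
  set f : Pt → ℝ := fun x => (2 * h x ^ 2 + pd 0 h x ^ 2 + pd 1 h x ^ 2 + (1 + h x ^ 2))
    + 5 * g x ^ 6 + 10 * (g x ^ 2 + ∑ k, pd k g x ^ 2) with hf
  have hint : ∫ x in cell, f x = 2 * (∫ x in cell, h x ^ 2) + (∫ x in cell, pd 0 h x ^ 2)
      + (∫ x in cell, pd 1 h x ^ 2)
        + (1 + ∫ x in cell, h x ^ 2) + 5 * (∫ x in cell, g x ^ 6) + 10 * hOne g := by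
    have hs : ∫ x in cell, (g x ^ 2 + ∑ k, pd k g x ^ 2) = hOne g := by
      rw [integral_add (integrableOn_cell (by fun_prop))
        (integrableOn_cell (by fun_prop)), integral_finsetSum _ fun k _ =>
        integrableOn_cell (f := fun x => pd k g x ^ 2) (by fun_prop), hOne]
    rw [← hs]
    simp only [hf]
    rw [integral_add (integrableOn_cell (by fun_prop)) (integrableOn_cell (by fun_prop)),
      integral_add (integrableOn_cell (by fun_prop)) (integrableOn_cell (by fun_prop)),
      integral_add (integrableOn_cell (by fun_prop)) (integrableOn_cell (by fun_prop)),
      integral_add (integrableOn_cell (by fun_prop)) (integrableOn_cell (by fun_prop)),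
      integral_add (integrableOn_cell (by fun_prop)) (integrableOn_cell (by fun_prop)),
      integral_add (integrableOn_cell (by fun_prop)) (integrableOn_cell (by fun_prop)),
      integral_const_mul, integral_const_mul, integral_const_mul, setIntegral_cell_const]
  rw [← hint]
  -- The factors h², h², g⁴ have product (h²g²)². The function h is differentiated only in the two
  -- horizontal directions, and g⁴ takes the vertical one, which is why no vertical derivative of h
  -- is needed.
  refine loomisWhitney_cell
    (Φ := ![fun x => h x ^ 2, fun x => h x ^ 2, fun x => g x ^ 4]) ?_ (by fun_prop)
    (by fun_prop) ?_ (fun x => sq_nonneg _) ?_ ?_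
  · intro i; fin_cases i
    exacts [hh.pow 2, hh.pow 2, hg.pow 4]
  · intro i x; fin_cases i <;> simp <;> positivity
  · have hh2 : ∀ k x, |pd k (fun x => h x ^ 2) x| ≤ h x ^ 2 + pd k h x ^ 2 := by
      intro k x
      rw [pd_pow hh, abs_le]
      constructor <;> simp <;> nlinarith [sq_nonneg (h x + pd k h x), sq_nonneg (h x - pd k h x)]
    have h0 : ∀ x, 0 ≤ 5 * g x ^ 6 + 10 * (g x ^ 2 + ∑ k, pd k g x ^ 2) := fun x => by positivity
    intro i x; fin_cases i
    · have := hh2 0 x; have := h0 x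
      simp only [hf, Fin.zero_eta, Matrix.cons_val_zero]
      nlinarith [sq_nonneg (pd 1 h x), sq_nonneg (h x)]
    · have := hh2 1 x; have := h0 x
      simp only [hf, Fin.mk_one, Matrix.cons_val_one, Matrix.cons_val_zero]
      nlinarith [sq_nonneg (pd 0 h x), sq_nonneg (h x)]
    · simp only [hf, Fin.reduceFinMk, Matrix.cons_val]
      rw [pd_pow hg]
      have h₁ : |((4 : ℕ) : ℝ) * g x ^ (4 - 1) * pd 2 g x| ≤ 2 * (g x ^ 6 + pd 2 g x ^ 2) := by
        rw [abs_le]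
        constructor <;> simp <;>
          nlinarith [sq_nonneg (g x ^ 3 + pd 2 g x), sq_nonneg (g x ^ 3 - pd 2 g x)]
      have h₂ : g x ^ 4 ≤ g x ^ 6 + g x ^ 2 := by
        nlinarith [mul_nonneg (sq_nonneg (g x)) (sq_nonneg (g x ^ 2 - 1)), sq_nonneg (g x)]
      simp only [Fin.sum_univ_three]
      nlinarith [sq_nonneg (h x), sq_nonneg (pd 0 h x), sq_nonneg (pd 1 h x), sq_nonneg (g x),
        sq_nonneg (pd 0 g x), sq_nonneg (pd 1 g x), sq_nonneg (pd 2 g x), sq_nonneg (g x ^ 3)]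
  · intro x
    simp [Fin.prod_univ_three]
    ring_nf; rfl

theorem fderiv_eq_sum_pd (g : Pt → ℝ) (z v : Pt) :
    fderiv ℝ g z v = ∑ k, v k * pd k g z := by
  have : v = ∑ k, v k • unitVec k := by
    ext i
    simp [unitVec, Finset.sum_apply, Pi.single_apply]
  conv_lhs => rw [this]
  simp [pd]

theorem cell_scale_mem {x y : Pt} (hx : x ∈ cell) (hy : y ∈ cell) {r : ℝ} (h0 : 0 ≤ r)
    (h1 : r ≤ 1) : x + r ^ 2 • (y - x) ∈ cell := by
  intro i
  have hr : r ^ 2 ≤ 1 := pow_le_one₀ h0 h1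
  have hr0 := sq_nonneg r
  obtain ⟨h₁, h₂⟩ := hx i
  obtain ⟨h₃, h₄⟩ := hy i
  simp only [Pi.add_apply, Pi.smul_apply, Pi.sub_apply, smul_eq_mul]
  rcases hr.eq_or_lt with h | h
  · rw [h]; constructor <;> linarith
  · constructor <;> nlinarith

/-- Contraction towards x by the factor r² maps the convex cell into itself and has Jacobian r⁶ in
dimension 3. The parameter r², rather than r, makes this Jacobian a sixth power of r. -/
theorem integral_cell_scale_le {φ : Pt → ℝ} (hφ : Continuous φ) (h0 : ∀ x, 0 ≤ φ x) {x : Pt}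
    (hx : x ∈ cell) {r : ℝ} (hr0 : 0 ≤ r) (hr1 : r ≤ 1) :
    ∫ y in cell, r ^ 6 * φ (x + r ^ 2 • (y - x)) ≤ ∫ y in cell, φ y := by
  rcases hr0.eq_or_lt with rfl | hr
  · simpa using integral_nonneg h0
  have hr2 : r ^ 2 ≠ 0 := by positivity
  set ψ : Pt → ℝ := cell.indicator φ with hψ
  have hψi : Integrable ψ := (integrableOn_cell hφ).integrable_indicator measurableSet_cell
  set c : Pt := x - r ^ 2 • x with hc
  have hz : ∀ y, x + r ^ 2 • (y - x) = r ^ 2 • y + c := by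
    intro y; rw [hc, smul_sub]; abel
  have hi : Integrable (fun y => ψ (r ^ 2 • y + c)) :=
    (hψi.comp_add_right c).comp_smul hr2
  have h₁ : ∫ y in cell, φ (x + r ^ 2 • (y - x)) ≤ ∫ y, ψ (r ^ 2 • y + c) := by
    rw [← integral_indicator measurableSet_cell]
    refine integral_mono ((integrableOn_cell (by fun_prop)).integrable_indicator
      measurableSet_cell) hi fun y => ?_
    by_cases hy : y ∈ cell
    · have := cell_scale_mem hx hy hr0 hr1
      rw [hz] at this
      simp [hψ, hy, this, hz]
    · simp only [hy, not_false_eq_true, indicator_of_notMem, hψ]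
      exact indicator_nonneg (fun _ _ => h0 _) _
  have h₂ : ∫ y, ψ (r ^ 2 • y + c) = (r ^ 6)⁻¹ * ∫ y in cell, φ y := by
    rw [Measure.integral_comp_smul volume (fun u => ψ (u + c)) (r ^ 2),
      integral_add_right_eq_self ψ c, hψ, integral_indicator measurableSet_cell]
    simp only [Module.finrank_fin_fun, smul_eq_mul]
    rw [abs_of_nonneg (by positivity)]
    ring
  rw [integral_const_mul]
  calc r ^ 6 * ∫ y in cell, φ (x + r ^ 2 • (y - x)) ≤ r ^ 6 * ((r ^ 6)⁻¹ * ∫ y in cell, φ y) := by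
        rw [← h₂]; exact mul_le_mul_of_nonneg_left h₁ (by positivity)
    _ = _ := by field_simp

theorem abs_le_one_add_pow_six (a : ℝ) : |a| ≤ 1 + a ^ 6 := by
  rw [← Even.pow_abs (by decide : Even 6)]
  rcases le_total |a| 1 with h | h
  · have : 0 ≤ |a| ^ 6 := by positivity
    linarith
  · have := le_self_pow₀ h (n := 6) (by norm_num)
    linarith

/-- A Morrey estimate on the cell. -/
theorem abs_le_of_gradient_six {g : Pt → ℝ} (hg : ContDiff ℝ ∞ g) {x : Pt} (hx : x ∈ cell) :
    |g x| ≤ 7 + (∫ y in cell, g y ^ 2) + 2 * ∑ k, ∫ y in cell, pd k g y ^ 6 := by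
  have hgc := hg.continuous
  have hgd : ∀ k, Continuous (pd k g) := fun k => (pd_contDiff hg k).continuous
  -- Along this path the derivative of g is 2r (y - x)·∇g. The factor r, raised to the sixth power,
  -- cancels the Jacobian of the contraction, so the integral over y and r is bounded by the sixth
  -- power integrals of ∇g.
  set z : Pt → ℝ → Pt := fun y r => x + r ^ 2 • (y - x) with hz
  set Ψ : Pt → ℝ → ℝ := fun y r => ∑ k, 2 * (1 + r ^ 6 * pd k g (z y r) ^ 6) with hΨ
  have hΨc : Continuous (Function.uncurry Ψ) := by
    simp only [hΨ, hz]; fun_prop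
  have h₁ : ∀ y ∈ cell, |g y - g x| ≤ ∫ r in (0 : ℝ)..1, Ψ y r := by
    intro y hy
    set φ' : ℝ → ℝ := fun r => ∑ k, (2 * r * (y k - x k)) * pd k g (z y r) with hφ'
    have hφc : Continuous φ' := by simp only [hφ', hz]; fun_prop
    have hd : ∀ r, HasDerivAt (fun r => g (z y r)) (φ' r) r := by
      intro r
      have h₂ : HasDerivAt (z y) ((2 * r) • (y - x)) r := by
        have := ((hasDerivAt_pow 2 r).smul_const (y - x)).const_add x
        simpa [hz] using this
      have h₃ := (contDiff_differentiable hg (z y r)).hasFDerivAt.comp_hasDerivAt r h₂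
      rw [fderiv_eq_sum_pd] at h₃
      simp only [Pi.smul_apply, Pi.sub_apply, smul_eq_mul] at h₃
      exact h₃
    have h₄ : ∫ r in (0 : ℝ)..1, φ' r = g y - g x := by
      rw [intervalIntegral.integral_eq_sub_of_hasDerivAt (fun r _ => hd r)
        (hφc.intervalIntegrable _ _)]
      simp [hz]
    rw [← h₄]
    refine (intervalIntegral.abs_integral_le_integral_abs zero_le_one).trans ?_
    refine intervalIntegral.integral_mono_on zero_le_one (hφc.abs.intervalIntegrable _ _)
      (Continuous.intervalIntegrable (by simp only [hΨ, hz]; fun_prop) _ _) fun r hr => ?_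
    refine (Finset.abs_sum_le_sum_abs _ _).trans (Finset.sum_le_sum fun k _ => ?_)
    have h₅ := abs_le_one_add_pow_six (r * pd k g (z y r))
    have h₆ : |y k - x k| ≤ 1 := by
      rw [abs_le]; constructor <;> linarith [(hx k).1, (hx k).2, (hy k).1, (hy k).2]
    have h₇ : (2 * r * (y k - x k)) * pd k g (z y r) = 2 * ((r * pd k g (z y r)) * (y k - x k)) := by
      ring
    rw [h₇, abs_mul, abs_mul, Nat.abs_ofNat]
    have := mul_le_mul h₅ h₆ (abs_nonneg _) (by positivity)
    rw [mul_pow] at this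
    linarith
  have h₂ : ∫ y in cell, |g y - g x| ≤ ∑ k, 2 * (1 + ∫ y in cell, pd k g y ^ 6) := by
    have hint : Integrable (Function.uncurry Ψ)
        ((volume.restrict cell).prod (volume.restrict (Ioc (0 : ℝ) 1))) := by
      rw [Measure.prod_restrict]
      refine (hΨc.continuousOn.integrableOn_compact
        (isCompact_Icc.prod isCompact_Icc)).mono_set (prod_mono cell_subset_Icc Ioc_subset_Icc_self)
    have hcΨ : ∀ r, Continuous fun y => Ψ y r := fun r => by simp only [hΨ, hz]; fun_prop
    calc ∫ y in cell, |g y - g x| ≤ ∫ y in cell, ∫ r in Ioc (0 : ℝ) 1, Ψ y r := by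
          refine setIntegral_mono_on (integrableOn_cell (by fun_prop)) hint.integral_prod_left
            measurableSet_cell fun y hy => ?_
          rw [← intervalIntegral.integral_of_le zero_le_one]
          exact h₁ y hy
      _ = ∫ r in Ioc (0 : ℝ) 1, ∫ y in cell, Ψ y r := integral_integral_swap hint
      _ ≤ ∫ _ in Ioc (0 : ℝ) 1, ∑ k, 2 * (1 + ∫ y in cell, pd k g y ^ 6) := by
          refine setIntegral_mono_on hint.integral_prod_right (by simp)
            measurableSet_Ioc fun r hr => ?_
          have hck : ∀ k, Continuous fun y => r ^ 6 * pd k g (z y r) ^ 6 := fun k => by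
            simp only [hz]; fun_prop
          simp only [hΨ]
          rw [integral_finsetSum _ fun k _ => integrableOn_cell (by have := hck k; fun_prop)]
          refine Finset.sum_le_sum fun k _ => ?_
          rw [integral_const_mul, integral_add (integrableOn_cell continuous_const)
            (integrableOn_cell (hck k)), setIntegral_cell_const]
          have := integral_cell_scale_le (φ := fun y => pd k g y ^ 6) (by fun_prop)
            (fun y => by positivity) hx hr.1.le hr.2
          simp only [hz]
          linarith
      _ = _ := by simp
  have h₃ : |g x| ≤ ∫ y in cell, (|g y - g x| + (1 + g y ^ 2)) := by
    conv_lhs => rw [← setIntegral_cell_const |g x|]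
    refine setIntegral_cell_mono continuous_const (by fun_prop) fun y _ => ?_
    have := abs_sub_abs_le_abs_sub (g x) (g y)
    rw [abs_sub_comm] at this
    have h5 : |g y| ≤ 1 + g y ^ 2 := by
      rw [← sq_abs (g y)]; nlinarith [sq_nonneg (|g y| - 1), abs_nonneg (g y)]
    linarith
  rw [integral_add (integrableOn_cell (by fun_prop)) (integrableOn_cell (by fun_prop)),
    integral_add (integrableOn_cell (by fun_prop)) (integrableOn_cell (by fun_prop)),
    setIntegral_cell_const] at h₃
  simp only [mul_add, Finset.sum_add_distrib, ← Finset.mul_sum] at h₂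
  simp at h₂
  linarith

/-! ### Increments in time and integration by parts -/

/-- The increment in time of a function is controlled by its time derivative. -/
theorem integral_time_increment_le {F : ℝ × Pt → ℝ} (hF : ContDiff ℝ ∞ F) {w : Pt → ℝ}
    (hw : Continuous w) {t B : ℝ} (ht : 0 ≤ t)
    (hB : ∀ s ∈ Icc 0 t, ∫ x in cell, (w x * sd none F (s, x)) ^ 2 ≤ B) :
    ∫ x in cell, (w x * (F (t, x) - F (0, x))) ^ 2 ≤ t ^ 2 * B := by
  have hFc := hF.continuous
  have hdc : Continuous (sd none F) := (sd_contDiff hF none).continuous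
  set Ψ : Pt → ℝ → ℝ := fun x s => (w x * sd none F (s, x)) ^ 2 with hΨ
  have hΨc : Continuous (Function.uncurry Ψ) := by simp only [hΨ]; fun_prop
  have h₁ : ∀ x, (w x * (F (t, x) - F (0, x))) ^ 2 ≤ t * ∫ s in Ioc 0 t, Ψ x s := by
    intro x
    rw [← intervalIntegral.integral_of_le ht]
    have hc : Continuous fun s => w x * sd none F (s, x) := by fun_prop
    have h₂ : ∫ s in (0 : ℝ)..t, w x * sd none F (s, x) = w x * (F (t, x) - F (0, x)) := by
      rw [intervalIntegral.integral_const_mul,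
        intervalIntegral.integral_eq_sub_of_hasDerivAt (fun s _ => hasDerivAt_sd hF s x)]
      exact Continuous.intervalIntegrable (by fun_prop) _ _
    -- Cauchy-Schwarz in time: the integral of a square is a nonnegative quadratic polynomial in l,
    -- so its discriminant is at most zero.
    have h₃ : ∀ l : ℝ, 0 ≤ t * (l * l) + (-2 * (w x * (F (t, x) - F (0, x)))) * l
        + ∫ s in (0 : ℝ)..t, Ψ x s := by
      intro l
      have h₄ : ∫ s in (0 : ℝ)..t, (l - w x * sd none F (s, x)) ^ 2 = t * (l * l)
          + (-2 * (w x * (F (t, x) - F (0, x)))) * l + ∫ s in (0 : ℝ)..t, Ψ x s := by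
        have h₅ : ∀ s, (l - w x * sd none F (s, x)) ^ 2
            = (l * l + (-2 * l) * (w x * sd none F (s, x))) + Ψ x s := fun s => by
          simp only [hΨ]; ring
        simp only [h₅]
        rw [intervalIntegral.integral_add (Continuous.intervalIntegrable (by fun_prop) _ _)
          (Continuous.intervalIntegrable (by simp only [hΨ]; fun_prop) _ _),
          intervalIntegral.integral_add (Continuous.intervalIntegrable (by fun_prop) _ _)
          (Continuous.intervalIntegrable (by fun_prop) _ _), intervalIntegral.integral_const_mul (-2 * l), h₂]
        simp; ring
      rw [← h₄]
      exact intervalIntegral.integral_nonneg ht fun s _ => sq_nonneg _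
    have := discrim_le_zero h₃
    rw [discrim] at this
    nlinarith
  have hint : Integrable (Function.uncurry Ψ)
      ((volume.restrict cell).prod (volume.restrict (Ioc (0 : ℝ) t))) := by
    rw [Measure.prod_restrict]
    refine (hΨc.continuousOn.integrableOn_compact
      (isCompact_Icc.prod isCompact_Icc)).mono_set (prod_mono cell_subset_Icc Ioc_subset_Icc_self)
  calc ∫ x in cell, (w x * (F (t, x) - F (0, x))) ^ 2
      ≤ ∫ x in cell, t * ∫ s in Ioc 0 t, Ψ x s :=
        setIntegral_mono_on (integrableOn_cell (by fun_prop)) (hint.integral_prod_left.const_mul t)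
          measurableSet_cell fun x _ => h₁ x
    _ = t * ∫ s in Ioc 0 t, ∫ x in cell, Ψ x s := by
        rw [integral_const_mul, integral_integral_swap hint]
    _ ≤ t * ∫ _ in Ioc 0 t, B := by
        refine mul_le_mul_of_nonneg_left ?_ ht
        exact setIntegral_mono_on hint.integral_prod_right (by simp) measurableSet_Ioc
          fun s hs => hB s ⟨hs.1.le, hs.2⟩
    _ = t ^ 2 * B := by simp [ht]; ring

/-- The integral of a derivative vanishes if the function takes equal values on opposite faces. -/
theorem integral_pd_eq_zero {F : Pt → ℝ} (hF : ContDiff ℝ ∞ F) (k : Fin 3)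
    (h : ∀ x ∈ Icc (0 : Pt) 1, F (Function.update x k 1) = F (Function.update x k 0)) :
    ∫ x in cell, pd k F x = 0 := by
  have hd := contDiff_differentiable hF
  have hae : (cell : Set Pt) =ᵐ[volume] Icc (0 : Pt) 1 := by
    rw [cell_eq_pi, volume_pi]
    exact Measure.univ_pi_Ioo_ae_eq_Icc (f := (0 : Pt)) (g := 1)
  rw [setIntegral_congr_set hae]
  -- The divergence theorem is applied to the vector field whose only nonzero component is F in
  -- direction k, so only the two opposite faces in that direction contribute.
  set f : Fin 3 → Pt → ℝ := fun i => if i = k then F else 0 with hf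
  have hfd : ∀ i, Differentiable ℝ (f i) := fun i => by
    simp only [hf]; split_ifs
    exacts [hd, differentiable_const 0]
  have hsum : ∀ x, ∑ i, fderiv ℝ (f i) x (Pi.single i 1) = pd k F x := by
    intro x
    rw [Finset.sum_eq_single k]
    · simp [hf, pd, unitVec]
    · intro i _ hi; simp [hf, hi]
    · simp
  have key := integral_divergence_of_hasFDerivAt_off_countable' (0 : Pt) 1
    (fun i => zero_le_one) f (fun i => fderiv ℝ (f i)) ∅ countable_empty
    (fun i => (hfd i).continuous.continuousOn) (fun x _ i => (hfd i x).hasFDerivAt) (by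
      simp only [hsum]
      exact ((pd_contDiff hF k).continuous.continuousOn).integrableOn_compact isCompact_Icc)
  simp only [hsum] at key
  rw [key]
  refine Finset.sum_eq_zero fun i _ => ?_
  by_cases hi : i = k
  · subst hi
    rw [sub_eq_zero]
    refine setIntegral_congr_fun measurableSet_Icc fun y hy => ?_
    have hx : i.insertNth (0 : ℝ) y ∈ Icc (0 : Pt) 1 := by
      rw [Fin.insertNth_mem_Icc]
      exact ⟨by simp, hy⟩
    have := h _ hx
    simpa [hf, Fin.update_insertNth] using this
  · simp [hf, hi]

/-! ### Quantities with polynomial bounds -/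

/-- The family `F` is bounded by a polynomial in the family `Λ`. -/
def Tame {ι : Type*} (Λ F : ι → ℝ) : Prop := ∃ (C : ℝ) (N : ℕ), 0 ≤ C ∧ ∀ i, F i ≤ C * Λ i ^ N

/-- The `L²` norms over the cell of a family of functions have a polynomial bound. -/
def L2Tame {ι : Type*} (Λ : ι → ℝ) (g : ι → Pt → ℝ) : Prop :=
  Tame Λ fun i => ∫ x in cell, g i x ^ 2

/-- The suprema over the cell of a family of functions have a polynomial bound. -/
def SupTame {ι : Type*} (Λ : ι → ℝ) (g : ι → Pt → ℝ) : Prop :=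
  ∃ M : ι → ℝ, Tame Λ M ∧ ∀ i, ∀ x ∈ cell, |g i x| ≤ M i

section Tame

variable {ι : Type*} {Λ : ι → ℝ}

theorem Tame.mono {F G : ι → ℝ} (hG : Tame Λ G) (h : ∀ i, F i ≤ G i) : Tame Λ F := by
  obtain ⟨C, N, hC, hb⟩ := hG
  exact ⟨C, N, hC, fun i => (h i).trans (hb i)⟩

theorem Tame.const (c : ℝ) : Tame Λ fun _ => c :=
  ⟨|c|, 0, abs_nonneg c, fun _ => by simpa using le_abs_self c⟩

theorem Tame.self : Tame Λ Λ := ⟨1, 1, zero_le_one, fun _ => by simp⟩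

theorem Tame.add (hΛ : ∀ i, 1 ≤ Λ i) {F G : ι → ℝ} (hF : Tame Λ F) (hG : Tame Λ G) :
    Tame Λ fun i => F i + G i := by
  obtain ⟨C, N, hC, hb⟩ := hF
  obtain ⟨C', N', hC', hb'⟩ := hG
  refine ⟨C + C', N + N', add_nonneg hC hC', fun i => ?_⟩
  have h₁ : Λ i ^ N ≤ Λ i ^ (N + N') := pow_le_pow_right₀ (hΛ i) (by omega)
  have h₂ : Λ i ^ N' ≤ Λ i ^ (N + N') := pow_le_pow_right₀ (hΛ i) (by omega)
  have := mul_le_mul_of_nonneg_left h₁ hC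
  have := mul_le_mul_of_nonneg_left h₂ hC'
  linarith [hb i, hb' i]

theorem Tame.mul {F G : ι → ℝ} (hF : Tame Λ F) (hG : Tame Λ G) (hF0 : ∀ i, 0 ≤ F i)
    (hG0 : ∀ i, 0 ≤ G i) : Tame Λ fun i => F i * G i := by
  obtain ⟨C, N, hC, hb⟩ := hF
  obtain ⟨C', N', hC', hb'⟩ := hG
  refine ⟨C * C', N + N', mul_nonneg hC hC', fun i => ?_⟩
  calc F i * G i ≤ (C * Λ i ^ N) * (C' * Λ i ^ N') :=
        mul_le_mul (hb i) (hb' i) (hG0 i) ((hF0 i).trans (hb i))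
    _ = _ := by ring

theorem Tame.pow {F : ι → ℝ} (hF : Tame Λ F) (hF0 : ∀ i, 0 ≤ F i) (n : ℕ) :
    Tame Λ fun i => F i ^ n := by
  induction n with
  | zero => simpa using Tame.const 1
  | succ n ih =>
    simp only [pow_succ]
    exact ih.mul hF (fun i => pow_nonneg (hF0 i) n) hF0

theorem Tame.const_mul {F : ι → ℝ} (hF : Tame Λ F) {c : ℝ} (hc : 0 ≤ c) :
    Tame Λ fun i => c * F i := by
  obtain ⟨C, N, hC, hb⟩ := hF
  refine ⟨c * C, N, mul_nonneg hc hC, fun i => ?_⟩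
  rw [mul_assoc]
  exact mul_le_mul_of_nonneg_left (hb i) hc

theorem Tame.sum (hΛ : ∀ i, 1 ≤ Λ i) {κ : Type*} (s : Finset κ) {F : κ → ι → ℝ}
    (hF : ∀ k ∈ s, Tame Λ (F k)) : Tame Λ fun i => ∑ k ∈ s, F k i := by
  classical
  induction s using Finset.induction_on with
  | empty => simpa using Tame.const 0
  | insert a s ha ih =>
    simp only [Finset.sum_insert ha]
    exact (hF a (Finset.mem_insert_self a s)).add hΛ
      (ih fun k hk => hF k (Finset.mem_insert_of_mem hk))

/-- Needed because some of the integral inequalities bound the square of the quantity of interest; F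
≤ 1 + F² suffices for polynomial bounds. -/
theorem tame_of_sq_le (hΛ : ∀ i, 1 ≤ Λ i) {F G : ι → ℝ} (hG : Tame Λ G)
    (h : ∀ i, F i ^ 2 ≤ G i) : Tame Λ F :=
  ((Tame.const 1).add hΛ hG).mono fun i => by nlinarith [h i, sq_nonneg (F i - 1)]

theorem L2Tame.congr {g h : ι → Pt → ℝ} (hh : L2Tame Λ h) (e : ∀ i, ∀ x ∈ cell, g i x = h i x) :
    L2Tame Λ g :=
  Tame.mono hh fun i => le_of_eq <|
    setIntegral_congr_fun measurableSet_cell fun x hx => by simp [e i x hx]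

theorem L2Tame.add (hΛ : ∀ i, 1 ≤ Λ i) {g h : ι → Pt → ℝ} (hg : L2Tame Λ g) (hh : L2Tame Λ h)
    (hgc : ∀ i, Continuous (g i)) (hhc : ∀ i, Continuous (h i)) :
    L2Tame Λ fun i x => g i x + h i x := by
  refine Tame.mono ((Tame.add hΛ hg hh).const_mul zero_le_two) fun i => ?_
  have := hgc i; have := hhc i
  rw [← integral_add (integrableOn_cell (by fun_prop)) (integrableOn_cell (by fun_prop)),
    ← integral_const_mul]
  exact setIntegral_cell_mono (by fun_prop) (by fun_prop) fun x _ => by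
    nlinarith [sq_nonneg (g i x - h i x)]

theorem L2Tame.const_mul {g : ι → Pt → ℝ} (hg : L2Tame Λ g) (c : ℝ) :
    L2Tame Λ fun i x => c * g i x := by
  refine Tame.mono (Tame.const_mul hg (sq_nonneg c)) fun i => le_of_eq ?_
  rw [← integral_const_mul]
  congr 1; ext x; ring

theorem L2Tame.sub (hΛ : ∀ i, 1 ≤ Λ i) {g h : ι → Pt → ℝ} (hg : L2Tame Λ g) (hh : L2Tame Λ h)
    (hgc : ∀ i, Continuous (g i)) (hhc : ∀ i, Continuous (h i)) :
    L2Tame Λ fun i x => g i x - h i x := by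
  have := hg.add hΛ (hh.const_mul (-1)) hgc fun i => (hhc i).const_mul (-1)
  exact this.congr fun i x _ => by ring

theorem L2Tame.zero : L2Tame Λ fun _ _ => 0 := by
  refine (Tame.const 0).mono fun i => ?_
  simp

theorem L2Tame.sum (hΛ : ∀ i, 1 ≤ Λ i) {κ : Type*} (s : Finset κ) {g : κ → ι → Pt → ℝ}
    (hg : ∀ k ∈ s, L2Tame Λ (g k)) (hgc : ∀ k i, Continuous (g k i)) :
    L2Tame Λ fun i x => ∑ k ∈ s, g k i x := by
  classical
  induction s using Finset.induction_on with
  | empty => simpa using L2Tame.zero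
  | insert a s ha ih =>
    simp only [Finset.sum_insert ha]
    exact (hg a (Finset.mem_insert_self a s)).add hΛ
      (ih fun k hk => hg k (Finset.mem_insert_of_mem hk)) (hgc a)
      fun i => continuous_finsetSum _ fun k _ => hgc k i

theorem SupTame.mul_l2 {g h : ι → Pt → ℝ} (hg : SupTame Λ g) (hh : L2Tame Λ h)
    (hgc : ∀ i, Continuous (g i)) (hhc : ∀ i, Continuous (h i)) :
    L2Tame Λ fun i x => g i x * h i x := by
  obtain ⟨M, hM, hb⟩ := hg
  -- Evaluating at the centre of the cell shows that a bound for an absolute value is nonnegative.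
  have hM0 : ∀ i, 0 ≤ M i := fun i =>
    (abs_nonneg _).trans (hb i (fun _ => 1 / 2) fun _ => by norm_num)
  refine Tame.mono ((hM.pow hM0 2).mul hh (fun _ => sq_nonneg _)
    fun i => setIntegral_sq_nonneg _ _) fun i => ?_
  rw [← integral_const_mul]
  have := hgc i; have := hhc i
  refine setIntegral_cell_mono (by fun_prop) (by fun_prop) fun x hx => ?_
  rw [mul_pow]
  exact mul_le_mul_of_nonneg_right (sq_le_sq' (by linarith [(abs_le.1 (hb i x hx)).1])
    (abs_le.1 (hb i x hx)).2) (sq_nonneg _)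

theorem SupTame.mul {g h : ι → Pt → ℝ} (hg : SupTame Λ g) (hh : SupTame Λ h) :
    SupTame Λ fun i x => g i x * h i x := by
  obtain ⟨M, hM, hb⟩ := hg
  obtain ⟨M', hM', hb'⟩ := hh
  have h0 : ∀ {M : ι → ℝ} {g : ι → Pt → ℝ}, (∀ i, ∀ x ∈ cell, |g i x| ≤ M i) → ∀ i, 0 ≤ M i :=
    fun hb i => (abs_nonneg _).trans (hb i (fun _ => 1 / 2) fun _ => by norm_num)
  refine ⟨_, hM.mul hM' (h0 hb) (h0 hb'), fun i x hx => ?_⟩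
  rw [abs_mul]
  exact mul_le_mul (hb i x hx) (hb' i x hx) (abs_nonneg _) (h0 hb i)

theorem SupTame.add (hΛ : ∀ i, 1 ≤ Λ i) {g h : ι → Pt → ℝ} (hg : SupTame Λ g) (hh : SupTame Λ h) :
    SupTame Λ fun i x => g i x + h i x := by
  obtain ⟨M, hM, hb⟩ := hg
  obtain ⟨M', hM', hb'⟩ := hh
  exact ⟨_, hM.add hΛ hM', fun i x hx =>
    (abs_add_le _ _).trans (add_le_add (hb i x hx) (hb' i x hx))⟩

/-- A fixed continuous function is bounded on the cell. -/
theorem supTame_of_continuous {g : Pt → ℝ} (hg : Continuous g) : SupTame Λ fun _ => g := by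
  obtain ⟨C, hC⟩ := isCompact_Icc.exists_bound_of_continuousOn (s := Icc (0 : Pt) 1) hg.continuousOn
  exact ⟨fun _ => C, Tame.const C, fun _ x hx => by simpa using hC x (cell_subset_Icc hx)⟩

theorem SupTame.l2 {g : ι → Pt → ℝ} (hg : SupTame Λ g) (hgc : ∀ i, Continuous (g i)) :
    L2Tame Λ g := by
  have h1 : L2Tame Λ fun _ _ => (1 : ℝ) := (Tame.const 1).mono fun i => by
    simp only [one_pow, setIntegral_cell_const, le_refl]
  exact (hg.mul_l2 h1 hgc fun _ => continuous_const).congr fun i x _ => by simp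

/-- The `H¹` norms of a family of functions have a polynomial bound. -/
def H1Tame (Λ : ι → ℝ) (g : ι → Pt → ℝ) : Prop := Tame Λ fun i => hOne (g i)

theorem h1Tame_of (hΛ : ∀ i, 1 ≤ Λ i) {g : ι → Pt → ℝ} (h : L2Tame Λ g)
    (h' : ∀ k, L2Tame Λ fun i => pd k (g i)) : H1Tame Λ g :=
  Tame.add hΛ h (Tame.sum hΛ _ fun k _ => h' k)

theorem H1Tame.pow_six {g : ι → Pt → ℝ} (h : H1Tame Λ g) (hg : ∀ i, ContDiff ℝ ∞ (g i)) :
    Tame Λ fun i => ∫ x in cell, g i x ^ 6 :=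
  ((Tame.pow h (fun _ => hOne_nonneg _) 3).const_mul (by norm_num : (0 : ℝ) ≤ 64 ^ 3)).mono
    fun i => integral_pow_six_le (hg i)

theorem H1Tame.l2 {g : ι → Pt → ℝ} (h : H1Tame Λ g) : L2Tame Λ g :=
  Tame.mono h fun _ =>
    le_add_of_nonneg_right (Finset.sum_nonneg fun _ _ => setIntegral_sq_nonneg _ _)

/-- H¹ functions lie in L² and L⁶. By a⁴ ≤ a² + a⁶ they lie in L⁴, and g²h² ≤ g⁴ + h⁴. -/
theorem H1Tame.mul (hΛ : ∀ i, 1 ≤ Λ i) {g h : ι → Pt → ℝ} (hg : H1Tame Λ g) (hh : H1Tame Λ h)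
    (hgs : ∀ i, ContDiff ℝ ∞ (g i)) (hhs : ∀ i, ContDiff ℝ ∞ (h i)) :
    L2Tame Λ fun i x => g i x * h i x := by
  refine Tame.mono (Tame.add hΛ (Tame.add hΛ hg.l2 (hg.pow_six hgs))
    (Tame.add hΛ hh.l2 (hh.pow_six hhs))) fun i => ?_
  have := (hgs i).continuous; have := (hhs i).continuous
  rw [← integral_add (integrableOn_cell (by fun_prop)) (integrableOn_cell (by fun_prop)),
    ← integral_add (integrableOn_cell (by fun_prop)) (integrableOn_cell (by fun_prop)),
    ← integral_add (integrableOn_cell (by fun_prop)) (integrableOn_cell (by fun_prop))]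
  refine setIntegral_cell_mono (by fun_prop) (by fun_prop) fun x _ => ?_
  have h4 : ∀ a : ℝ, a ^ 4 ≤ a ^ 2 + a ^ 6 := fun a => by
    nlinarith [mul_nonneg (sq_nonneg a) (sq_nonneg (a ^ 2 - 1)), sq_nonneg a]
  nlinarith [h4 (g i x), h4 (h i x), sq_nonneg (g i x ^ 2 - h i x ^ 2), sq_nonneg (g i x ^ 2),
    sq_nonneg (h i x ^ 2)]

/-- The embedding H² ⊂ L^∞: the gradient lies in H¹ ⊂ L⁶, and Morrey's estimate applies. -/
theorem supTame_of_h1 (hΛ : ∀ i, 1 ≤ Λ i) {g : ι → Pt → ℝ} (h : L2Tame Λ g)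
    (h' : ∀ k, H1Tame Λ fun i => pd k (g i)) (hgs : ∀ i, ContDiff ℝ ∞ (g i)) : SupTame Λ g := by
  refine ⟨_, Tame.add hΛ (Tame.add hΛ (Tame.const 7) h) (Tame.const_mul (Tame.sum hΛ Finset.univ
    fun k _ => (h' k).pow_six fun i => pd_contDiff (hgs i) k) zero_le_two), fun i x hx => ?_⟩
  exact abs_le_of_gradient_six (hgs i) hx

/-- Used with h equal to ρ₀ times a horizontal derivative of Dη, where the energy controls further
horizontal derivatives but no vertical one. -/
theorem l2Tame_hor_mul (hΛ : ∀ i, 1 ≤ Λ i) {g h : ι → Pt → ℝ} (hh : L2Tame Λ h)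
    (hh' : ∀ α : Fin 2, L2Tame Λ fun i => pd (hor α) (h i)) (hg : H1Tame Λ g)
    (hhs : ∀ i, ContDiff ℝ ∞ (h i)) (hgs : ∀ i, ContDiff ℝ ∞ (g i)) :
    L2Tame Λ fun i x => h i x * g i x := by
  have h0 : L2Tame Λ fun i => pd 0 (h i) := hh' 0
  have h1 : L2Tame Λ fun i => pd 1 (h i) := hh' 1
  refine tame_of_sq_le hΛ (Tame.pow (((((Tame.const_mul hh zero_le_two).add hΛ h0).add hΛ h1).add hΛ
    ((Tame.const 1).add hΛ hh)).add hΛ ((hg.pow_six hgs).const_mul (by norm_num : (0 : ℝ) ≤ 5)) |>.add hΛ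
    (Tame.const_mul hg (by norm_num : (0 : ℝ) ≤ 10))) (fun i => ?_) 3)
    fun i => integral_hor_mul_le (hhs i) (hgs i)
  have h₁ := setIntegral_sq_nonneg cell (h i)
  have h₂ := setIntegral_sq_nonneg cell (pd 0 (h i))
  have h₃ := setIntegral_sq_nonneg cell (pd 1 (h i))
  have h₄ : 0 ≤ ∫ x in cell, g i x ^ 6 := integral_nonneg fun x => by positivity
  have h₅ := hOne_nonneg (g i)
  positivity

/-! ### Families of space-time functions -/

/-- The derivative along `L` of the members of a family `u`, at the times `τ`. -/
def sl (τ : ι → ℝ) (L : List (Option (Fin 3))) (u : ι → ℝ × Pt → ℝ) (i : ι) (x : Pt) : ℝ :=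
  sdL L (u i) (τ i, x)

/-- All derivatives of parabolic order at most six are bounded in `L²` at the times `τ`. -/
structure Reg (Λ : ι → ℝ) (τ : ι → ℝ) (u : ι → ℝ × Pt → ℝ) : Prop where
  smooth : ∀ i, ContDiff ℝ ∞ (u i)
  bound : ∀ L, ord L ≤ 6 → L2Tame Λ (sl τ L u)

/-- In addition to `Reg`, the weighted horizontal derivatives of order at most eight are bounded in
`L²`. -/
structure RegW (Λ : ι → ℝ) (τ : ι → ℝ) (ρ : Pt → ℝ) (u : ι → ℝ × Pt → ℝ) : Prop
    extends Reg Λ τ u where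
  weighted : ∀ L, IsHor L → ord L ≤ 8 → L2Tame Λ fun i x => ρ x * sl τ L u i x

variable {τ : ι → ℝ} {u w : ι → ℝ × Pt → ℝ}

theorem sl_contDiff (hu : ∀ i, ContDiff ℝ ∞ (u i)) (L) (i : ι) : ContDiff ℝ ∞ (sl τ L u i) :=
  (sdL_contDiff (hu i) L).comp (contDiff_prodMk_right (τ i))

theorem sl_continuous (hu : ∀ i, ContDiff ℝ ∞ (u i)) (L) (i : ι) : Continuous (sl τ L u i) :=
  (sl_contDiff hu L i).continuous

theorem pd_sl (hu : ∀ i, ContDiff ℝ ∞ (u i)) (L) (k : Fin 3) (i : ι) :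
    pd k (sl τ L u i) = sl τ (some k :: L) u i := by
  ext x
  exact pd_eq_sd isOpen_univ (sdL_contDiff (hu i) L).contDiffOn (fun _ _ => rfl) k x (mem_univ _)

/-- A spatial derivative costs two orders, so order 4 leaves room for one of them within the six
available orders. Order 2 leaves room for two, which gives the supremum bound below. -/
theorem Reg.h1 (hΛ : ∀ i, 1 ≤ Λ i) (hu : Reg Λ τ u) {L} (hL : ord L ≤ 4) : H1Tame Λ (sl τ L u) := by
  refine h1Tame_of hΛ (hu.bound L (by omega)) fun k => ?_
  simp only [pd_sl hu.smooth]
  exact hu.bound _ (by rw [ord_cons_some]; omega)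

theorem Reg.sup (hΛ : ∀ i, 1 ≤ Λ i) (hu : Reg Λ τ u) {L} (hL : ord L ≤ 2) :
    SupTame Λ (sl τ L u) := by
  refine supTame_of_h1 hΛ (hu.bound L (by omega)) (fun k => ?_) (sl_contDiff hu.smooth L)
  simp only [pd_sl hu.smooth]
  exact hu.h1 hΛ (by rw [ord_cons_some]; omega)

/-- Either one order is at most 2 and that factor is bounded, or both are at least 3. In the latter
case the total of 7 forces both to be at most 4, and both factors lie in H¹. -/
theorem Reg.mul_l2 (hΛ : ∀ i, 1 ≤ Λ i) (hu : Reg Λ τ u) (hw : Reg Λ τ w) {L L'} (hL : ord L ≤ 6)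
    (hL' : ord L' ≤ 6) (h : ord L + ord L' ≤ 7) :
    L2Tame Λ fun i x => sl τ L u i x * sl τ L' w i x := by
  have hc := sl_continuous (τ := τ) hu.smooth L
  have hc' := sl_continuous (τ := τ) hw.smooth L'
  rcases le_or_gt (ord L) 2 with h₁ | h₁
  · exact (hu.sup hΛ h₁).mul_l2 (hw.bound _ hL') hc hc'
  rcases le_or_gt (ord L') 2 with h₂ | h₂
  · exact ((hw.sup hΛ h₂).mul_l2 (hu.bound _ hL) hc' hc).congr fun i x _ => mul_comm _ _
  · exact (hu.h1 hΛ (by omega)).mul hΛ (hw.h1 hΛ (by omega)) (sl_contDiff hu.smooth L)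
      (sl_contDiff hw.smooth L')

theorem l2Tame_leibSum (hΛ : ∀ i, 1 ≤ Λ i) (hu : ∀ i, ContDiff ℝ ∞ (u i))
    (hw : ∀ i, ContDiff ℝ ∞ (w i)) {ρ : Pt → ℝ} (hρ : Continuous ρ) (S)
    (h : ∀ b ∈ S, L2Tame Λ fun i x => ρ x * (sl τ b.1 u i x * sl τ b.2 w i x)) :
    L2Tame Λ fun i x => ρ x * leibSum S (u i) (w i) (τ i, x) := by
  induction S with
  | nil => simpa [leibSum] using L2Tame.zero
  | cons b S ih =>
    have h₁ := (h b (by simp)).add hΛ (ih fun b hb => h b (by simp [hb]))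
      (fun i => hρ.mul ((sl_continuous hu _ i).mul (sl_continuous hw _ i)))
      (fun i => hρ.mul ((leibSum_contDiff (hu i) (hw i) S).continuous.comp
        (Continuous.prodMk_right (τ i))))
    refine h₁.congr fun i x _ => ?_
    simp [leibSum, sl, mul_add]

theorem Reg.mul (hΛ : ∀ i, 1 ≤ Λ i) (hu : Reg Λ τ u) (hw : Reg Λ τ w) :
    Reg Λ τ fun i => u i * w i where
  smooth i := (hu.smooth i).mul (hw.smooth i)
  bound L hL := by
    have := l2Tame_leibSum (ρ := fun _ => 1) (τ := τ) hΛ hu.smooth hw.smooth continuous_const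
      (splits L) fun b hb => by
        have := ord_of_mem_splits hb
        simpa using hu.mul_l2 hΛ hw (by omega) (by omega) (by omega)
    refine this.congr fun i x _ => ?_
    rw [sl, sdL_mul (hu.smooth i) (hw.smooth i), one_mul]

theorem Reg.add (hΛ : ∀ i, 1 ≤ Λ i) (hu : Reg Λ τ u) (hw : Reg Λ τ w) :
    Reg Λ τ fun i => u i + w i where
  smooth i := (hu.smooth i).add (hw.smooth i)
  bound L hL := by
    refine ((hu.bound L hL).add hΛ (hw.bound L hL) (sl_continuous hu.smooth L)
      (sl_continuous hw.smooth L)).congr fun i x _ => ?_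
    simp [sl, sdL_add (hu.smooth i) (hw.smooth i)]

theorem Reg.smul (hu : Reg Λ τ u) (c : ℝ) : Reg Λ τ fun i => c • u i where
  smooth i := contDiff_const.smul (hu.smooth i)
  bound L hL := by
    refine ((hu.bound L hL).const_mul c).congr fun i x _ => ?_
    simp [sl, sdL_smul (hu.smooth i)]

theorem Reg.sub (hΛ : ∀ i, 1 ≤ Λ i) (hu : Reg Λ τ u) (hw : Reg Λ τ w) :
    Reg Λ τ fun i => u i - w i where
  smooth i := (hu.smooth i).sub (hw.smooth i)
  bound L hL := by
    refine ((hu.bound L hL).sub hΛ (hw.bound L hL) (sl_continuous hu.smooth L)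
      (sl_continuous hw.smooth L)).congr fun i x _ => ?_
    simp [sl, sdL_sub (hu.smooth i) (hw.smooth i)]

theorem Reg.sum (hΛ : ∀ i, 1 ≤ Λ i) {κ : Type*} (s : Finset κ) {u : κ → ι → ℝ × Pt → ℝ}
    (hu : ∀ k, Reg Λ τ (u k)) : Reg Λ τ fun i => ∑ k ∈ s, u k i where
  smooth i := contDiff_finset_sum fun k => (hu k).smooth i
  bound L hL := by
    refine (L2Tame.sum hΛ s (fun k _ => (hu k).bound L hL)
      fun k => sl_continuous (hu k).smooth L).congr fun i x _ => ?_
    simp [sl, sdL_sum s fun k => (hu k).smooth i]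

/-- The derivatives of a fixed function are bounded. -/
theorem l2Tame_fixed {F : ℝ × Pt → ℝ} (hF : ContDiff ℝ ∞ F) (hτ : ∀ i, τ i ∈ Icc (0 : ℝ) 1) (L) :
    L2Tame Λ (sl τ L fun _ => F) := by
  have hc := (sdL_contDiff hF L).continuous
  obtain ⟨C, hC⟩ := (isCompact_Icc.prod isCompact_Icc).exists_bound_of_continuousOn
    (s := Icc (0 : ℝ) 1 ×ˢ Icc (0 : Pt) 1) hc.continuousOn
  refine SupTame.l2 ⟨fun _ => C, Tame.const C, fun i x hx => ?_⟩ (sl_continuous (fun _ => hF) L)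
  exact hC (τ i, x) ⟨hτ i, cell_subset_Icc hx⟩

theorem reg_fixed {F : ℝ × Pt → ℝ} (hF : ContDiff ℝ ∞ F) (hτ : ∀ i, τ i ∈ Icc (0 : ℝ) 1) :
    Reg Λ τ fun _ => F where
  smooth _ := hF
  bound L _ := l2Tame_fixed hF hτ L

/-- The total of 9 forces one order to be at most 4. If it is at most 2, that factor is bounded. If
it is 3 or 4, the factor lies in H¹ and the other order is at most 6, so the weighted other factor
admits one more horizontal derivative within order 8. The term where this derivative falls on ρ is
bounded without a weight, and the anisotropic product inequality applies. -/
theorem RegW.mul_l2 (hΛ : ∀ i, 1 ≤ Λ i) {ρ : Pt → ℝ} (hρ : ContDiff ℝ ∞ ρ) (hu : RegW Λ τ ρ u)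
    (hw : RegW Λ τ ρ w) {L L'} (hL : ord L ≤ 8) (hL' : ord L' ≤ 8) (h : ord L + ord L' ≤ 9)
    (hH : IsHor L) (hH' : IsHor L') :
    L2Tame Λ fun i x => ρ x * (sl τ L u i x * sl τ L' w i x) := by
  have key : ∀ {u w : ι → ℝ × Pt → ℝ}, RegW Λ τ ρ u → RegW Λ τ ρ w → ∀ {L L'}, ord L ≤ 4 →
      ord L' ≤ 8 → ord L + ord L' ≤ 9 → IsHor L' →
      L2Tame Λ fun i x => ρ x * (sl τ L u i x * sl τ L' w i x) := by
    intro u w hu hw L L' hL hL' h hH'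
    have hc := sl_continuous (τ := τ) hu.smooth L
    have hc' := sl_continuous (τ := τ) hw.smooth L'
    rcases le_or_gt (ord L) 2 with h₁ | h₁
    · refine ((hu.sup hΛ h₁).mul_l2 (hw.weighted L' hH' hL') hc
        fun i => hρ.continuous.mul (hc' i)).congr fun i x _ => by ring
    · have hs : ∀ i, ContDiff ℝ ∞ fun x => ρ x * sl τ L' w i x := fun i =>
        hρ.mul (sl_contDiff hw.smooth L' i)
      refine (l2Tame_hor_mul hΛ (hw.weighted L' hH' hL') (fun α => ?_) (hu.h1 hΛ hL) hs
        (sl_contDiff hu.smooth L)).congr fun i x _ => by ring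
      have h₂ := (hw.weighted (some (hor α) :: L') (isHor_cons_hor hH' α)
        (by rw [ord_cons_some]; omega)).add hΛ ((supTame_of_continuous
          (pd_contDiff hρ (hor α)).continuous).mul_l2 (hw.bound L' (by omega))
          (fun _ => (pd_contDiff hρ (hor α)).continuous) hc')
          (fun i => hρ.continuous.mul (sl_continuous hw.smooth _ i))
          (fun i => (pd_contDiff hρ (hor α)).continuous.mul (hc' i))
      refine h₂.congr fun i x _ => ?_
      rw [← pd_sl hw.smooth, pd, fderiv_fun_mul (contDiff_differentiable hρ x)
        (contDiff_differentiable (sl_contDiff hw.smooth L' i) x)]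
      simp [pd]
      ring
  rcases le_or_gt (ord L) 4 with h₁ | h₁
  · exact key hu hw h₁ hL' h hH'
  · exact (key (L := L') hw hu (by omega) hL (by omega) hH).congr fun i x _ => by ring

/-! ### Top order parts modulo errors bounded in L² -/

/-- The derivative along `L` equals `p` on the cell up to an error with bounded `L²` norm. -/
def HasTop (Λ τ : ι → ℝ) (L : List (Option (Fin 3))) (u : ι → ℝ × Pt → ℝ) (p : ι → Pt → ℝ) : Prop :=
  ∃ g, L2Tame Λ g ∧ (∀ i, Continuous (g i)) ∧ ∀ i, ∀ x ∈ cell, sl τ L u i x = p i x + g i x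

theorem HasTop.congr {L} {p q : ι → Pt → ℝ} (h : HasTop Λ τ L u p)
    (e : ∀ i, ∀ x ∈ cell, p i x = q i x) : HasTop Λ τ L u q := by
  obtain ⟨g, hg, hgc, hge⟩ := h
  exact ⟨g, hg, hgc, fun i x hx => by rw [hge i x hx, e i x hx]⟩

theorem hasTop_self (L) : HasTop Λ τ L u (sl τ L u) :=
  ⟨fun _ _ => 0, L2Tame.zero, fun _ => continuous_const, fun _ _ _ => by simp⟩

theorem HasTop.add (hΛ : ∀ i, 1 ≤ Λ i) {L} {p q : ι → Pt → ℝ} (hu : ∀ i, ContDiff ℝ ∞ (u i))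
    (hw : ∀ i, ContDiff ℝ ∞ (w i)) (hp : HasTop Λ τ L u p) (hq : HasTop Λ τ L w q) :
    HasTop Λ τ L (fun i => u i + w i) fun i x => p i x + q i x := by
  obtain ⟨g, hg, hgc, hge⟩ := hp
  obtain ⟨h, hh, hhc, hhe⟩ := hq
  refine ⟨_, hg.add hΛ hh hgc hhc, fun i => (hgc i).add (hhc i), fun i x hx => ?_⟩
  have h₁ := hge i x hx
  have h₂ := hhe i x hx
  simp only [sl] at h₁ h₂ ⊢
  rw [sdL_add (hu i) (hw i), Pi.add_apply, h₁, h₂]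
  ring

theorem HasTop.smul {L} {p : ι → Pt → ℝ} (hu : ∀ i, ContDiff ℝ ∞ (u i)) (hp : HasTop Λ τ L u p)
    (c : ℝ) : HasTop Λ τ L (fun i => c • u i) fun i x => c * p i x := by
  obtain ⟨g, hg, hgc, hge⟩ := hp
  refine ⟨_, hg.const_mul c, fun i => continuous_const.mul (hgc i), fun i x hx => ?_⟩
  have h₁ := hge i x hx
  simp only [sl] at h₁ ⊢
  rw [sdL_smul (hu i), Pi.smul_apply, h₁, smul_eq_mul]
  ring

theorem HasTop.sub (hΛ : ∀ i, 1 ≤ Λ i) {L} {p q : ι → Pt → ℝ} (hu : ∀ i, ContDiff ℝ ∞ (u i))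
    (hw : ∀ i, ContDiff ℝ ∞ (w i)) (hp : HasTop Λ τ L u p) (hq : HasTop Λ τ L w q) :
    HasTop Λ τ L (fun i => u i - w i) fun i x => p i x - q i x := by
  have h := HasTop.add (w := fun i => (-1 : ℝ) • w i) hΛ hu
    (fun i => contDiff_const.smul (hw i)) hp (hq.smul hw (-1))
  have e : (fun i => u i + (-1 : ℝ) • w i) = fun i => u i - w i := by ext; simp; ring
  rw [e] at h
  exact h.congr fun i x _ => by ring

theorem HasTop.sum (hΛ : ∀ i, 1 ≤ Λ i) {κ : Type*} (s : Finset κ) {L} {u : κ → ι → ℝ × Pt → ℝ}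
    {p : κ → ι → Pt → ℝ} (hu : ∀ k i, ContDiff ℝ ∞ (u k i)) (hp : ∀ k, HasTop Λ τ L (u k) (p k)) :
    HasTop Λ τ L (fun i => ∑ k ∈ s, u k i) fun i x => ∑ k ∈ s, p k i x := by
  choose g hg hgc hge using hp
  refine ⟨fun i x => ∑ k ∈ s, g k i x, L2Tame.sum hΛ s (fun k _ => hg k) hgc,
    fun i => continuous_finsetSum _ fun k _ => hgc k i, fun i x hx => ?_⟩
  have h₁ := fun k => hge k i x hx
  simp only [sl] at h₁ ⊢
  rw [sdL_sum s fun k => hu k i, Finset.sum_apply]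
  simp only [h₁, Finset.sum_add_distrib]

/-- The top order part of a derivative of order seven of a product. -/
theorem HasTop.mul (hΛ : ∀ i, 1 ≤ Λ i) (hu : Reg Λ τ u) (hw : Reg Λ τ w) {L} (hL : ord L = 7)
    {p q : ι → Pt → ℝ} (hp : HasTop Λ τ L u p) (hq : HasTop Λ τ L w q) :
    HasTop Λ τ L (fun i => u i * w i)
      fun i x => u i (τ i, x) * q i x + w i (τ i, x) * p i x := by
  obtain ⟨g, hg, hgc, hge⟩ := hp
  obtain ⟨h, hh, hhc, hhe⟩ := hq
  -- Once the two extreme terms are removed, both orders are between 1 and 6 with sum 7, so every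
  -- remaining product is an L² error.
  have hlei := l2Tame_leibSum (ρ := fun _ => 1) (τ := τ) hΛ hu.smooth hw.smooth continuous_const
    (splitsLR L) fun b hb => by
      obtain ⟨h₁, h₂, h₃⟩ := mem_splitsLR hb
      have := ord_of_mem_splits h₁
      simpa using hu.mul_l2 hΛ hw (by omega) (by omega) (by omega)
  have hcl : ∀ i, Continuous fun x => 1 * leibSum (splitsLR L) (u i) (w i) (τ i, x) := fun i =>
    continuous_const.mul ((leibSum_contDiff (hu.smooth i) (hw.smooth i) _).continuous.comp
      (Continuous.prodMk_right (τ i)))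
  have hcu := sl_continuous (τ := τ) hu.smooth []
  have hcw := sl_continuous (τ := τ) hw.smooth []
  refine ⟨_, (((hu.sup hΛ (L := []) (by simp)).mul_l2 hh hcu hhc).add hΛ
    ((hw.sup hΛ (L := []) (by simp)).mul_l2 hg hcw hgc) (fun i => (hcu i).mul (hhc i))
    (fun i => (hcw i).mul (hgc i))).add hΛ hlei
    (fun i => ((hcu i).mul (hhc i)).add ((hcw i).mul (hgc i))) hcl,
    fun i => (((hcu i).mul (hhc i)).add ((hcw i).mul (hgc i))).add (hcl i), fun i x hx => ?_⟩
  have hne : L ≠ [] := by rintro rfl; simp at hL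
  have h₁ := hge i x hx
  have h₂ := hhe i x hx
  simp only [sl] at h₁ h₂ ⊢
  rw [sdL_mul_leftRight (hu.smooth i) (hw.smooth i) L hne]
  simp only [Pi.add_apply, Pi.mul_apply, h₁, h₂, sdL_nil]
  ring

/-- A regular family together with the top order part of a derivative. -/
structure RegTop (Λ τ : ι → ℝ) (L : List (Option (Fin 3))) (u : ι → ℝ × Pt → ℝ)
    (p : ι → Pt → ℝ) : Prop extends Reg Λ τ u where
  top : HasTop Λ τ L u p

variable {L : List (Option (Fin 3))} {p q : ι → Pt → ℝ}

theorem Reg.regTop (hu : Reg Λ τ u) (L) : RegTop Λ τ L u (sl τ L u) := ⟨hu, hasTop_self L⟩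

theorem RegTop.congr (hu : RegTop Λ τ L u p) (e : ∀ i, ∀ x ∈ cell, p i x = q i x) :
    RegTop Λ τ L u q := ⟨hu.toReg, hu.top.congr e⟩

theorem RegTop.add (hΛ : ∀ i, 1 ≤ Λ i) (hu : RegTop Λ τ L u p) (hw : RegTop Λ τ L w q) :
    RegTop Λ τ L (fun i => u i + w i) fun i x => p i x + q i x :=
  ⟨hu.toReg.add hΛ hw.toReg, hu.top.add hΛ hu.smooth hw.smooth hw.top⟩

theorem RegTop.sub (hΛ : ∀ i, 1 ≤ Λ i) (hu : RegTop Λ τ L u p) (hw : RegTop Λ τ L w q) :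
    RegTop Λ τ L (fun i => u i - w i) fun i x => p i x - q i x :=
  ⟨hu.toReg.sub hΛ hw.toReg, hu.top.sub hΛ hu.smooth hw.smooth hw.top⟩

theorem RegTop.smul (hu : RegTop Λ τ L u p) (c : ℝ) :
    RegTop Λ τ L (fun i => c • u i) fun i x => c * p i x :=
  ⟨hu.toReg.smul c, hu.top.smul hu.smooth c⟩

theorem RegTop.sum (hΛ : ∀ i, 1 ≤ Λ i) {κ : Type*} (s : Finset κ) {u : κ → ι → ℝ × Pt → ℝ}
    {p : κ → ι → Pt → ℝ} (hu : ∀ k, RegTop Λ τ L (u k) (p k)) :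
    RegTop Λ τ L (fun i => ∑ k ∈ s, u k i) fun i x => ∑ k ∈ s, p k i x :=
  ⟨Reg.sum hΛ s fun k => (hu k).toReg,
    HasTop.sum hΛ s (fun k => (hu k).smooth) fun k => (hu k).top⟩

theorem RegTop.mul (hΛ : ∀ i, 1 ≤ Λ i) (hL : ord L = 7) (hu : RegTop Λ τ L u p)
    (hw : RegTop Λ τ L w q) :
    RegTop Λ τ L (fun i => u i * w i) fun i x => u i (τ i, x) * q i x + w i (τ i, x) * p i x :=
  ⟨hu.toReg.mul hΛ hw.toReg, HasTop.mul hΛ hu.toReg hw.toReg hL hu.top hw.top⟩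

theorem regTop_fixed {F : ℝ × Pt → ℝ} (hF : ContDiff ℝ ∞ F) (hτ : ∀ i, τ i ∈ Icc (0 : ℝ) 1) (L) :
    RegTop Λ τ L (fun _ => F) fun _ _ => 0 :=
  ⟨reg_fixed hF hτ, _, l2Tame_fixed hF hτ L, sl_continuous (fun _ => hF) L,
    fun _ _ _ => (zero_add _).symm⟩

/-- Equality on the cell up to an error with bounded `L²` norm. -/
def EqMod (Λ : ι → ℝ) (p q : ι → Pt → ℝ) : Prop :=
  ∃ g, L2Tame Λ g ∧ (∀ i, Continuous (g i)) ∧ ∀ i, ∀ x ∈ cell, p i x = q i x + g i x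

theorem EqMod.congr {p' q' : ι → Pt → ℝ} (h : EqMod Λ p q) (hp : ∀ i, ∀ x ∈ cell, p' i x = p i x)
    (hq : ∀ i, ∀ x ∈ cell, q i x = q' i x) : EqMod Λ p' q' := by
  obtain ⟨g, hg, hgc, hge⟩ := h
  exact ⟨g, hg, hgc, fun i x hx => by rw [hp i x hx, hge i x hx, hq i x hx]⟩

theorem L2Tame.eqMod (hp : L2Tame Λ p) (hpc : ∀ i, Continuous (p i)) : EqMod Λ p fun _ _ => 0 :=
  ⟨p, hp, hpc, fun _ _ _ => (zero_add _).symm⟩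

theorem EqMod.trans (hΛ : ∀ i, 1 ≤ Λ i) {r : ι → Pt → ℝ} (h : EqMod Λ p q) (h' : EqMod Λ q r) :
    EqMod Λ p r := by
  obtain ⟨g, hg, hgc, hge⟩ := h
  obtain ⟨k, hk, hkc, hke⟩ := h'
  exact ⟨_, hg.add hΛ hk hgc hkc, fun i => (hgc i).add (hkc i), fun i x hx => by
    rw [hge i x hx, hke i x hx]; ring⟩

theorem EqMod.add (hΛ : ∀ i, 1 ≤ Λ i) {p' q' : ι → Pt → ℝ} (h : EqMod Λ p q)
    (h' : EqMod Λ p' q') : EqMod Λ (fun i x => p i x + p' i x) fun i x => q i x + q' i x := by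
  obtain ⟨g, hg, hgc, hge⟩ := h
  obtain ⟨k, hk, hkc, hke⟩ := h'
  exact ⟨_, hg.add hΛ hk hgc hkc, fun i => (hgc i).add (hkc i), fun i x hx => by
    beta_reduce; rw [hge i x hx, hke i x hx]; ring⟩

theorem EqMod.mul {c : ι → Pt → ℝ} (hc : SupTame Λ c) (hcc : ∀ i, Continuous (c i))
    (h : EqMod Λ p q) : EqMod Λ (fun i x => c i x * p i x) fun i x => c i x * q i x := by
  obtain ⟨g, hg, hgc, hge⟩ := h
  exact ⟨_, hc.mul_l2 hg hcc hgc, fun i => (hcc i).mul (hgc i), fun i x hx => by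
    beta_reduce; rw [hge i x hx]; ring⟩

theorem EqMod.symm (h : EqMod Λ p q) : EqMod Λ q p := by
  obtain ⟨g, hg, hgc, hge⟩ := h
  exact ⟨_, hg.const_mul (-1), fun i => continuous_const.mul (hgc i), fun i x hx => by
    rw [hge i x hx]; ring⟩

theorem EqMod.l2Tame (hΛ : ∀ i, 1 ≤ Λ i) (h : EqMod Λ p q) (hq : L2Tame Λ q)
    (hqc : ∀ i, Continuous (q i)) : L2Tame Λ p := by
  obtain ⟨g, hg, hgc, hge⟩ := h
  exact (hq.add hΛ hg hqc hgc).congr hge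

theorem EqMod.sum (hΛ : ∀ i, 1 ≤ Λ i) {κ : Type*} (s : Finset κ) {p q : κ → ι → Pt → ℝ}
    (h : ∀ k, EqMod Λ (p k) (q k)) :
    EqMod Λ (fun i x => ∑ k ∈ s, p k i x) fun i x => ∑ k ∈ s, q k i x := by
  choose g hg hgc hge using h
  refine ⟨fun i x => ∑ k ∈ s, g k i x, L2Tame.sum hΛ s (fun k _ => hg k) hgc,
    fun i => continuous_finsetSum _ fun k _ => hgc k i, fun i x hx => ?_⟩
  rw [← Finset.sum_add_distrib]
  exact Finset.sum_congr rfl fun k _ => hge k i x hx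

end Tame

/-! ### Quantities controlled by the energy -/

/-- The `i`-th component of the flow map as a space-time function. -/
def comp (η : ℝ → Pt → Pt) (i : Fin 3) (p : ℝ × Pt) : ℝ := η p.1 p.2 i

section Extraction

variable {η : ℝ → Pt → Pt}

theorem comp_contDiff (h : ContDiff ℝ ∞ fun p : ℝ × Pt => η p.1 p.2) (i : Fin 3) :
    ContDiff ℝ ∞ (comp η i) := contDiff_pi.1 h i

theorem dtv_eq_sdL (h : ContDiff ℝ ∞ fun p : ℝ × Pt => η p.1 p.2) (m : ℕ) (t : ℝ) (x : Pt)
    (i : Fin 3) : dtv m η t x i = sdL (List.replicate m none) (comp η i) (t, x) :=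
  dt_eq_sdL isOpen_univ (comp_contDiff h i).contDiffOn (fun _ _ _ => rfl) m t x (mem_univ _)

theorem vel_eq_sd (h : ContDiff ℝ ∞ fun p : ℝ × Pt => η p.1 p.2) (t : ℝ) (x : Pt) (i : Fin 3) :
    vel η t x i = sd none (comp η i) (t, x) := dtv_eq_sdL h 1 t x i

theorem dtv_vel_eq_sdL (h : ContDiff ℝ ∞ fun p : ℝ × Pt => η p.1 p.2) (m : ℕ) (t : ℝ) (x : Pt)
    (i : Fin 3) :
    dtv m (vel η) t x i = sdL (List.replicate m none) (sd none (comp η i)) (t, x) :=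
  dt_eq_sdL isOpen_univ (sd_contDiff (comp_contDiff h i) none).contDiffOn
    (fun s y _ => vel_eq_sd h s y i) m t x (mem_univ _)

theorem sobSqV_nonneg (k : ℕ) (F : Pt → Pt) : 0 ≤ sobSqV k F :=
  Finset.sum_nonneg fun _ _ => sobSq_nonneg _ _

theorem tanSqV_nonneg (w : Pt → ℝ) (k : ℕ) (F : Pt → Pt) : 0 ≤ tanSqV w k F :=
  Finset.sum_nonneg fun _ _ => tanSq_nonneg _ _ _

theorem sobSq_le_sobSqV (k : ℕ) (F : Pt → Pt) (i : Fin 3) :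
    sobSq k (fun x => F x i) ≤ sobSqV k F :=
  Finset.single_le_sum (f := fun i => sobSq k fun x => F x i) (fun _ _ => sobSq_nonneg _ _)
    (Finset.mem_univ i)

theorem tanSq_le_tanSqV (w : Pt → ℝ) (k : ℕ) (F : Pt → Pt) (i : Fin 3) :
    tanSq w k (fun x => F x i) ≤ tanSqV w k F :=
  Finset.single_le_sum (f := fun i => tanSq w k fun x => F x i) (fun _ _ => tanSq_nonneg _ _ _)
    (Finset.mem_univ i)

/-- Each of the five groups of terms in the energy is bounded by the energy. -/
theorem energy_parts (ρ₀ : Pt → ℝ) (η : ℝ → Pt → Pt) (t : ℝ) :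
    (∀ a ≤ 4, sobSqV (4 - a) (dtv (2 * a) η t) ≤ energy ρ₀ η t) ∧
    (∀ a ≤ 4, ∀ j, tanSqV ρ₀ (4 - a) (fun x i => pd j (fun y => dtv (2 * a) η t y i) x)
      ≤ energy ρ₀ η t) ∧
    (∀ a ≤ 4, tanSqV (fun x => Real.sqrt (ρ₀ x)) (4 - a) (dtv (2 * a) (vel η) t)
      ≤ energy ρ₀ η t) ∧
    sobSqV 3 (lagCurl η t (vel η t)) ≤ energy ρ₀ η t ∧
    tanSqV ρ₀ 4 (lagCurl η t (vel η t)) ≤ energy ρ₀ η t ∧ 0 ≤ energy ρ₀ η t := by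
  have h₁ : 0 ≤ ∑ a ∈ Finset.range 5, sobSqV (4 - a) (dtv (2 * a) η t) :=
    Finset.sum_nonneg fun _ _ => sobSqV_nonneg _ _
  have h₂' : ∀ a, 0 ≤ ∑ j, tanSqV ρ₀ (4 - a) (fun x i => pd j (fun y => dtv (2 * a) η t y i) x) :=
    fun a => Finset.sum_nonneg fun _ _ => tanSqV_nonneg _ _ _
  have h₂ : 0 ≤ ∑ a ∈ Finset.range 5,
      ((∑ j, tanSqV ρ₀ (4 - a) (fun x i => pd j (fun y => dtv (2 * a) η t y i) x))
        + tanSqV (fun x => Real.sqrt (ρ₀ x)) (4 - a) (dtv (2 * a) (vel η) t)) :=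
    Finset.sum_nonneg fun a _ => add_nonneg (h₂' a) (tanSqV_nonneg _ _ _)
  have h₃ : 0 ≤ ∑ a ∈ Finset.range 4, sobSq (4 - a) (fun x => ρ₀ x * dt (2 * a) (jacInvSq η) t x) :=
    Finset.sum_nonneg fun _ _ => sobSq_nonneg _ _
  have h₄ := sobSqV_nonneg 3 (lagCurl η t (vel η t))
  have h₅ := tanSqV_nonneg ρ₀ 4 (lagCurl η t (vel η t))
  have key : ∀ a ≤ 4, (∑ j, tanSqV ρ₀ (4 - a) (fun x i => pd j (fun y => dtv (2 * a) η t y i) x))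
        + tanSqV (fun x => Real.sqrt (ρ₀ x)) (4 - a) (dtv (2 * a) (vel η) t) ≤ energy ρ₀ η t := by
    intro a ha
    have := Finset.single_le_sum (f := fun a =>
      (∑ j, tanSqV ρ₀ (4 - a) (fun x i => pd j (fun y => dtv (2 * a) η t y i) x))
        + tanSqV (fun x => Real.sqrt (ρ₀ x)) (4 - a) (dtv (2 * a) (vel η) t))
      (fun a _ => add_nonneg (h₂' a) (tanSqV_nonneg _ _ _)) (Finset.mem_range.2 (by omega : a < 5))
    unfold energy
    linarith
  refine ⟨fun a ha => ?_, fun a ha j => ?_, fun a ha => ?_, ?_, ?_, ?_⟩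
  · have := Finset.single_le_sum (f := fun a => sobSqV (4 - a) (dtv (2 * a) η t))
      (fun _ _ => sobSqV_nonneg _ _) (Finset.mem_range.2 (by omega : a < 5))
    unfold energy
    linarith
  · have := Finset.single_le_sum (f := fun j =>
      tanSqV ρ₀ (4 - a) (fun x i => pd j (fun y => dtv (2 * a) η t y i) x))
      (fun _ _ => tanSqV_nonneg _ _ _) (Finset.mem_univ j)
    have := key a ha
    have := tanSqV_nonneg (fun x => Real.sqrt (ρ₀ x)) (4 - a) (dtv (2 * a) (vel η) t)
    linarith
  · have := key a ha
    have := h₂' a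
    linarith
  all_goals unfold energy; linarith

theorem energy_nonneg (ρ₀ : Pt → ℝ) (η : ℝ → Pt → Pt) (t : ℝ) : 0 ≤ energy ρ₀ η t :=
  (energy_parts ρ₀ η t).2.2.2.2.2

theorem sdL_replicate_sd_none (F : ℝ × Pt → ℝ) (m : ℕ) :
    sdL (List.replicate m none) (sd none F) = sdL (List.replicate (m + 1) none) F := by
  rw [List.replicate_succ', sdL_append]; rfl

theorem integral_sdL_le_sobSq {F : ℝ × Pt → ℝ} (hF : ContDiff ℝ ∞ F) {m k : ℕ} {t : ℝ} {g : Pt → ℝ}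
    (hg : ∀ x, g x = sdL (List.replicate m none) F (t, x)) {L : List (Option (Fin 3))}
    (hm : L.count none = m) (hk : ∑ i, mcount L i ≤ k) :
    ∫ x in cell, sdL L F (t, x) ^ 2 ≤ sobSq k g := by
  have := le_sobSq isOpen_univ (sdL_contDiff hF (List.replicate m none)).contDiffOn
    (fun _ _ => mem_univ _) (fun y _ => hg y) k (mcount L) hk
  rwa [← sdL_append, ← hm, ← sdL_perm hF (perm_canonical L)] at this

theorem ord_perm {L L' : List (Option (Fin 3))} (h : L.Perm L') : ord L = ord L' := by
  rw [ord_eq_count, ord_eq_count, h.count_eq, h.count_eq, h.count_eq, h.count_eq]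

theorem ord_eq_sum_mcount (L : List (Option (Fin 3))) :
    ord L = L.count none + 2 * ∑ i, mcount L i := by
  rw [ord_eq_count, Fin.sum_univ_three]; rfl

/-- With 2a time derivatives, order at most 8 leaves at most 4 - a spatial ones, exactly the Sobolev
index in the energy. -/
theorem integral_even_le_energy (h : ContDiff ℝ ∞ fun p : ℝ × Pt => η p.1 p.2)
    (ρ₀ : Pt → ℝ) {L : List (Option (Fin 3))} {a : ℕ}
    (ha : L.count none = 2 * a) (hL : ord L ≤ 8) (i : Fin 3) (t : ℝ) :
    ∫ x in cell, sdL L (comp η i) (t, x) ^ 2 ≤ energy ρ₀ η t := by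
  have ho := ord_eq_sum_mcount L
  refine (integral_sdL_le_sobSq (comp_contDiff h i) (k := 4 - a)
    (fun x => dtv_eq_sdL h (2 * a) t x i) ha (by omega)).trans ?_
  exact (sobSq_le_sobSqV (4 - a) (dtv (2 * a) η t) i).trans
    ((energy_parts ρ₀ η t).1 a (by omega))

theorem integral_odd_le_initialSize (h : ContDiff ℝ ∞ fun p : ℝ × Pt => η p.1 p.2)
    {L : List (Option (Fin 3))} {b : ℕ}
    (hb : L.count none = 2 * b + 1) (hL : ord L ≤ 8) (i : Fin 3) :
    ∫ x in cell, sdL L (comp η i) (0, x) ^ 2 ≤ initialSize η := by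
  have ho := ord_eq_sum_mcount L
  refine (integral_sdL_le_sobSq (comp_contDiff h i) (k := 3 - b)
    (fun x => (dtv_vel_eq_sdL h (2 * b) 0 x i).trans
      (by rw [sdL_replicate_sd_none])) hb (by omega)).trans ?_
  refine (sobSq_le_sobSqV (3 - b) (dtv (2 * b) (vel η) 0) i).trans ?_
  exact Finset.single_le_sum (f := fun b => sobSqV (3 - b) (dtv (2 * b) (vel η) 0))
    (fun _ _ => sobSqV_nonneg _ _) (Finset.mem_range.2 (by omega : b < 4))

theorem integral_hor_le_tanSq {F : ℝ × Pt → ℝ} (hF : ContDiff ℝ ∞ F) (w : Pt → ℝ) {m k : ℕ} {t : ℝ}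
    {g : Pt → ℝ} (hg : ∀ x, g x = sdL (List.replicate m none) F (t, x))
    {L : List (Option (Fin 3))} (hH : IsHor L)
    (hm : L.count none = m) (hk : ord L = m + 2 * k) :
    ∫ x in cell, (w x * sdL L F (t, x)) ^ 2 ≤ tanSq w k g := by
  obtain ⟨l, hl⟩ := hH.perm_canonical
  have hlen : l.length = k := by
    have h₁ := ord_perm hl
    rw [ord_append, ord_hlist, ord_replicate_none] at h₁
    omega
  have := le_tanSq isOpen_univ (sdL_contDiff hF (List.replicate m none)).contDiffOn
    (fun _ _ => mem_univ _) (fun y _ => hg y) w k l hlen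
  rwa [← sdL_append, ← hm, ← sdL_perm hF hl] at this

theorem integral_weighted_le_energy (h : ContDiff ℝ ∞ fun p : ℝ × Pt => η p.1 p.2)
    (ρ₀ : Pt → ℝ) {L : List (Option (Fin 3))} {a : ℕ}
    (hH : IsHor L) (ha : L.count none = 2 * a) (hL : ord L = 8) (j i : Fin 3) (t : ℝ) :
    ∫ x in cell, (ρ₀ x * sdL L (sd (some j) (comp η i)) (t, x)) ^ 2 ≤ energy ρ₀ η t := by
  have ho := ord_eq_sum_mcount L
  refine (integral_hor_le_tanSq (sd_contDiff (comp_contDiff h i) _) ρ₀ (k := 4 - a)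
    (g := fun x => pd j (fun y => dtv (2 * a) η t y i) x) (fun x => ?_) hH ha (by omega)).trans ?_
  · rw [pd_eq_sd isOpen_univ (sdL_contDiff (comp_contDiff h i) _).contDiffOn
      (fun y _ => dtv_eq_sdL h (2 * a) t y i) j x (mem_univ _)]
    have := sdL_perm (comp_contDiff h i) (L := some j :: List.replicate (2 * a) none)
      (L' := List.replicate (2 * a) none ++ [some j]) (List.perm_append_singleton _ _).symm
    rw [sdL_append] at this
    exact congrFun this _
  · exact (tanSq_le_tanSqV ρ₀ (4 - a)
      (fun x i => pd j (fun y => dtv (2 * a) η t y i) x) i).trans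
      ((energy_parts ρ₀ η t).2.1 a (by omega) j)

/-- The only part of the energy that reaches order 9 in η. It supplies the horizontal entries in the
weighted bound at the initial time. -/
theorem integral_sqrt_le_energy (h : ContDiff ℝ ∞ fun p : ℝ × Pt => η p.1 p.2)
    (ρ₀ : Pt → ℝ) {L : List (Option (Fin 3))} {a : ℕ}
    (hH : IsHor L) (ha : L.count none = 2 * a + 1) (hL : ord L = 9) (i : Fin 3) (t : ℝ) :
    ∫ x in cell, (Real.sqrt (ρ₀ x) * sdL L (comp η i) (t, x)) ^ 2 ≤ energy ρ₀ η t := by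
  have ho := ord_eq_sum_mcount L
  refine (integral_hor_le_tanSq (comp_contDiff h i) (fun x => Real.sqrt (ρ₀ x)) (k := 4 - a)
    (g := fun x => dtv (2 * a) (vel η) t x i) (fun x => ?_) hH ha (by omega)).trans ?_
  · rw [dtv_vel_eq_sdL h, sdL_replicate_sd_none]
  · exact (tanSq_le_tanSqV _ (4 - a) (dtv (2 * a) (vel η) t) i).trans
      ((energy_parts ρ₀ η t).2.2.1 a (by omega))

end Extraction

/-! ### Identities satisfied by a solution -/

/-- The entry `η^i,_k` of the deformation tensor as a space-time function. -/
def gr (η : ℝ → Pt → Pt) (i k : Fin 3) : ℝ × Pt → ℝ := sd (some k) (comp η i)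

/-- The Jacobian determinant as a space-time function. -/
def jacF (η : ℝ → Pt → Pt) : ℝ × Pt → ℝ :=
  gr η 0 0 * gr η 1 1 * gr η 2 2 - gr η 0 0 * gr η 1 2 * gr η 2 1
    - gr η 0 1 * gr η 1 0 * gr η 2 2 + gr η 0 1 * gr η 1 2 * gr η 2 0
    + gr η 0 2 * gr η 1 0 * gr η 2 1 - gr η 0 2 * gr η 1 1 * gr η 2 0

/-- The function `η^i,_k η_tt^i`. -/
def accel (η : ℝ → Pt → Pt) (k : Fin 3) : ℝ × Pt → ℝ :=
  ∑ i, gr η i k * sdL [none, none] (comp η i)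

/-- The antisymmetric part `η^i,_k v^i,_l - η^i,_l v^i,_k`. -/
def cauchyInv (η : ℝ → Pt → Pt) (k l : Fin 3) : ℝ × Pt → ℝ :=
  ∑ i, (gr η i k * sd none (gr η i l) - gr η i l * sd none (gr η i k))

section Smooth

variable {η : ℝ → Pt → Pt}

theorem gr_contDiff (h : ContDiff ℝ ∞ fun p : ℝ × Pt => η p.1 p.2) (i k : Fin 3) :
    ContDiff ℝ ∞ (gr η i k) := sd_contDiff (comp_contDiff h i) _

theorem jacF_contDiff (h : ContDiff ℝ ∞ fun p : ℝ × Pt => η p.1 p.2) : ContDiff ℝ ∞ (jacF η) := by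
  have hg := gr_contDiff h
  unfold jacF
  refine ContDiff.sub (ContDiff.add (ContDiff.add (ContDiff.sub (ContDiff.sub ?_ ?_) ?_) ?_) ?_) ?_
  all_goals exact ((hg _ _).mul (hg _ _)).mul (hg _ _)

theorem accel_contDiff (h : ContDiff ℝ ∞ fun p : ℝ × Pt => η p.1 p.2) (k : Fin 3) :
    ContDiff ℝ ∞ (accel η k) :=
  contDiff_finset_sum fun i => (gr_contDiff h i k).mul (sdL_contDiff (comp_contDiff h i) _)

theorem cauchyInv_contDiff (h : ContDiff ℝ ∞ fun p : ℝ × Pt => η p.1 p.2) (k l : Fin 3) :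
    ContDiff ℝ ∞ (cauchyInv η k l) :=
  contDiff_finset_sum fun i => ((gr_contDiff h i k).mul (sd_contDiff (gr_contDiff h i l) _)).sub
    ((gr_contDiff h i l).mul (sd_contDiff (gr_contDiff h i k) _))

theorem defTensor_eq (h : ContDiff ℝ ∞ fun p : ℝ × Pt => η p.1 p.2) (t : ℝ) (x : Pt) (i k : Fin 3) :
    defTensor η t x i k = gr η i k (t, x) :=
  pd_eq_sd isOpen_univ (comp_contDiff h i).contDiffOn (fun _ _ => rfl) k x (mem_univ _)

theorem jac_eq (h : ContDiff ℝ ∞ fun p : ℝ × Pt => η p.1 p.2) (t : ℝ) (x : Pt) :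
    jac η t x = jacF η (t, x) := by
  rw [jac, Matrix.det_fin_three]
  simp only [defTensor_eq h, jacF, Pi.sub_apply, Pi.add_apply, Pi.mul_apply]

end Smooth

section Solution

variable {ρ₀ : Pt → ℝ} {T : ℝ} {u₀ : Pt → Pt} {η : ℝ → Pt → Pt}

theorem density_pos (hρ : IsInitialDensity ρ₀) {x : Pt} (hx : x ∈ slab) : 0 < ρ₀ x := by
  obtain ⟨c, hc, h⟩ := hρ.lower
  have h₁ := h x (slab_subset_closedSlab hx)
  have h₂ : 0 < 1 - x 2 := by linarith [hx.2]
  have := mul_pos hc h₂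
  linarith

/-- The density as a space-time function. -/
def dens (ρ₀ : Pt → ℝ) (p : ℝ × Pt) : ℝ := ρ₀ p.2

theorem dens_contDiff (hρ : IsInitialDensity ρ₀) : ContDiff ℝ ∞ (dens ρ₀) :=
  hρ.smooth.comp contDiff_snd

theorem sd_dens (hρ : IsInitialDensity ρ₀) (t : ℝ) (x : Pt) (k : Fin 3) :
    sd (some k) (dens ρ₀) (t, x) = pd k ρ₀ x :=
  (pd_eq_sd isOpen_univ (dens_contDiff hρ).contDiffOn (fun _ _ => rfl) k x (mem_univ _)).symm

/-- The momentum equation multiplied by the deformation tensor. -/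
theorem momentum_polynomial (hρ : IsInitialDensity ρ₀) (hs : IsSmoothSolution ρ₀ T u₀ η)
    (hJ : ∀ t ∈ Icc 0 T, ∀ x ∈ slab, 1 / 2 ≤ jac η t x ∧ jac η t x ≤ 3 / 2)
    {t : ℝ} (ht : t ∈ Ioc 0 T) {x : Pt} (hx : x ∈ slab) (l : Fin 3) :
    jacF η (t, x) ^ 2 * accel η l (t, x) + 2 * jacF η (t, x) * pd l ρ₀ x
      - 2 * ρ₀ x * sd (some l) (jacF η) (t, x) = 0 := by
  have h := hs.smooth
  have hJF := jacF_contDiff h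
  have hJ1 := (hJ t (Ioc_subset_Icc_self ht) x hx).1
  have hj0 : jacF η (t, x) ≠ 0 := by rw [← jac_eq h]; linarith
  have hρ0 := density_pos hρ hx
  set M := defTensor η t x with hM
  have hdet : M.det = jacF η (t, x) := jac_eq h t x
  -- Contracting a with Dη gives J times the identity, so multiplication by Dη removes the cofactors
  -- from the pressure term and leaves a pure derivative in direction l.
  have hcof : ∀ k, ∑ i, cof η t x k i * M i l = if k = l then jacF η (t, x) else 0 := by
    intro k
    have h₁ : (cof η t x * M) k l = ∑ i, cof η t x k i * M i l := Matrix.mul_apply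
    rw [← h₁, cof, invDef, jac_eq h, Matrix.smul_mul, Matrix.nonsing_inv_mul]
    · simp [Matrix.one_apply]
    · rw [isUnit_iff_ne_zero]; exact hdet ▸ hj0
  have hpd : pd l (fun y => ρ₀ y ^ 2 * jacInvSq η t y) x
      = 2 * ρ₀ x * pd l ρ₀ x * (jacF η (t, x) ^ 2)⁻¹
        - 2 * ρ₀ x ^ 2 * sd (some l) (jacF η) (t, x) * (jacF η (t, x) ^ 3)⁻¹ := by
    have hd := (contDiff_differentiable hρ.smooth x).hasFDerivAt
    have hjs : ContDiff ℝ ∞ fun y => jac η t y := by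
      simp only [jac_eq h]; exact hJF.comp (contDiff_prodMk_right t)
    have hjd := (contDiff_differentiable hjs x).hasFDerivAt
    have hpj : fderiv ℝ (fun y => jac η t y) x (unitVec l) = sd (some l) (jacF η) (t, x) :=
      pd_eq_sd isOpen_univ hJF.contDiffOn (fun y _ => jac_eq h t y) l x (mem_univ _)
    have hne : jac η t x ^ 2 ≠ 0 := by rw [jac_eq h]; positivity
    have hinv := (hasDerivAt_inv hne).comp_hasFDerivAt x (hjd.pow 2)
    have hall := (hd.pow 2).mul hinv
    have : pd l (fun y => ρ₀ y ^ 2 * jacInvSq η t y) x = _ := congrArg (· (unitVec l)) hall.fderiv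
    rw [this]
    simp only [_root_.add_apply, _root_.smul_apply, hpj, smul_eq_mul,
      Function.comp_apply, nsmul_eq_mul]
    simp only [jac_eq h, pd]
    field_simp
    push_cast
    ring
  have hmom : ∑ i, M i l * (ρ₀ x * dtv 1 (vel η) t x i
      + ∑ k, cof η t x k i * pd k (fun y => ρ₀ y ^ 2 * jacInvSq η t y) x) = 0 :=
    Finset.sum_eq_zero fun i _ => by rw [hs.momentum t ht x hx i, mul_zero]
  have h₂ : ∑ i, M i l * (∑ k, cof η t x k i * pd k (fun y => ρ₀ y ^ 2 * jacInvSq η t y) x)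
      = jacF η (t, x) * pd l (fun y => ρ₀ y ^ 2 * jacInvSq η t y) x := by
    simp only [Finset.mul_sum]
    rw [Finset.sum_comm]
    have : ∀ k, ∑ i, M i l * (cof η t x k i * pd k (fun y => ρ₀ y ^ 2 * jacInvSq η t y) x)
        = (if k = l then jacF η (t, x) else 0) * pd k (fun y => ρ₀ y ^ 2 * jacInvSq η t y) x := by
      intro k
      rw [← hcof k, Finset.sum_mul]
      exact Finset.sum_congr rfl fun i _ => by ring
    simp only [this, ite_mul, zero_mul, Finset.sum_ite_eq', Finset.mem_univ, if_true]
  have h₃ : ∑ i, M i l * (ρ₀ x * dtv 1 (vel η) t x i) = ρ₀ x * accel η l (t, x) := by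
    rw [accel, Finset.sum_apply, Finset.mul_sum]
    refine Finset.sum_congr rfl fun i _ => ?_
    rw [dtv_vel_eq_sdL h, hM, defTensor_eq h]
    simp [List.replicate]
    ring
  simp only [mul_add, Finset.sum_add_distrib] at hmom
  rw [h₂, h₃, hpd] at hmom
  -- The contracted equation carries a factor ρ₀, which is positive in the open slab and is divided
  -- out. The factor J² clears the denominators.
  have h₄ : ρ₀ x * (jacF η (t, x) ^ 2 * accel η l (t, x) + 2 * jacF η (t, x) * pd l ρ₀ x
      - 2 * ρ₀ x * sd (some l) (jacF η) (t, x)) = 0 := by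
    have : ρ₀ x * (jacF η (t, x) ^ 2 * accel η l (t, x) + 2 * jacF η (t, x) * pd l ρ₀ x
      - 2 * ρ₀ x * sd (some l) (jacF η) (t, x)) = jacF η (t, x) ^ 2 * (ρ₀ x * accel η l (t, x) +
        jacF η (t, x) * (2 * ρ₀ x * pd l ρ₀ x * (jacF η (t, x) ^ 2)⁻¹
        - 2 * ρ₀ x ^ 2 * sd (some l) (jacF η) (t, x) * (jacF η (t, x) ^ 3)⁻¹)) := by
      field_simp
      ring
    rw [this, hmom, mul_zero]
  exact (mul_eq_zero.1 h₄).resolve_left hρ0.ne'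

/-- The momentum equation in the form in which it is differentiated. -/
def momentumF (ρ₀ : Pt → ℝ) (η : ℝ → Pt → Pt) (l : Fin 3) : ℝ × Pt → ℝ :=
  (1 / 2 : ℝ) • (jacF η * jacF η * accel η l) + (2 : ℝ) • (jacF η * sd (some l) (dens ρ₀))
    - sd (some l) (dens ρ₀ * jacF η)

/-- Half of the polynomial momentum equation, with Jρ₀,_l - ρ₀J,_l rewritten as 2Jρ₀,_l - (ρ₀J),_l.
In this form a derivative of J appears only inside the gradient of ρ₀J, the quantity to which the
elliptic estimate applies. -/
theorem sdL_momentumF (hρ : IsInitialDensity ρ₀) (hs : IsSmoothSolution ρ₀ T u₀ η) (hT : 0 < T)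
    (hJ : ∀ t ∈ Icc 0 T, ∀ x ∈ slab, 1 / 2 ≤ jac η t x ∧ jac η t x ≤ 3 / 2) (l : Fin 3)
    (L : List (Option (Fin 3))) {t : ℝ} (ht : t ∈ Icc 0 T) {x : Pt} (hx : x ∈ closedSlab) :
    sdL L (momentumF ρ₀ η l) (t, x) = 0 := by
  have h := hs.smooth
  have hJF := jacF_contDiff h
  have hd := dens_contDiff hρ
  refine sdL_eq_zero_of_slab hT ?_ ?_ L t ht x hx
  · exact ((contDiff_const.smul ((hJF.mul hJF).mul (accel_contDiff h l))).add
      (contDiff_const.smul (hJF.mul (sd_contDiff hd _)))).sub (sd_contDiff (hd.mul hJF) _)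
  · intro t ht x hx
    have := momentum_polynomial hρ hs hJ (Ioo_subset_Ioc_self ht) hx l
    rw [momentumF, sd_mul hd hJF]
    simp only [Pi.sub_apply, Pi.add_apply, Pi.smul_apply, Pi.mul_apply, smul_eq_mul, sd_dens hρ, dens]
    linarith

/-- The vector field `η^i,_k η_tt^i` is curl free. -/
theorem sd_accel_symm (hρ : IsInitialDensity ρ₀) (hs : IsSmoothSolution ρ₀ T u₀ η)
    (hJ : ∀ t ∈ Icc 0 T, ∀ x ∈ slab, 1 / 2 ≤ jac η t x ∧ jac η t x ≤ 3 / 2)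
    {t : ℝ} (ht : t ∈ Ioo 0 T) {x : Pt} (hx : x ∈ slab) (k l : Fin 3) :
    sd (some k) (accel η l) (t, x) = sd (some l) (accel η k) (t, x) := by
  have h := hs.smooth
  have hJF := jacF_contDiff h
  have hd := dens_contDiff hρ
  set O : Set (ℝ × Pt) := Ioo 0 T ×ˢ slab with hO
  have hOo : IsOpen O := isOpen_Ioo.prod isOpen_slab
  have hj0 : ∀ p ∈ O, jacF η p ≠ 0 := fun p hp => by
    have := (hJ p.1 (Ioo_subset_Icc_self hp.1) p.2 hp.2).1
    rw [jac_eq h] at this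
    exact ne_of_gt (by linarith)
  -- The potential -2ρ₀/J: the contracted momentum equation says that η^i,_l η_tt^i is its gradient,
  -- and the asserted symmetry is the symmetry of its second derivatives.
  set G : ℝ × Pt → ℝ := fun p => -2 * (dens ρ₀ p / jacF η p) with hG
  have hGs : ∀ p ∈ O, ContDiffAt ℝ ∞ G p := fun p hp =>
    contDiffAt_const.mul (hd.contDiffAt.div hJF.contDiffAt (hj0 p hp))
  have hSG : ∀ l, ∀ p ∈ O, accel η l p = sd (some l) G p := by
    intro l p hp
    have h₁ := (((contDiff_differentiable hd p).hasFDerivAt).mul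
      ((hasDerivAt_inv (hj0 p hp)).comp_hasFDerivAt p
        (contDiff_differentiable hJF p).hasFDerivAt)).const_mul (-2)
    have h₂ : sd (some l) G p = _ := congrArg (· (dir (some l))) h₁.fderiv
    rw [h₂]
    have h₃ := momentum_polynomial hρ hs hJ (Ioo_subset_Ioc_self hp.1) hp.2 l
    have h₄ := sd_dens hρ p.1 p.2 l
    have h₅ := hj0 p hp
    simp only [sd] at h₃ h₄
    simp only [_root_.add_apply, _root_.smul_apply, smul_eq_mul,
      Function.comp_apply, h₄]
    simp only [dens]
    field_simp
    linarith
  have hsd : ∀ k l, sd (some k) (accel η l) (t, x) = sd (some k) (sd (some l) G) (t, x) := by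
    intro k l
    have : accel η l =ᶠ[nhds (t, x)] sd (some l) G :=
      Filter.mem_of_superset (hOo.mem_nhds ⟨ht, hx⟩) (hSG l)
    rw [sd, this.fderiv_eq]; rfl
  rw [hsd, hsd]
  exact sd_comm_of_contDiffAt (hGs _ ⟨ht, hx⟩) _ _

/-- The Cauchy invariants do not depend on time. -/
theorem sd_none_cauchyInv (hρ : IsInitialDensity ρ₀) (hs : IsSmoothSolution ρ₀ T u₀ η)
    (hJ : ∀ t ∈ Icc 0 T, ∀ x ∈ slab, 1 / 2 ≤ jac η t x ∧ jac η t x ≤ 3 / 2)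
    {t : ℝ} (ht : t ∈ Ioo 0 T) {x : Pt} (hx : x ∈ slab) (k l : Fin 3) :
    sd none (cauchyInv η k l) (t, x) = 0 := by
  have h := hs.smooth
  have hc := comp_contDiff h
  have hg := gr_contDiff h
  have h₁ := sd_accel_symm hρ hs hJ ht hx k l
  have hS : ∀ k l, sd (some k) (accel η l) (t, x) = ∑ i, (sdL [some k, some l] (comp η i) (t, x) *
      sdL [none, none] (comp η i) (t, x) + gr η i l (t, x) * sd none (sd none (gr η i k)) (t, x)) := by
    intro k l
    have : sd (some k) (accel η l) = ∑ i, sdL [some k] (gr η i l * sdL [none, none] (comp η i)) :=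
      sdL_sum _ (fun i => (hg i l).mul (sdL_contDiff (hc i) _)) [some k]
    rw [this, Finset.sum_apply]
    refine Finset.sum_congr rfl fun i _ => ?_
    rw [sdL_cons, sdL_nil, sd_mul (hg i l) (sdL_contDiff (hc i) _)]
    have h₂ : sd (some k) (sdL [none, none] (comp η i)) = sd none (sd none (gr η i k)) := by
      simp only [sdL_cons, sdL_nil, gr]
      rw [sd_comm (sd_contDiff (hc i) _), sd_comm (hc i)]
    rw [h₂]; rfl
  have hW : sd none (cauchyInv η k l) (t, x) = ∑ i, (gr η i k (t, x) * sd none (sd none (gr η i l)) (t, x)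
      - gr η i l (t, x) * sd none (sd none (gr η i k)) (t, x)) := by
    have hm : ∀ i k l, ContDiff ℝ ∞ (gr η i k * sd none (gr η i l)) := fun i k l =>
      (hg i k).mul (sd_contDiff (hg i l) _)
    have : sd none (cauchyInv η k l) = ∑ i, sdL [none]
        (gr η i k * sd none (gr η i l) - gr η i l * sd none (gr η i k)) :=
      sdL_sum _ (fun i => (hm i k l).sub (hm i l k)) [none]
    rw [this, Finset.sum_apply]
    refine Finset.sum_congr rfl fun i _ => ?_
    rw [sdL_cons, sdL_nil, sd_sub (hm i k l) (hm i l k), sd_mul (hg i k) (sd_contDiff (hg i l) _),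
      sd_mul (hg i l) (sd_contDiff (hg i k) _)]
    simp only [Pi.sub_apply, Pi.add_apply, Pi.mul_apply]
    ring
  rw [hS, hS] at h₁
  rw [hW, Finset.sum_sub_distrib, sub_eq_zero]
  simp only [Finset.sum_add_distrib] at h₁
  -- The terms η^i,_kl η_tt^i are symmetric in k and l and cancel, leaving the time derivative of
  -- the invariant.
  have h₃ : ∀ i, sdL [some k, some l] (comp η i) = sdL [some l, some k] (comp η i) := fun i =>
    sdL_perm (hc i) (List.Perm.swap _ _ [])
  simp only [h₃] at h₁
  linarith

/-- A time derivative anywhere in the word can be moved to the innermost place, where it annihilates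
the invariant. -/
theorem sdL_cauchyInv_time (hρ : IsInitialDensity ρ₀) (hs : IsSmoothSolution ρ₀ T u₀ η) (hT : 0 < T)
    (hJ : ∀ t ∈ Icc 0 T, ∀ x ∈ slab, 1 / 2 ≤ jac η t x ∧ jac η t x ≤ 3 / 2) (k l : Fin 3)
    {L : List (Option (Fin 3))} (hL : none ∈ L) {t : ℝ} (ht : t ∈ Icc 0 T) {x : Pt}
    (hx : x ∈ closedSlab) : sdL L (cauchyInv η k l) (t, x) = 0 := by
  have hc := cauchyInv_contDiff hs.smooth k l
  obtain ⟨A, B, rfl⟩ := List.append_of_mem hL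
  have hp : (A ++ none :: B).Perm ((A ++ B) ++ [none]) :=
    List.perm_middle.trans (List.perm_append_singleton _ _).symm
  rw [sdL_perm hc hp, sdL_append]
  exact sdL_eq_zero_of_slab hT (sd_contDiff hc none)
    (fun t ht x hx => sd_none_cauchyInv hρ hs hJ ht hx k l) _ t ht x hx

/-- The time derivative of D^L of the invariant vanishes on [0,T], so integration in time gives
constancy. -/
theorem sdL_cauchyInv_eq_initial (hρ : IsInitialDensity ρ₀) (hs : IsSmoothSolution ρ₀ T u₀ η)
    (hT : 0 < T) (hJ : ∀ t ∈ Icc 0 T, ∀ x ∈ slab, 1 / 2 ≤ jac η t x ∧ jac η t x ≤ 3 / 2)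
    (k l : Fin 3) (L : List (Option (Fin 3))) {t : ℝ} (ht : t ∈ Icc 0 T) {x : Pt}
    (hx : x ∈ closedSlab) : sdL L (cauchyInv η k l) (t, x) = sdL L (cauchyInv η k l) (0, x) := by
  have hc := sdL_contDiff (cauchyInv_contDiff hs.smooth k l) L
  have hd : ∀ s ∈ Icc 0 T, sd none (sdL L (cauchyInv η k l)) (s, x) = 0 := fun s hs' =>
    sdL_cauchyInv_time hρ hs hT hJ k l (L := none :: L) (by simp) hs' hx
  have h₁ : ∫ s in (0 : ℝ)..t, sd none (sdL L (cauchyInv η k l)) (s, x)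
      = sdL L (cauchyInv η k l) (t, x) - sdL L (cauchyInv η k l) (0, x) :=
    intervalIntegral.integral_eq_sub_of_hasDerivAt (fun s _ => hasDerivAt_sd hc s x)
      (((sd_contDiff hc none).continuous.comp (Continuous.prodMk_left x)).intervalIntegrable _ _)
  have h₂ : ∫ s in (0 : ℝ)..t, sd none (sdL L (cauchyInv η k l)) (s, x) = 0 := by
    rw [intervalIntegral.integral_congr (g := fun _ => 0)]
    · simp
    · intro s hs'
      rw [uIcc_of_le ht.1] at hs'
      exact hd s ⟨hs'.1, hs'.2.trans ht.2⟩
  linarith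

theorem gr_initial (hs : IsSmoothSolution ρ₀ T u₀ η) {x : Pt} (hx : x ∈ slab) (i k : Fin 3) :
    gr η i k (0, x) = if i = k then 1 else 0 := by
  rw [← defTensor_eq hs.smooth]
  have h₁ : (fun y => η 0 y i) =ᶠ[nhds x] fun y => y i :=
    Filter.mem_of_superset (isOpen_slab.mem_nhds hx) fun y hy => by
      simp [hs.initial_position y (slab_subset_closedSlab hy)]
  change fderiv ℝ (fun y => η 0 y i) x (unitVec k) = _
  rw [h₁.fderiv_eq]
  have : HasFDerivAt (fun y : Pt => y i) (ContinuousLinearMap.proj (R := ℝ) (φ := fun _ : Fin 3 => ℝ) i) x :=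
    (ContinuousLinearMap.proj (R := ℝ) (φ := fun _ : Fin 3 => ℝ) i).hasFDerivAt
  rw [this.fderiv]
  simp [unitVec, Pi.single_apply]

end Solution

/-! ### Boundedness of the energy -/

/-- A function that is bounded above on `[0,T]`. -/
def BddOn (T : ℝ) (f : ℝ → ℝ) : Prop := ∃ C, ∀ t ∈ Icc 0 T, f t ≤ C

theorem BddOn.add {T : ℝ} {f g : ℝ → ℝ} (hf : BddOn T f) (hg : BddOn T g) :
    BddOn T fun t => f t + g t := by
  obtain ⟨C, hC⟩ := hf
  obtain ⟨C', hC'⟩ := hg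
  exact ⟨C + C', fun t ht => add_le_add (hC t ht) (hC' t ht)⟩

theorem BddOn.sum {T : ℝ} {κ : Type*} (s : Finset κ) {f : κ → ℝ → ℝ} (hf : ∀ k ∈ s, BddOn T (f k)) :
    BddOn T fun t => ∑ k ∈ s, f k t := by
  classical
  choose! C hC using hf
  exact ⟨∑ k ∈ s, C k, fun t ht => Finset.sum_le_sum fun k hk => hC k hk t ht⟩

section Bounded

variable {T : ℝ} {U : Set (ℝ × Pt)} {F : ℝ × Pt → ℝ}

theorem exists_bound_sdL (hU : IsOpen U) (hF : ContDiffOn ℝ ∞ F U)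
    (hc : ∀ t ∈ Icc 0 T, ∀ x ∈ closedSlab, (t, x) ∈ U) (L : List (Option (Fin 3))) :
    ∃ C, ∀ t ∈ Icc 0 T, ∀ x ∈ cell, |sdL L F (t, x)| ≤ C := by
  have hsub : Icc 0 T ×ˢ Icc (0 : Pt) 1 ⊆ U := fun p hp =>
    hc p.1 hp.1 p.2 ⟨hp.2.1 2, hp.2.2 2⟩
  obtain ⟨C, hC⟩ := (isCompact_Icc.prod isCompact_Icc).exists_bound_of_continuousOn
    ((sdL_contDiffOn hU hF L).continuousOn.mono hsub)
  exact ⟨C, fun t ht x hx => hC (t, x) ⟨ht, cell_subset_Icc hx⟩⟩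

theorem bddOn_integral_sq {g : ℝ → Pt → ℝ} {C : ℝ}
    (h : ∀ t ∈ Icc 0 T, ∀ x ∈ cell, |g t x| ≤ C) :
    BddOn T fun t => ∫ x in cell, g t x ^ 2 := by
  have := isProbabilityMeasure_cell
  refine ⟨C ^ 2, fun t ht => ?_⟩
  have h₁ : ‖∫ x in cell, g t x ^ 2‖ ≤ C ^ 2 * volume.real cell := by
    refine norm_setIntegral_le_of_norm_le_const ?_ fun x hx => ?_
    · rw [cell_eq_pi, volume_pi]; simp
    · rw [norm_pow, Real.norm_eq_abs]
      exact pow_le_pow_left₀ (abs_nonneg _) (h t ht x hx) 2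
  have h₂ : volume.real (cell : Set Pt) = 1 := by simp [measureReal_def, cell_eq_pi, volume_pi]
  rw [h₂, mul_one] at h₁
  exact (le_abs_self _).trans h₁

theorem bddOn_sobSq (hU : IsOpen U) (hF : ContDiffOn ℝ ∞ F U)
    (hc : ∀ t ∈ Icc 0 T, ∀ x ∈ closedSlab, (t, x) ∈ U) {g : ℝ → Pt → ℝ}
    (hg : ∀ t y, (t, y) ∈ U → g t y = F (t, y)) (k : ℕ) : BddOn T fun t => sobSq k (g t) := by
  refine BddOn.sum _ fun j _ => BddOn.sum _ fun a _ => ?_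
  obtain ⟨C, hC⟩ := exists_bound_sdL hU hF hc (mlist a)
  refine bddOn_integral_sq (C := C) fun t ht x hx => ?_
  rw [mpd_eq_sdL hU hF (hg t) a x (hc t ht x (slab_subset_closedSlab (cell_subset_slab hx)))]
  exact hC t ht x hx

theorem bddOn_tanSq (hU : IsOpen U) (hF : ContDiffOn ℝ ∞ F U)
    (hc : ∀ t ∈ Icc 0 T, ∀ x ∈ closedSlab, (t, x) ∈ U) {g : ℝ → Pt → ℝ}
    (hg : ∀ t y, (t, y) ∈ U → g t y = F (t, y)) {w : Pt → ℝ} (hw : Continuous w) (k : ℕ) :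
    BddOn T fun t => tanSq w k (g t) := by
  induction k generalizing F g with
  | zero =>
    obtain ⟨C, hC⟩ := exists_bound_sdL hU hF hc []
    obtain ⟨C', hC'⟩ := isCompact_Icc.exists_bound_of_continuousOn (s := Icc (0 : Pt) 1)
      hw.continuousOn
    refine bddOn_integral_sq (C := C' * C) fun t ht x hx => ?_
    rw [hg t x (hc t ht x (slab_subset_closedSlab (cell_subset_slab hx))), abs_mul]
    exact mul_le_mul (hC' x (cell_subset_Icc hx)) (hC t ht x hx) (abs_nonneg _)
      ((abs_nonneg _).trans (hC' x (cell_subset_Icc hx)))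
  | succ k ih =>
    exact BddOn.sum _ fun α _ => ih (sd_contDiffOn hU hF (some (hor α)))
      fun t y hy => pd_eq_sd hU hF (hg t) (hor α) y hy

end Bounded

section Solution

variable {ρ₀ : Pt → ℝ} {T : ℝ} {u₀ : Pt → Pt} {η : ℝ → Pt → Pt}

/-- The lower bound for J is assumed in the open slab only; continuity carries it to the boundary.
-/
theorem jacF_ne_zero (hs : IsSmoothSolution ρ₀ T u₀ η)
    (hJ : ∀ t ∈ Icc 0 T, ∀ x ∈ slab, 1 / 2 ≤ jac η t x ∧ jac η t x ≤ 3 / 2) :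
    ∀ t ∈ Icc 0 T, ∀ x ∈ closedSlab, jacF η (t, x) ≠ 0 := by
  intro t ht x hx
  have h₁ : IsClosed {y : Pt | 1 / 2 ≤ jacF η (t, y)} := isClosed_le continuous_const
    ((jacF_contDiff hs.smooth).continuous.comp (Continuous.prodMk_right t))
  have h₂ := closure_minimal (fun y hy => by
    have := (hJ t ht y hy).1
    rwa [jac_eq hs.smooth] at this) h₁ (closure_slab hx)
  simp only [mem_ofPred_eq] at h₂
  exact ne_of_gt (by linarith)

/-- The components of the Lagrangian curl of the velocity are smooth where `J ≠ 0`. -/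
theorem exists_lagCurl (h : ContDiff ℝ ∞ fun p : ℝ × Pt => η p.1 p.2) (i : Fin 3) :
    ContDiffOn ℝ ∞ (fun p : ℝ × Pt => lagCurl η p.1 (vel η p.1) p.2 i) {p | jacF η p ≠ 0} := by
  have hg := gr_contDiff h
  have hpd : ∀ s k (p : ℝ × Pt), pd s (fun y => vel η p.1 y k) p.2 = sd (some s) (sd none (comp η k)) p :=
    fun s k p => pd_eq_sd isOpen_univ (sd_contDiff (comp_contDiff h k) none).contDiffOn
      (fun y _ => vel_eq_sd h p.1 y k) s p.2 (mem_univ _)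
  have hinv : ∀ s j (p : ℝ × Pt), invDef η p.1 p.2 s j
      = (jacF η p)⁻¹ * (defTensor η p.1 p.2).adjugate s j := by
    intro s j p
    have : (defTensor η p.1 p.2).det = jacF η p := jac_eq h p.1 p.2
    rw [invDef, Matrix.inv_def, Ring.inverse_eq_inv', Matrix.smul_apply, this, smul_eq_mul]
  have hadj : ∀ s j, ContDiff ℝ ∞ fun p : ℝ × Pt => (defTensor η p.1 p.2).adjugate s j := by
    intro s j
    simp only [Matrix.adjugate_fin_three, defTensor_eq h]
    fin_cases s <;> fin_cases j <;> simp <;> fun_prop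
  simp only [lagCurl, hpd, hinv]
  refine ContDiffOn.sum fun j _ => ContDiffOn.sum fun k _ => ContDiffOn.sum fun s _ => ?_
  refine (contDiffOn_const.mul (ContDiffOn.mul ?_ (hadj s j).contDiffOn)).mul
    (sd_contDiff (sd_contDiff (comp_contDiff h k) none) _).contDiffOn
  exact (jacF_contDiff h).contDiffOn.inv fun p hp => hp

/-- Every term is an integral of derivatives of a function smooth near the compact set [0,T] ×
[0,1]³. For the terms with J⁻² or the inverse of Dη, the relevant neighbourhood is the open set
where J ≠ 0. -/
theorem bddAbove_energy (hρ : IsInitialDensity ρ₀) (hs : IsSmoothSolution ρ₀ T u₀ η)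
    (hJ : ∀ t ∈ Icc 0 T, ∀ x ∈ slab, 1 / 2 ≤ jac η t x ∧ jac η t x ≤ 3 / 2) :
    BddAbove (energy ρ₀ η '' Icc 0 T) := by
  have h := hs.smooth
  have hρc := hρ.smooth.continuous
  have hJ0 := jacF_ne_zero hs hJ
  have hUo : IsOpen {p | jacF η p ≠ 0} :=
    isOpen_ne_fun (jacF_contDiff h).continuous continuous_const
  suffices BddOn T (energy ρ₀ η) by
    obtain ⟨C, hC⟩ := this
    exact ⟨C, by rintro _ ⟨t, ht, rfl⟩; exact hC t ht⟩
  have hcomp := comp_contDiff h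
  unfold energy
  refine BddOn.add (BddOn.add (BddOn.add (BddOn.add ?_ ?_) ?_) ?_) ?_
  · refine BddOn.sum _ fun a _ => BddOn.sum _ fun i _ => ?_
    exact bddOn_sobSq isOpen_univ (sdL_contDiff (hcomp i) (List.replicate (2 * a) none)).contDiffOn
      (fun _ _ _ _ => mem_univ _) (fun t y _ => dtv_eq_sdL h (2 * a) t y i) _
  · refine BddOn.sum _ fun a _ => BddOn.add (BddOn.sum _ fun j _ => BddOn.sum _ fun i _ => ?_)
      (BddOn.sum _ fun i _ => ?_)
    · exact bddOn_tanSq isOpen_univ (sd_contDiff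
        (sdL_contDiff (hcomp i) (List.replicate (2 * a) none)) (some j)).contDiffOn
        (fun _ _ _ _ => mem_univ _) (fun t y _ => pd_eq_sd isOpen_univ
          (sdL_contDiff (hcomp i) (List.replicate (2 * a) none)).contDiffOn
          (fun z _ => dtv_eq_sdL h (2 * a) t z i) j y (mem_univ _)) hρc _
    · exact bddOn_tanSq isOpen_univ (sdL_contDiff (sd_contDiff (hcomp i) none)
        (List.replicate (2 * a) none)).contDiffOn
        (fun _ _ _ _ => mem_univ _) (fun t y _ => dtv_vel_eq_sdL h (2 * a) t y i) hρc.sqrt _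
  · refine BddOn.sum _ fun a _ => ?_
    have hjs : ContDiffOn ℝ ∞ (fun p => (jacF η p ^ 2)⁻¹) {p | jacF η p ≠ 0} :=
      ((jacF_contDiff h).pow 2).contDiffOn.inv fun p hp => pow_ne_zero 2 hp
    refine bddOn_sobSq hUo ((dens_contDiff hρ).contDiffOn.mul
      (sdL_contDiffOn hUo hjs (List.replicate (2 * a) none))) hJ0 (fun t y hy => ?_) _
    rw [dt_eq_sdL hUo hjs (fun s z _ => by rw [jacInvSq, jac_eq h]) (2 * a) t y hy]
    rfl
  · exact BddOn.sum _ fun i _ => bddOn_sobSq hUo (exists_lagCurl h i) hJ0 (fun _ _ _ => rfl) _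
  · exact BddOn.sum _ fun i _ => bddOn_tanSq hUo (exists_lagCurl h i) hJ0 (fun _ _ _ => rfl) hρc _

/-! ### The initial vorticity -/

/-- Functions that agree on the initial slab have the same spatial derivatives there. -/
theorem sdL_congr_initial {F G : ℝ × Pt → ℝ} (hF : ContDiff ℝ ∞ F) (hG : ContDiff ℝ ∞ G)
    (hFG : ∀ y ∈ slab, F (0, y) = G (0, y)) {L : List (Option (Fin 3))} (hL : L.count none = 0)
    {x : Pt} (hx : x ∈ slab) : sdL L F (0, x) = sdL L G (0, x) := by
  have hp := perm_canonical L
  rw [hL, List.replicate_zero, List.append_nil] at hp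
  rw [sdL_perm hF hp, sdL_perm hG hp]
  have hU : IsOpen ((univ : Set ℝ) ×ˢ slab) := isOpen_univ.prod isOpen_slab
  rw [← mpd_eq_sdL hU hF.contDiffOn (t := 0) (g := fun y => F (0, y)) (fun _ _ => rfl) _ x
    ⟨mem_univ _, hx⟩]
  exact mpd_eq_sdL hU hG.contDiffOn (t := 0) (g := fun y => F (0, y)) (fun y hy => hFG y hy.2) _ x
    ⟨mem_univ _, hx⟩

/-- The components of the curl of the velocity as space-time functions. -/
def curlVel (η : ℝ → Pt → Pt) (i : Fin 3) : ℝ × Pt → ℝ :=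
  ∑ j, ∑ k, eps i j k • sd (some j) (sd none (comp η k))

theorem curlVel_contDiff (h : ContDiff ℝ ∞ fun p : ℝ × Pt => η p.1 p.2) (i : Fin 3) :
    ContDiff ℝ ∞ (curlVel η i) :=
  contDiff_finset_sum fun _ => contDiff_finset_sum fun k =>
    contDiff_const.smul (sd_contDiff (sd_contDiff (comp_contDiff h k) _) _)

theorem lagCurl_initial (hs : IsSmoothSolution ρ₀ T u₀ η) {x : Pt} (hx : x ∈ slab) (i : Fin 3) :
    lagCurl η 0 (vel η 0) x i = curlVel η i (0, x) := by
  have h := hs.smooth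
  have hM : defTensor η 0 x = 1 := by
    ext a b
    rw [defTensor_eq h, gr_initial hs hx, Matrix.one_apply]
  have hpd : ∀ s k, pd s (fun y => vel η 0 y k) x = sd (some s) (sd none (comp η k)) (0, x) :=
    fun s k => pd_eq_sd isOpen_univ (sd_contDiff (comp_contDiff h k) none).contDiffOn
      (fun y _ => vel_eq_sd h 0 y k) s x (mem_univ _)
  simp only [lagCurl, invDef, hM, inv_one, hpd, curlVel, Finset.sum_apply, Pi.smul_apply,
    smul_eq_mul]
  refine Finset.sum_congr rfl fun j _ => Finset.sum_congr rfl fun k _ => ?_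
  rw [Finset.sum_eq_single j]
  · simp
  · intro s _ hsj; simp [Matrix.one_apply_ne hsj]
  · simp

/-- At t = 0 the deformation is the identity, and the antisymmetric part of Dv is dual to the curl.
-/
theorem cauchyInv_initial (hs : IsSmoothSolution ρ₀ T u₀ η) {x : Pt} (hx : x ∈ slab) (k l : Fin 3) :
    cauchyInv η k l (0, x) = (∑ i, (-eps i k l) • curlVel η i) (0, x) := by
  have h := hs.smooth
  have hcomm : ∀ i l, sd none (gr η i l) = sd (some l) (sd none (comp η i)) := fun i l =>
    sd_comm (comp_contDiff h i) _ _
  simp only [cauchyInv, Finset.sum_apply, Pi.sub_apply, Pi.mul_apply, gr_initial hs hx, hcomm,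
    curlVel, Pi.smul_apply, smul_eq_mul, Fin.sum_univ_three]
  fin_cases k <;> fin_cases l <;> simp [eps] <;> ring

theorem setIntegral_sum_three_sq_le {w : Pt → ℝ} {c : Fin 3 → ℝ} {f : Fin 3 → Pt → ℝ} {B : ℝ}
    (hw : Continuous w) (hf : ∀ i, Continuous (f i)) (hc : ∀ i, c i ^ 2 ≤ 1)
    (hB : ∀ i, ∫ x in cell, (w x * f i x) ^ 2 ≤ B) :
    ∫ x in cell, (w x * ∑ i, c i * f i x) ^ 2 ≤ 9 * B := by
  have h₁ : ∫ x in cell, (w x * ∑ i, c i * f i x) ^ 2 ≤ ∫ x in cell, 3 * ∑ i, (w x * f i x) ^ 2 := by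
    refine setIntegral_cell_mono (by fun_prop) (by fun_prop) fun x _ => ?_
    have h₂ : ∀ i, (w x * f i x * c i) ^ 2 ≤ (w x * f i x) ^ 2 := fun i => by
      rw [mul_pow]; nlinarith [sq_nonneg (w x * f i x), hc i]
    simp only [Fin.sum_univ_three]
    nlinarith [h₂ 0, h₂ 1, h₂ 2, sq_nonneg (w x * f 0 x * c 0 - w x * f 1 x * c 1),
      sq_nonneg (w x * f 0 x * c 0 - w x * f 2 x * c 2),
      sq_nonneg (w x * f 1 x * c 1 - w x * f 2 x * c 2)]
  refine h₁.trans ?_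
  rw [integral_const_mul, integral_finsetSum _ fun i _ => integrableOn_cell (by
    have := hf i; fun_prop)]
  have : ∑ i, ∫ x in cell, (w x * f i x) ^ 2 ≤ ∑ _i : Fin 3, B := Finset.sum_le_sum fun i _ => hB i
  simp at this
  linarith

theorem eps_sq_le (i k l : Fin 3) : (-eps i k l) ^ 2 ≤ 1 := by
  fin_cases i <;> fin_cases k <;> fin_cases l <;> norm_num [eps]

/-- The invariant at t = 0 is a combination of components of the Lagrangian curl, whose H³ norm and
weighted horizontal norm belong to E(0). The identification holds only on the initial slice, so no
time derivative is allowed in the word. -/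
theorem integral_cauchyInv_initial_le (hρ : IsInitialDensity ρ₀) (hs : IsSmoothSolution ρ₀ T u₀ η)
    (k l : Fin 3) {L : List (Option (Fin 3))} (hL : L.count none = 0) :
    (ord L ≤ 6 → ∫ x in cell, sdL L (cauchyInv η k l) (0, x) ^ 2 ≤ 9 * energy ρ₀ η 0) ∧
    (ord L = 8 → IsHor L →
      ∫ x in cell, (ρ₀ x * sdL L (cauchyInv η k l) (0, x)) ^ 2 ≤ 9 * energy ρ₀ η 0) := by
  have h := hs.smooth
  have hcc := curlVel_contDiff h
  have hU : IsOpen ((univ : Set ℝ) ×ˢ slab) := isOpen_univ.prod isOpen_slab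
  have hcell : ∀ y ∈ cell, ((0 : ℝ), y) ∈ (univ : Set ℝ) ×ˢ slab := fun y hy =>
    ⟨mem_univ _, cell_subset_slab hy⟩
  have hlag : ∀ i, ∀ y, ((0 : ℝ), y) ∈ (univ : Set ℝ) ×ˢ slab →
      lagCurl η 0 (vel η 0) y i = curlVel η i (0, y) := fun i y hy => lagCurl_initial hs hy.2 i
  have hsl : ∀ i, Continuous fun x => sdL L (curlVel η i) (0, x) := fun i =>
    (sdL_contDiff (hcc i) L).continuous.comp (Continuous.prodMk_right 0)
  have he : ∀ x ∈ cell, sdL L (cauchyInv η k l) (0, x)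
      = ∑ i, -eps i k l * sdL L (curlVel η i) (0, x) := by
    intro x hx
    have hG : ∀ i, ContDiff ℝ ∞ ((-eps i k l) • curlVel η i) := fun i =>
      contDiff_const.smul (hcc i)
    rw [sdL_congr_initial (cauchyInv_contDiff h k l) (contDiff_finset_sum hG)
      (fun y hy => cauchyInv_initial hs hy k l) hL (cell_subset_slab hx), sdL_sum _ hG,
      Finset.sum_apply]
    refine Finset.sum_congr rfl fun i _ => ?_
    rw [sdL_smul (hcc i), Pi.smul_apply, smul_eq_mul]
  have hp := perm_canonical L
  rw [hL, List.replicate_zero, List.append_nil] at hp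
  constructor
  · intro hord
    have h₁ := setIntegral_sum_three_sq_le (w := fun _ => 1) (c := fun i => -eps i k l)
      (B := energy ρ₀ η 0) continuous_const hsl (fun i => eps_sq_le i k l) fun i => by
        have h₂ := le_sobSq hU (hcc i).contDiffOn hcell (hlag i) 3 (mcount L) (by
          rw [ord_eq_sum_mcount] at hord; omega)
        rw [← sdL_perm (hcc i) hp] at h₂
        simp only [one_mul]
        exact h₂.trans ((sobSq_le_sobSqV 3 (lagCurl η 0 (vel η 0)) i).trans
          (energy_parts ρ₀ η 0).2.2.2.1)
    refine le_trans (le_of_eq ?_) h₁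
    exact setIntegral_congr_fun measurableSet_cell fun x hx => by simp only [he x hx, one_mul]
  · intro hord hH
    have h₁ := setIntegral_sum_three_sq_le (w := ρ₀) (c := fun i => -eps i k l)
      (B := energy ρ₀ η 0) hρ.smooth.continuous hsl (fun i => eps_sq_le i k l) fun i => by
        obtain ⟨m, hm⟩ := hH.perm_canonical
        rw [hL, List.replicate_zero, List.append_nil] at hm
        have hlen : m.length = 4 := by
          have := ord_perm hm
          rw [ord_hlist] at this
          omega
        have h₂ := le_tanSq hU (hcc i).contDiffOn hcell (hlag i) ρ₀ 4 m hlen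
        rw [← sdL_perm (hcc i) hm] at h₂
        exact h₂.trans ((tanSq_le_tanSqV ρ₀ 4 (lagCurl η 0 (vel η 0)) i).trans
          (energy_parts ρ₀ η 0).2.2.2.2.1)
    refine le_trans (le_of_eq ?_) h₁
    exact setIntegral_congr_fun measurableSet_cell fun x hx => by simp only [he x hx]

end Solution

/-! ### A weighted elliptic estimate -/

theorem update_hor_mem_closedSlab {x : Pt} (hx : x ∈ Icc (0 : Pt) 1) (α : Fin 2) (s : ℝ) :
    Function.update x (hor α) s ∈ closedSlab := by
  have : (2 : Fin 3) ≠ hor α := by fin_cases α <;> simp [hor]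
  simp only [closedSlab, mem_ofPred_eq, Function.update_of_ne this]
  exact ⟨hx.1 2, hx.2 2⟩

theorem update_add_unitVec (x : Pt) (k : Fin 3) :
    Function.update x k 0 + unitVec k = Function.update x k 1 := by
  ext i
  by_cases h : i = k
  · subst h; simp [unitVec]
  · simp [unitVec, h]

theorem pd_mul {f g : Pt → ℝ} (hf : ContDiff ℝ ∞ f) (hg : ContDiff ℝ ∞ g) (k : Fin 3) (x : Pt) :
    pd k (fun y => f y * g y) x = pd k f x * g x + f x * pd k g x := by
  rw [pd, fderiv_fun_mul (contDiff_differentiable hf x) (contDiff_differentiable hg x)]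
  simp [pd]; ring

theorem contDiff_coord (i : Fin 3) : ContDiff ℝ ∞ fun x : Pt => x i := contDiff_apply ℝ ℝ i

theorem pd_coord (k i : Fin 3) (x : Pt) : pd k (fun y => y i) x = if k = i then 1 else 0 := by
  have : HasFDerivAt (fun y : Pt => y i) (ContinuousLinearMap.proj (R := ℝ) (φ := fun _ : Fin 3 => ℝ) i) x :=
    (ContinuousLinearMap.proj (R := ℝ) (φ := fun _ : Fin 3 => ℝ) i).hasFDerivAt
  rw [pd, this.fderiv]
  simp [unitVec, Pi.single_apply, eq_comm]

theorem abs_mul_mul_eq (u h w : ℝ) : |u * h * w| = |u| * (|h| * |w|) := by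
  rw [abs_mul, abs_mul, mul_assoc]

theorem neg_mul_le_of_abs_le {u U h w : ℝ} (hu : |u| ≤ U) : -(u * h * w) ≤ U * (|h| * |w|) :=
  (neg_le_abs _).trans ((abs_mul_mul_eq u h w).le.trans
    (mul_le_mul_of_nonneg_right hu (by positivity)))

theorem abs_mul_le_of_le_one {x u U : ℝ} (hx : |x| ≤ 1) (hu : |u| ≤ U) : |x * u| ≤ U := by
  rw [abs_mul]
  exact (mul_le_of_le_one_left (abs_nonneg _) hx).trans hu

/-- The pointwise bound behind the weighted part of the elliptic estimate. -/
theorem elliptic_weighted {x ρ h M R g' I₁ : ℝ} {w g cc ρ' h' : Fin 3 → ℝ}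
    (hx : |x| ≤ 1) (hR : 0 ≤ R) (hρR : |ρ| ≤ R)
    (hρ' : ∀ k, |ρ' k| ≤ R) (hcc : ∀ k, |cc k| ≤ M) (hg : ∀ k, ρ * h' k = cc k * h + g k)
    (hI₁ : I₁ = ρ * h * w 2 + ∑ k, (x * ρ' k * h * w k + x * (ρ * h' k) * w k) + x * h * (h - g')) :
    x * h ^ 2 ≤ I₁ + |h| * ((2 * R + M) * (|w 0| + |w 1| + |w 2|) + |g'|)
      + ∑ k, |g k| * |w k| := by
  have e₁ := neg_mul_le_of_abs_le (h := h) (w := w 2) hρR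
  have e₂ : ∀ k, -(x * ρ' k * h * w k) ≤ R * (|h| * |w k|) := fun k =>
    neg_mul_le_of_abs_le (abs_mul_le_of_le_one hx (hρ' k))
  have e₃ : ∀ k, -(x * cc k * h * w k) ≤ M * (|h| * |w k|) := fun k =>
    neg_mul_le_of_abs_le (abs_mul_le_of_le_one hx (hcc k))
  have e₄ : ∀ k, -(x * g k * w k) ≤ 1 * (|g k| * |w k|) := fun k => neg_mul_le_of_abs_le hx
  have e₅ : -(-x * h * g') ≤ 1 * (|h| * |g'|) := neg_mul_le_of_abs_le (by rwa [abs_neg])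
  have p0 : 0 ≤ R * (|h| * |w 0|) := by positivity
  have p1 : 0 ≤ R * (|h| * |w 1|) := by positivity
  simp only [Fin.sum_univ_three, hg] at hI₁ ⊢
  rw [hI₁]
  linarith [e₂ 0, e₂ 1, e₂ 2, e₃ 0, e₃ 1, e₃ 2, e₄ 0, e₄ 1, e₄ 2]

/-- The pointwise bound behind the elliptic estimate away from the vanishing density. -/
theorem elliptic_bottom {x ρ h c M I₂ g cc h' : ℝ} (hx0 : 0 ≤ x) (hx1 : x ≤ 1) (hc : 0 < c)
    (hρc : c * (1 - x) ≤ ρ) (hcc : |cc| ≤ M) (hg : ρ * h' = cc * h + g)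
    (hI₂ : I₂ = ((1 - x) ^ 2 - 2 * x * (1 - x)) * h ^ 2 + x * (1 - x) ^ 2 * (2 * h * h')) :
    h ^ 2 ≤ I₂ + (4 + 2 * M / c) * (x * h ^ 2) + 2 / c * (|h| * |g|) := by
  have hM : 0 ≤ M := (abs_nonneg _).trans hcc
  have h1x : 0 ≤ 1 - x := by linarith
  have hρ0 : 0 ≤ ρ := le_trans (by positivity) hρc
  have e₁ : (1 - x) * |h'| ≤ (M * |h| + |g|) / c := by
    rw [le_div_iff₀ hc]
    calc (1 - x) * |h'| * c = c * (1 - x) * |h'| := by ring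
      _ ≤ ρ * |h'| := mul_le_mul_of_nonneg_right hρc (abs_nonneg _)
      _ = |ρ * h'| := by rw [abs_mul, abs_of_nonneg hρ0]
      _ = |cc * h + g| := by rw [hg]
      _ ≤ |cc| * |h| + |g| := (abs_add_le _ _).trans (by rw [abs_mul])
      _ ≤ _ := by have := mul_le_mul_of_nonneg_right hcc (abs_nonneg h); linarith
  have e₃ : -(h * h') ≤ |h| * |h'| := by rw [← abs_mul]; exact neg_le_abs _
  have e₄ : x * (1 - x) ^ 2 * (2 * -(h * h')) ≤ x * (1 - x) ^ 2 * (2 * (|h| * |h'|)) := by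
    gcongr
  have e₅ : x * (1 - x) ^ 2 * (2 * (|h| * |h'|)) = 2 * x * (1 - x) * (|h| * ((1 - x) * |h'|)) := by
    ring
  have e₆ : 2 * x * (1 - x) * (|h| * ((1 - x) * |h'|)) ≤
      2 * x * 1 * (|h| * ((M * |h| + |g|) / c)) := by
    gcongr
    linarith
  have e₇ : 2 * x * 1 * (|h| * ((M * |h| + |g|) / c)) ≤
      2 * M / c * (x * h ^ 2) + 2 / c * (|h| * |g|) := by
    have : 2 * x * 1 * (|h| * ((M * |h| + |g|) / c))
        = 2 * M / c * (x * |h| ^ 2) + x * (2 / c * (|h| * |g|)) := by ring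
    rw [this, sq_abs]
    have h0 : 0 ≤ 2 / c * (|h| * |g|) := by positivity
    have := mul_le_of_le_one_left h0 hx1
    linarith
  have e₈ : h ^ 2 ≤ ((1 - x) ^ 2 - 2 * x * (1 - x)) * h ^ 2 + 4 * (x * h ^ 2) := by
    have : ((1 - x) ^ 2 - 2 * x * (1 - x)) * h ^ 2 + 4 * (x * h ^ 2)
        = h ^ 2 + 3 * x ^ 2 * h ^ 2 := by ring
    rw [this]
    have : 0 ≤ 3 * x ^ 2 * h ^ 2 := by positivity
    linarith
  rw [hI₂]
  linarith

theorem sq_sum_five_le (a b c d e : ℝ) :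
    (a + b + c + d + e) ^ 2 ≤ 5 * (a ^ 2 + b ^ 2 + c ^ 2 + d ^ 2 + e ^ 2) := by
  linarith [sq_nonneg (a - b), sq_nonneg (a - c), sq_nonneg (a - d), sq_nonneg (a - e),
    sq_nonneg (b - c), sq_nonneg (b - d), sq_nonneg (b - e), sq_nonneg (c - d),
    sq_nonneg (c - e), sq_nonneg (d - e)]

/-- `elliptic_bottom` bounds h² up to a multiple κ of x h², which `elliptic_weighted` supplies. In
the sum, h occurs linearly against the data, and Young's inequality absorbs half of h²; this
produces the factors 2 in front of I₁ and I₂, which are divergences with zero integral. -/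
theorem elliptic_pointwise {x ρ h c M R κ Γ g' I₁ I₂ : ℝ} {w g cc ρ' h' : Fin 3 → ℝ}
    (hx0 : 0 ≤ x) (hx1 : x ≤ 1) (hc : 0 < c) (hρc : c * (1 - x) ≤ ρ) (hρR : |ρ| ≤ R)
    (hρ' : ∀ k, |ρ' k| ≤ R) (hcc : ∀ k, |cc k| ≤ M) (hg : ∀ k, ρ * h' k = cc k * h + g k)
    (hκ : κ = 4 + 2 * M / c) (hΓ : Γ = κ * (2 * R + M + 1) + 2 / c)
    (hI₁ : I₁ = ρ * h * w 2 + ∑ k, (x * ρ' k * h * w k + x * (ρ * h' k) * w k) + x * h * (h - g'))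
    (hI₂ : I₂ = ((1 - x) ^ 2 - 2 * x * (1 - x)) * h ^ 2 + x * (1 - x) ^ 2 * (2 * h * h' 2)) :
    h ^ 2 ≤ 2 * I₂ + 2 * κ * I₁ + (10 * Γ ^ 2 + κ) * ((∑ k, w k ^ 2) + (∑ k, g k ^ 2) + g' ^ 2) := by
  have hM : 0 ≤ M := (abs_nonneg _).trans (hcc 0)
  have hR : 0 ≤ R := (abs_nonneg _).trans hρR
  have hκ0 : 0 ≤ κ := by rw [hκ]; positivity
  have h2c : 0 ≤ 2 / c := by positivity
  have hY := elliptic_weighted (by rwa [abs_of_nonneg hx0]) hR hρR hρ' hcc hg hI₁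
  have hB := elliptic_bottom hx0 hx1 hc hρc (hcc 2) (hg 2) hI₂
  rw [← hκ] at hB
  set S : ℝ := (2 * R + M) * (|w 0| + |w 1| + |w 2|) + |g'| with hS
  set W : ℝ := (∑ k, w k ^ 2) + (∑ k, g k ^ 2) + g' ^ 2 with hW
  set Q : ℝ := κ * S + 2 / c * |g 2| with hQ
  have hq0 : 0 ≤ 2 * R + M := by positivity
  have hΓ0 : 0 ≤ Γ := by rw [hΓ]; positivity
  have hS0 : 0 ≤ S := by rw [hS]; positivity
  have hκq : κ * (2 * R + M) ≤ Γ := by rw [hΓ]; linarith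
  have hκΓ : κ ≤ Γ := by
    have : 0 ≤ κ * (2 * R + M) := by positivity
    rw [hΓ]; linarith
  have hcΓ : 2 / c ≤ Γ := by
    have : 0 ≤ κ * (2 * R + M + 1) := by positivity
    rw [hΓ]; linarith
  have hQ0 : Q ≤ Γ * (|w 0| + |w 1| + |w 2| + |g'| + |g 2|) := by
    calc Q = κ * (2 * R + M) * (|w 0| + |w 1| + |w 2|) + κ * |g'| + 2 / c * |g 2| := by
          rw [hQ, hS]; ring
      _ ≤ Γ * (|w 0| + |w 1| + |w 2|) + Γ * |g'| + Γ * |g 2| := by gcongr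
      _ = _ := by ring
  have hsum : (|w 0| + |w 1| + |w 2| + |g'| + |g 2|) ^ 2 ≤ 5 * W := by
    refine (sq_sum_five_le _ _ _ _ _).trans ?_
    simp only [hW, Fin.sum_univ_three, sq_abs]
    linarith [sq_nonneg (g 0), sq_nonneg (g 1)]
  have hP : Q ^ 2 ≤ 5 * (Γ ^ 2 * W) := by
    calc Q ^ 2 ≤ (Γ * (|w 0| + |w 1| + |w 2| + |g'| + |g 2|)) ^ 2 :=
          pow_le_pow_left₀ (by rw [hQ]; positivity) hQ0 2
      _ = Γ ^ 2 * (|w 0| + |w 1| + |w 2| + |g'| + |g 2|) ^ 2 := by ring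
      _ ≤ Γ ^ 2 * (5 * W) := mul_le_mul_of_nonneg_left hsum (sq_nonneg _)
      _ = _ := by ring
  have hgw : ∑ k, |g k| * |w k| ≤ 1 / 2 * W := by
    have e : ∀ k, |g k| * |w k| ≤ 1 / 2 * (w k ^ 2 + g k ^ 2) := fun k => by
      rw [← sq_abs (w k), ← sq_abs (g k)]
      linarith [sq_nonneg (|w k| - |g k|)]
    calc ∑ k, |g k| * |w k| ≤ ∑ k, 1 / 2 * (w k ^ 2 + g k ^ 2) := Finset.sum_le_sum fun k _ => e k
      _ = 1 / 2 * ((∑ k, w k ^ 2) + ∑ k, g k ^ 2) := by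
          rw [← Finset.mul_sum, Finset.sum_add_distrib]
      _ ≤ _ := by rw [hW]; linarith [sq_nonneg g']
  have hY' := mul_le_mul_of_nonneg_left hY hκ0
  have hgw' := mul_le_mul_of_nonneg_left hgw hκ0
  have hyoung : |h| * Q ≤ 1 / 2 * h ^ 2 + 1 / 2 * Q ^ 2 := by
    rw [← sq_abs h]; linarith [sq_nonneg (|h| - Q)]
  have hsplit : |h| * Q = κ * (|h| * S) + 2 / c * (|h| * |g 2|) := by rw [hQ]; ring
  have hW0 : 0 ≤ Γ ^ 2 * W := by positivity
  linarith

/-- The constant in the weighted elliptic estimate. -/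
def ellConst (c R M : ℝ) : ℝ :=
  10 * ((4 + 2 * M / c) * (2 * R + M + 1) + 2 / c) ^ 2 + (4 + 2 * M / c)

/-- Two integrations by parts. Testing h = ρ₀ div w + g' with x₃h moves the divergence off w, and
ρ₀∇h = cc h + g removes the derivative of h, giving ∫ x₃h². The part near x₃ = 0 is recovered from
the vertical derivative of a weighted h², where ρ₀ ≥ c(1 - x₃) again removes ∂₃h. -/
theorem elliptic_estimate {ρ₀ : Pt → ℝ} (hρ : IsInitialDensity ρ₀) {c R M : ℝ} (hc : 0 < c)
    (hρc : ∀ x ∈ closedSlab, c * (1 - x 2) ≤ ρ₀ x) (hρR : ∀ x ∈ cell, |ρ₀ x| ≤ R)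
    (hρ' : ∀ k, ∀ x ∈ cell, |pd k ρ₀ x| ≤ R) {h g' : Pt → ℝ} {w g cc : Fin 3 → Pt → ℝ}
    (hh : ContDiff ℝ ∞ h) (hw : ∀ k, ContDiff ℝ ∞ (w k)) (hgc : ∀ k, Continuous (g k))
    (hgc' : Continuous g')
    (hhper : ∀ x ∈ closedSlab, ∀ α : Fin 2, h (x + unitVec (hor α)) = h x)
    (hwper : ∀ k, ∀ x ∈ closedSlab, ∀ α : Fin 2, w k (x + unitVec (hor α)) = w k x)
    (hcc : ∀ k, ∀ x ∈ cell, |cc k x| ≤ M)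
    (hg : ∀ k, ∀ x ∈ cell, ρ₀ x * pd k h x = cc k x * h x + g k x)
    (hg' : ∀ x ∈ cell, h x = ρ₀ x * (∑ k, pd k (w k) x) + g' x) :
    ∫ x in cell, h x ^ 2 ≤ ellConst c R M * ((∑ k, ∫ x in cell, w k x ^ 2)
      + (∑ k, ∫ x in cell, g k x ^ 2) + ∫ x in cell, g' x ^ 2) := by
  have hρs := hρ.smooth
  have hX : ContDiff ℝ ∞ fun x : Pt => x 2 := contDiff_coord 2
  -- The factor ρ₀ kills the flux through x₃ = 1 and the factor x₃ kills the flux through x₃ = 0,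
  -- where no boundary condition is available. Horizontal fluxes cancel by periodicity.
  set Fk : Fin 3 → Pt → ℝ := fun k x => (x 2 * ρ₀ x) * (h x * w k x) with hFk
  have hFs : ∀ k, ContDiff ℝ ∞ (Fk k) := fun k => (hX.mul hρs).mul (hh.mul (hw k))
  set G : Pt → ℝ := fun x => (x 2 * (1 - x 2) ^ 2) * h x ^ 2 with hG
  have hGs : ContDiff ℝ ∞ G := (hX.mul ((contDiff_const.sub hX).pow 2)).mul (hh.pow 2)
  have hzero : ∀ (F : Pt → ℝ), ContDiff ℝ ∞ F → (∀ x, x 2 = 0 → F x = 0) → (∀ x, x 2 = 1 → F x = 0) →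
      ∫ x in cell, pd 2 F x = 0 := fun F hF h0 h1 =>
    integral_pd_eq_zero hF 2 fun x _ => by rw [h1 _ (by simp), h0 _ (by simp)]
  have hF0 : ∀ k, ∫ x in cell, pd k (Fk k) x = 0 := by
    have hhor : ∀ α : Fin 2, ∫ x in cell, pd (hor α) (Fk (hor α)) x = 0 := by
      intro α
      refine integral_pd_eq_zero (hFs _) _ fun x hx => ?_
      have hm := update_hor_mem_closedSlab hx α 0
      have h2 : (2 : Fin 3) ≠ hor α := by fin_cases α <;> simp [hor]
      simp only [hFk, ← update_add_unitVec, hhper _ hm α, hwper _ _ hm α, hρ.periodic _ hm α]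
      simp [unitVec, h2]
    intro k
    fin_cases k
    · exact hhor 0
    · exact hhor 1
    · refine hzero _ (hFs 2) (fun x hx => ?_) fun x hx => ?_
      · simp [hFk, hx]
      · simp [hFk, hρ.vanishes x hx]
  have hG0 : ∫ x in cell, pd 2 G x = 0 :=
    hzero G hGs (fun x hx => by simp [hG, hx]) fun x hx => by simp [hG, hx]
  set κ : ℝ := 4 + 2 * M / c with hκ
  have hpt : ∀ x ∈ cell, h x ^ 2 ≤ 2 * pd 2 G x + 2 * κ * (∑ k, pd k (Fk k) x)
      + ellConst c R M * ((∑ k, w k x ^ 2) + (∑ k, g k x ^ 2) + g' x ^ 2) := by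
    intro x hx
    refine elliptic_pointwise (x := x 2) (ρ := ρ₀ x) (ρ' := fun k => pd k ρ₀ x)
      (h' := fun k => pd k h x) (cc := fun k => cc k x) (w := fun k => w k x) (g := fun k => g k x)
      (hx 2).1.le (hx 2).2.le hc
      (hρc x (slab_subset_closedSlab (cell_subset_slab hx))) (hρR x hx) (fun k => hρ' k x hx)
      (fun k => hcc k x hx) (fun k => hg k x hx) hκ rfl ?_ ?_
    · have e : ∀ k, pd k (Fk k) x = (if k = 2 then 1 else 0) * ρ₀ x * h x * w k x
          + (x 2 * pd k ρ₀ x * h x * w k x + x 2 * (ρ₀ x * pd k h x) * w k x)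
          + x 2 * h x * (ρ₀ x * pd k (w k) x) := by
        intro k
        rw [hFk, pd_mul (hX.mul hρs) (hh.mul (hw k)), pd_mul hX hρs, pd_mul hh (hw k), pd_coord]
        ring
      have e' : h x - g' x = ρ₀ x * (∑ k, pd k (w k) x) := by rw [hg' x hx]; ring
      simp only [e, e', Fin.sum_univ_three]
      simp
      ring
    · have hA : ContDiff ℝ ∞ fun x : Pt => (1 - x 2) ^ 2 := (contDiff_const.sub hX).pow 2
      have e₁ : pd 2 (fun x : Pt => (1 - x 2) ^ 2) x = -2 * (1 - x 2) := by
        rw [pd_pow (contDiff_const.sub hX)]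
        have : pd 2 (fun y : Pt => 1 - y 2) x = -1 := by
          have := pd_coord 2 2 x
          rw [pd] at this ⊢
          rw [fderiv_const_sub]
          simpa using this
        rw [this]; simp
      rw [hG, pd_mul (hX.mul hA) (hh.pow 2), pd_mul hX hA, pd_coord, e₁, pd_pow hh]
      simp only [if_true, Nat.cast_ofNat, Nat.add_one_sub_one, pow_one]
      ring
  have hhc := hh.continuous
  have hwc : ∀ k, Continuous (w k) := fun k => (hw k).continuous
  have hFc : ∀ k, Continuous (pd k (Fk k)) := fun k => (pd_contDiff (hFs k) k).continuous
  have hGc : Continuous (pd 2 G) := (pd_contDiff hGs 2).continuous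
  have hint := setIntegral_cell_mono (by fun_prop) (by fun_prop) hpt
  rw [integral_add (integrableOn_cell (by fun_prop)) (integrableOn_cell (by fun_prop)),
    integral_add (integrableOn_cell (by fun_prop)) (integrableOn_cell (by fun_prop)),
    integral_const_mul, integral_const_mul, integral_const_mul,
    integral_add (integrableOn_cell (by fun_prop)) (integrableOn_cell (by fun_prop)),
    integral_add (integrableOn_cell (by fun_prop)) (integrableOn_cell (by fun_prop)),
    integral_finsetSum _ fun k _ => integrableOn_cell (hFc k),
    integral_finsetSum _ fun k _ => integrableOn_cell (by have := hwc k; fun_prop),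
    integral_finsetSum _ fun k _ => integrableOn_cell (by have := hgc k; fun_prop), hG0,
    Finset.sum_eq_zero fun k _ => hF0 k] at hint
  linarith

/-! ### Families of solutions -/

/-- A solution on a time interval of length at most one, with the bounds of the curl estimate. -/
structure Flow (ρ₀ : Pt → ℝ) where
  size : ℝ
  T : ℝ
  u₀ : Pt → Pt
  η : ℝ → Pt → Pt
  T_pos : 0 < T
  T_le : T ≤ 1
  sol : IsSmoothSolution ρ₀ T u₀ η
  jac_bounds : ∀ t ∈ Icc 0 T, ∀ x ∈ slab, 1 / 2 ≤ jac η t x ∧ jac η t x ≤ 3 / 2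
  size_le : initialSize η ≤ size

variable {ρ₀ : Pt → ℝ}

/-- The quantity in which all bounds are polynomial. -/
def Flow.lam (f : Flow ρ₀) : ℝ := 1 + |f.size| + sSup (energy ρ₀ f.η '' Icc 0 f.T)

theorem Flow.sSup_energy_nonneg (f : Flow ρ₀) : 0 ≤ sSup (energy ρ₀ f.η '' Icc 0 f.T) :=
  Real.sSup_nonneg (by rintro _ ⟨t, _, rfl⟩; exact energy_nonneg _ _ _)

theorem Flow.one_le_lam (f : Flow ρ₀) : 1 ≤ f.lam := by
  have := f.sSup_energy_nonneg
  have := abs_nonneg f.size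
  rw [Flow.lam]; linarith

theorem Flow.energy_le_lam (hρ : IsInitialDensity ρ₀) (f : Flow ρ₀) {t : ℝ} (ht : t ∈ Icc 0 f.T) :
    energy ρ₀ f.η t ≤ f.lam := by
  have := le_csSup (bddAbove_energy hρ f.sol f.jac_bounds) (mem_image_of_mem _ ht)
  have := abs_nonneg f.size
  rw [Flow.lam]; linarith

theorem Flow.initialSize_le_lam (f : Flow ρ₀) : initialSize f.η ≤ f.lam := by
  have := f.sSup_energy_nonneg
  have := le_abs_self f.size
  have := f.size_le
  rw [Flow.lam]; linarith

theorem Flow.zero_mem (f : Flow ρ₀) : (0 : ℝ) ∈ Icc 0 f.T := ⟨le_rfl, f.T_pos.le⟩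

/-- A weighted `L²` bound from the initial value and the time derivative. -/
theorem integral_sq_le_of_initial {F : ℝ × Pt → ℝ} (hF : ContDiff ℝ ∞ F) {w : Pt → ℝ}
    (hw : Continuous w) {t A B : ℝ} (ht : t ∈ Icc (0 : ℝ) 1)
    (hA : ∫ x in cell, (w x * F (0, x)) ^ 2 ≤ A)
    (hB : ∀ s ∈ Icc 0 t, ∫ x in cell, (w x * sd none F (s, x)) ^ 2 ≤ B) :
    ∫ x in cell, (w x * F (t, x)) ^ 2 ≤ 2 * A + 2 * B := by
  have h₁ := integral_time_increment_le hF hw ht.1 hB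
  have hB0 : 0 ≤ B := (setIntegral_sq_nonneg _ _).trans (hB 0 ⟨le_rfl, ht.1⟩)
  have ht2 : t ^ 2 * B ≤ B := mul_le_of_le_one_left hB0 (pow_le_one₀ ht.1 ht.2)
  have hc : ∀ s, Continuous fun x => F (s, x) := fun s =>
    hF.continuous.comp (Continuous.prodMk_right s)
  have := hc t; have := hc 0
  have h₂ : ∫ x in cell, (w x * F (t, x)) ^ 2 ≤
      ∫ x in cell, (2 * (w x * F (0, x)) ^ 2 + 2 * (w x * (F (t, x) - F (0, x))) ^ 2) :=
    setIntegral_cell_mono (by fun_prop) (by fun_prop) fun x _ => by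
      linarith [sq_nonneg (w x * F (0, x) - w x * (F (t, x) - F (0, x)))]
  rw [integral_add (integrableOn_cell (by fun_prop)) (integrableOn_cell (by fun_prop)),
    integral_const_mul, integral_const_mul] at h₂
  linarith

theorem Flow.mem_Icc_one (f : Flow ρ₀) {t : ℝ} (ht : t ∈ Icc 0 f.T) : t ∈ Icc (0 : ℝ) 1 :=
  ⟨ht.1, ht.2.trans f.T_le⟩

/-- An odd number of time derivatives forces odd order, hence order at most 7. One more time
derivative then has an even count within order 8, and integration in time from the initial value
applies. -/
theorem Flow.integral_sdL_le (hρ : IsInitialDensity ρ₀) (f : Flow ρ₀) {L : List (Option (Fin 3))}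
    (hL : ord L ≤ 8) (i : Fin 3) {t : ℝ} (ht : t ∈ Icc 0 f.T) :
    ∫ x in cell, sdL L (comp f.η i) (t, x) ^ 2 ≤ 4 * f.lam := by
  have hΛ := f.one_le_lam
  rcases Nat.even_or_odd' (L.count none) with ⟨a, ha | ha⟩
  · have := integral_even_le_energy f.sol.smooth ρ₀ ha hL i t
    linarith [f.energy_le_lam hρ ht]
  · have hL' : ord (none :: L) ≤ 8 := by
      have := ord_eq_sum_mcount L
      rw [ord_cons_none]; omega
    have h₁ := integral_sq_le_of_initial (sdL_contDiff (comp_contDiff f.sol.smooth i) L)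
      (w := fun _ => 1) continuous_const (f.mem_Icc_one ht) (A := f.lam) (B := f.lam)
      (by simpa using (integral_odd_le_initialSize f.sol.smooth ha hL i).trans f.initialSize_le_lam)
      fun s hs => by
        have := integral_even_le_energy f.sol.smooth ρ₀ (L := none :: L) (a := a + 1)
          (by rw [List.count_cons_self, ha]; ring) hL' i s
        simpa using this.trans (f.energy_le_lam hρ ⟨hs.1, hs.2.trans ht.2⟩)
    simp only [one_mul] at h₁
    linarith

section Families

variable {ι : Type*} {φ : ι → Flow ρ₀} {τ : ι → ℝ}

theorem one_le_lam (φ : ι → Flow ρ₀) (i : ι) : 1 ≤ (φ i).lam := (φ i).one_le_lam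

theorem l2Tame_comp (hρ : IsInitialDensity ρ₀) (hτ : ∀ i, τ i ∈ Icc 0 (φ i).T)
    {L : List (Option (Fin 3))} (hL : ord L ≤ 8) (a : Fin 3) :
    L2Tame (fun i => (φ i).lam) (sl τ L fun i => comp (φ i).η a) :=
  (Tame.const_mul Tame.self (by norm_num : (0 : ℝ) ≤ 4)).mono
    fun i => (φ i).integral_sdL_le hρ hL a (hτ i)

theorem reg_gr (hρ : IsInitialDensity ρ₀) (hτ : ∀ i, τ i ∈ Icc 0 (φ i).T) (a k : Fin 3) :
    Reg (fun i => (φ i).lam) τ fun i => gr (φ i).η a k where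
  smooth i := gr_contDiff (φ i).sol.smooth a k
  bound L hL := by
    have := l2Tame_comp hρ hτ (L := L ++ [some k]) (by rw [ord_append]; simp; omega) a
    refine this.congr fun i x _ => ?_
    rw [sl, sl, sdL_append]; rfl

theorem reg_acc (hρ : IsInitialDensity ρ₀) (hτ : ∀ i, τ i ∈ Icc 0 (φ i).T) (a : Fin 3) :
    Reg (fun i => (φ i).lam) τ fun i => sdL [none, none] (comp (φ i).η a) where
  smooth i := sdL_contDiff (comp_contDiff (φ i).sol.smooth a) _
  bound L hL := by
    have := l2Tame_comp hρ hτ (L := L ++ [none, none]) (by rw [ord_append]; simp; omega) a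
    refine this.congr fun i x _ => ?_
    rw [sl, sl, sdL_append]

/-! ### Derivatives of the Cauchy invariants -/

/-- The antisymmetric expression `Σ_i (η^i,_k D^L η^i,_l − η^i,_l D^L η^i,_k)`. -/
def brk (η : ℝ → Pt → Pt) (k l : Fin 3) (L : List (Option (Fin 3))) : ℝ × Pt → ℝ :=
  ∑ i, (gr η i k * sdL L (gr η i l) - gr η i l * sdL L (gr η i k))

theorem brk_contDiff {η : ℝ → Pt → Pt} (h : ContDiff ℝ ∞ fun p : ℝ × Pt => η p.1 p.2)
    (k l : Fin 3) (L) : ContDiff ℝ ∞ (brk η k l L) :=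
  contDiff_finset_sum fun i => ((gr_contDiff h i k).mul (sdL_contDiff (gr_contDiff h i l) L)).sub
    ((gr_contDiff h i l).mul (sdL_contDiff (gr_contDiff h i k) L))

theorem contDiff_mul_fun {F G : ℝ × Pt → ℝ} (hF : ContDiff ℝ ∞ F) (hG : ContDiff ℝ ∞ G) :
    ContDiff ℝ ∞ (F * G) := hF.mul hG

/-- The terms with all derivatives on v form the bracket; in every other term at least one
derivative falls on Dη. -/
theorem sdL_cauchyInv {η : ℝ → Pt → Pt} (h : ContDiff ℝ ∞ fun p : ℝ × Pt => η p.1 p.2)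
    (k l : Fin 3) (L : List (Option (Fin 3))) (p : ℝ × Pt) :
    sdL L (cauchyInv η k l) p = brk η k l (L ++ [none]) p
      + ∑ i, (leibSum (splitsL L) (gr η i k) (sd none (gr η i l)) p
        - leibSum (splitsL L) (gr η i l) (sd none (gr η i k)) p) := by
  have hg := gr_contDiff h
  have hs := fun i k => sd_contDiff (hg i k) none
  rw [cauchyInv, sdL_sum (F := fun i => gr η i k * sd none (gr η i l) - gr η i l * sd none (gr η i k))
    _ fun i => ((hg i k).mul (hs i l)).sub ((hg i l).mul (hs i k)), brk]
  simp only [Finset.sum_apply, ← Finset.sum_add_distrib, sdL_append, sdL_cons, sdL_nil]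
  refine Finset.sum_congr rfl fun i _ => ?_
  rw [sdL_sub (contDiff_mul_fun (hg i k) (hs i l)) (contDiff_mul_fun (hg i l) (hs i k)), sdL_mul_left (hg i k) (hs i l),
    sdL_mul_left (hg i l) (hs i k)]
  simp only [Pi.sub_apply, Pi.add_apply, Pi.mul_apply]
  ring

/-- The common core of the weighted and unweighted cases: the bracket, which has the order of the
top derivatives of v, equals a known invariant minus commutator products. -/
theorem l2Tame_brk_none {w : Pt → ℝ} (hw : Continuous w) {L : List (Option (Fin 3))}
    (hprod : ∀ a k l, ∀ b ∈ splitsL L, L2Tame (fun i => (φ i).lam) fun i x =>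
      w x * (sl τ b.1 (fun i => gr (φ i).η a k) i x
        * sl τ (b.2 ++ [none]) (fun i => gr (φ i).η a l) i x)) {k l : Fin 3}
    (hinv : L2Tame (fun i => (φ i).lam) fun i x =>
      w x * sl τ L (fun i => cauchyInv (φ i).η k l) i x) :
    L2Tame (fun i => (φ i).lam) fun i x => w x * brk (φ i).η k l (L ++ [none]) (τ i, x) := by
  have hΛ := one_le_lam φ
  have hg := fun a k (i : ι) => gr_contDiff (φ i).sol.smooth a k
  have hs := fun a k (i : ι) => sd_contDiff (hg a k i) none
  have hlei : ∀ a k l, L2Tame (fun i => (φ i).lam) fun i x =>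
      w x * leibSum (splitsL L) (gr (φ i).η a k) (sd none (gr (φ i).η a l)) (τ i, x) := fun a k l =>
    l2Tame_leibSum hΛ (hg a k) (hs a l) hw (splitsL L) fun b hb =>
      (hprod a k l b hb).congr fun i x _ => by simp only [sl, sdL_append, sdL_cons, sdL_nil]
  have hlc : ∀ a k l i, Continuous fun x =>
      w x * leibSum (splitsL L) (gr (φ i).η a k) (sd none (gr (φ i).η a l)) (τ i, x) :=
    fun a k l i => hw.mul ((leibSum_contDiff (hg a k i) (hs a l i) _).continuous.comp
      (Continuous.prodMk_right (τ i)))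
  refine (hinv.sub hΛ (L2Tame.sum hΛ Finset.univ (fun a _ => (hlei a k l).sub hΛ (hlei a l k)
    (hlc a k l) (hlc a l k)) fun a i => (hlc a k l i).sub (hlc a l k i))
    (fun i => hw.mul (sl_continuous (fun i => cauchyInv_contDiff (φ i).sol.smooth k l) L i))
    fun i => continuous_finsetSum _ fun a _ => (hlc a k l i).sub (hlc a l k i)).congr
    fun i x _ => ?_
  rw [sl, sdL_cauchyInv (φ i).sol.smooth]
  simp only [← mul_sub, ← Finset.mul_sum]
  ring

/-- Conservation leaves two cases: with a time derivative in the word the quantity is zero,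
otherwise it equals its initial value, which E(0) bounds. -/
theorem l2Tame_sdL_cauchyInv (hρ : IsInitialDensity ρ₀) (hτ : ∀ i, τ i ∈ Icc 0 (φ i).T)
    {L : List (Option (Fin 3))} (k l : Fin 3) :
    (ord L ≤ 6 → L2Tame (fun i => (φ i).lam) (sl τ L fun i => cauchyInv (φ i).η k l)) ∧
    (ord L = 8 → IsHor L → L2Tame (fun i => (φ i).lam) fun i x =>
      ρ₀ x * sl τ L (fun i => cauchyInv (φ i).η k l) i x) := by
  have hx' : ∀ {x}, x ∈ cell → x ∈ closedSlab := fun hx =>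
    slab_subset_closedSlab (cell_subset_slab hx)
  by_cases hn : none ∈ L
  · have h0 : ∀ i, ∀ x ∈ cell, sl τ L (fun i => cauchyInv (φ i).η k l) i x = 0 := fun i x hx =>
      sdL_cauchyInv_time hρ (φ i).sol (φ i).T_pos (φ i).jac_bounds k l hn (hτ i) (hx' hx)
    exact ⟨fun _ => L2Tame.zero.congr h0,
      fun _ _ => L2Tame.zero.congr fun i x hx => by rw [h0 i x hx, mul_zero]⟩
  · have h0 : ∀ i, ∀ x ∈ cell, sl τ L (fun i => cauchyInv (φ i).η k l) i x
        = sdL L (cauchyInv (φ i).η k l) (0, x) := fun i x hx =>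
      sdL_cauchyInv_eq_initial hρ (φ i).sol (φ i).T_pos (φ i).jac_bounds k l L (hτ i) (hx' hx)
    have hE : ∀ i, 9 * energy ρ₀ (φ i).η 0 ≤ 9 * (φ i).lam := fun i => by
      linarith [(φ i).energy_le_lam hρ (φ i).zero_mem]
    have hc : L.count none = 0 := List.count_eq_zero.2 hn
    have hT : Tame (fun i => (φ i).lam) fun i => 9 * (φ i).lam :=
      Tame.const_mul Tame.self (by norm_num)
    refine ⟨fun hL => L2Tame.congr (hT.mono fun i => ?_) h0, fun hL hH => L2Tame.congr
      (h := fun i x => ρ₀ x * sdL L (cauchyInv (φ i).η k l) (0, x)) (hT.mono fun i => ?_)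
      fun i x hx => by rw [h0 i x hx]⟩
    · exact ((integral_cauchyInv_initial_le hρ (φ i).sol k l hc).1 hL).trans (hE i)
    · exact ((integral_cauchyInv_initial_le hρ (φ i).sol k l hc).2 hL hH).trans (hE i)

theorem l2Tame_brk (hρ : IsInitialDensity ρ₀) (hτ : ∀ i, τ i ∈ Icc 0 (φ i).T)
    {L : List (Option (Fin 3))} (hL : ord L ≤ 6) (k l : Fin 3) :
    L2Tame (fun i => (φ i).lam) fun i x => brk (φ i).η k l (L ++ [none]) (τ i, x) := by
  have := l2Tame_brk_none (φ := φ) (τ := τ) (w := fun _ => 1) continuous_const (L := L)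
    (fun a k l b hb => by
      obtain ⟨h₁, h₂⟩ := mem_splitsL hb
      have := ord_of_mem_splits h₁
      simpa using (reg_gr hρ hτ a k).mul_l2 (one_le_lam φ) (reg_gr hρ hτ a l)
        (L := b.1) (L' := b.2 ++ [none]) (by omega) (by rw [ord_append]; simp; omega)
        (by rw [ord_append]; simp; omega)) (k := k) (l := l)
    (by simpa using (l2Tame_sdL_cauchyInv hρ hτ k l).1 hL)
  simpa using this

/-- The commutator products have orders adding up to 9, neither above 8, since the derivatives on Dη
are at least one. -/
theorem l2Tame_weighted_brk (hρ : IsInitialDensity ρ₀) (hτ : ∀ i, τ i ∈ Icc 0 (φ i).T)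
    (hW : ∀ a k, RegW (fun i => (φ i).lam) τ ρ₀ fun i => gr (φ i).η a k)
    {L : List (Option (Fin 3))} (hL : ord L = 8) (hH : IsHor L) (k l : Fin 3) :
    L2Tame (fun i => (φ i).lam) fun i x => ρ₀ x * brk (φ i).η k l (L ++ [none]) (τ i, x) :=
  l2Tame_brk_none hρ.smooth.continuous
    (fun a k l b hb => by
      obtain ⟨h₁, h₂⟩ := mem_splitsL hb
      have := ord_of_mem_splits h₁
      obtain ⟨h₃, h₄⟩ := isHor_of_mem_splits h₁ hH
      exact (hW a k).mul_l2 (one_le_lam φ) hρ.smooth (hW a l)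
        (L := b.1) (L' := b.2 ++ [none]) (by omega) (by rw [ord_append]; simp; omega)
        (by rw [ord_append]; simp; omega) h₃ (isHor_append h₄ (isHor_replicate_none 1)))
    ((l2Tame_sdL_cauchyInv hρ hτ k l).2 hL hH)

end Families

/-! ### The elliptic estimate at the initial time -/

/-- The lifted flow map is periodic only up to a constant c, which any derivative removes.
Periodicity is given only on [0,T] and over the slab, so the argument applies the vanishing lemma to
the difference instead of differentiating a global identity. -/
theorem sdL_periodic {T : ℝ} (hT : 0 < T) {F : ℝ × Pt → ℝ} (hF : ContDiff ℝ ∞ F) {e : Pt} {c : ℝ}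
    (h : ∀ t ∈ Icc 0 T, ∀ x ∈ slab, F (t, x + e) = F (t, x) + c) {L : List (Option (Fin 3))}
    (hL : L ≠ []) {t : ℝ} (ht : t ∈ Icc 0 T) {x : Pt} (hx : x ∈ closedSlab) :
    sdL L F (t, x + e) = sdL L F (t, x) := by
  have hs : ContDiff ℝ ∞ fun p : ℝ × Pt => F (p.1, p.2 + e) :=
    hF.comp (contDiff_fst.prodMk (contDiff_snd.add contDiff_const))
  have hs' : ContDiff ℝ ∞ ((fun p : ℝ × Pt => F (p.1, p.2 + e)) - F) := hs.sub hF
  have h₁ := sdL_eq_zero_of_slab hT (hs'.sub (contDiff_const (c := c)))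
    (fun t ht x hx => by
      simp [h t (Ioo_subset_Icc_self ht) x hx]) L t ht x hx
  have e₁ : (fun p : ℝ × Pt => ((fun p : ℝ × Pt => F (p.1, p.2 + e)) - F) p - c)
      = ((fun p : ℝ × Pt => F (p.1, p.2 + e)) - F) - fun _ => c := rfl
  rw [e₁, sdL_sub hs' contDiff_const, sdL_sub hs hF, sdL_const c hL, sdL_translate] at h₁
  simpa [sub_eq_zero] using h₁

theorem exists_bound_cell {g : Pt → ℝ} (hg : Continuous g) : ∃ C, ∀ x ∈ cell, |g x| ≤ C := by
  obtain ⟨C, hC⟩ := isCompact_Icc.exists_bound_of_continuousOn (s := Icc (0 : Pt) 1) hg.continuousOn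
  exact ⟨C, fun x hx => by simpa using hC x (cell_subset_Icc hx)⟩

variable {ρ₀ : Pt → ℝ}

theorem Flow.gr_periodic (f : Flow ρ₀) (a k : Fin 3) (α : Fin 2) {t : ℝ} (ht : t ∈ Icc 0 f.T)
    {x : Pt} (hx : x ∈ closedSlab) :
    gr f.η a k (t, x + unitVec (hor α)) = gr f.η a k (t, x) :=
  sdL_periodic (L := [some k]) f.T_pos (comp_contDiff f.sol.smooth a)
    (c := unitVec (hor α) a) (fun t ht x hx => by
      simp [comp, f.sol.periodic t ht x (slab_subset_closedSlab hx)]) (by simp) ht hx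

theorem Flow.sdL_comp_periodic (f : Flow ρ₀) (a : Fin 3) (α : Fin 2) {L : List (Option (Fin 3))}
    (hL : L ≠ []) {t : ℝ} (ht : t ∈ Icc 0 f.T) {x : Pt} (hx : x ∈ closedSlab) :
    sdL L (comp f.η a) (t, x + unitVec (hor α)) = sdL L (comp f.η a) (t, x) :=
  sdL_periodic f.T_pos (comp_contDiff f.sol.smooth a)
    (c := unitVec (hor α) a) (fun t ht x hx => by
      simp [comp, f.sol.periodic t ht x (slab_subset_closedSlab hx)]) hL ht hx

theorem densJac_contDiff (hρ : IsInitialDensity ρ₀) (f : Flow ρ₀) :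
    ContDiff ℝ ∞ (dens ρ₀ * jacF f.η) := (dens_contDiff hρ).mul (jacF_contDiff f.sol.smooth)

theorem Flow.sdL_densJac_periodic (hρ : IsInitialDensity ρ₀) (f : Flow ρ₀) (α : Fin 2)
    {L : List (Option (Fin 3))} (hL : L ≠ []) {t : ℝ} (ht : t ∈ Icc 0 f.T) {x : Pt}
    (hx : x ∈ closedSlab) :
    sdL L (dens ρ₀ * jacF f.η) (t, x + unitVec (hor α)) = sdL L (dens ρ₀ * jacF f.η) (t, x) :=
  sdL_periodic f.T_pos (densJac_contDiff hρ f) (c := 0) (fun t ht x hx => by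
    have hx' := slab_subset_closedSlab hx
    simp [dens, jacF, f.gr_periodic _ _ α ht hx', hρ.periodic x hx']) hL ht hx

theorem exists_perm_append_none {L : List (Option (Fin 3))} (hL : none ∈ L) :
    ∃ M, L.Perm (M ++ [none]) ∧ ord M + 1 = ord L := by
  have h := List.perm_cons_erase hL
  refine ⟨L.erase none, h.trans (List.perm_append_comm (l₁ := [none])), ?_⟩
  rw [ord_perm h, ord_cons_none]

/-- Spatial directions contribute even order. -/
theorem none_mem_of_odd {L : List (Option (Fin 3))} (hL : Odd (ord L)) : none ∈ L := by
  have := ord_eq_sum_mcount L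
  refine List.count_pos_iff.1 (Nat.pos_of_ne_zero fun h0 => ?_)
  obtain ⟨m, hm⟩ := hL
  omega

section Elliptic

variable {ι : Type*} {φ : ι → Flow ρ₀}

/-- The energy weight is √ρ₀; multiplication by the bounded function √ρ₀ turns it into ρ₀. -/
theorem l2Tame_weighted_nine (hρ : IsInitialDensity ρ₀) {τ : ι → ℝ} (hτ : ∀ i, τ i ∈ Icc 0 (φ i).T)
    {L : List (Option (Fin 3))} (hH : IsHor L) (hL : ord L = 9) (a : Fin 3) :
    L2Tame (fun i => (φ i).lam) fun i x => ρ₀ x * sl τ L (fun i => comp (φ i).η a) i x := by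
  obtain ⟨b, hb⟩ : ∃ b, L.count none = 2 * b + 1 := by
    have := ord_eq_sum_mcount L
    exact ⟨4 - ∑ i, mcount L i, by omega⟩
  have hr : Continuous fun x => Real.sqrt (ρ₀ x) := hρ.smooth.continuous.sqrt
  have hc := sl_continuous (τ := τ) (fun i => comp_contDiff (φ i).sol.smooth a) L
  have h₁ : L2Tame (fun i => (φ i).lam) fun i x =>
      Real.sqrt (ρ₀ x) * sl τ L (fun i => comp (φ i).η a) i x :=
    Tame.self.mono fun i => (integral_sqrt_le_energy (φ i).sol.smooth ρ₀ hH hb hL a (τ i)).trans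
      ((φ i).energy_le_lam hρ (hτ i))
  refine ((supTame_of_continuous hr).mul_l2 h₁ (fun _ => hr) fun i => hr.mul (hc i)).congr
    fun i x hx => ?_
  rw [← mul_assoc, Real.mul_self_sqrt (density_pos hρ (cell_subset_slab hx)).le]

theorem sl_gr_eq (L : List (Option (Fin 3))) (τ : ι → ℝ) (a k : Fin 3) (i : ι) :
    sl τ L (fun i => gr (φ i).η a k) i = pd k (sl τ L (fun i => comp (φ i).η a) i) := by
  have h := fun i => comp_contDiff (φ i).sol.smooth a
  rw [pd_sl h]
  ext x
  have : (some k :: L).Perm (L ++ [some k]) := List.perm_append_comm (l₁ := [some k])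
  rw [sl, sl, sdL_perm (h i) this, sdL_append]
  rfl

/-- The top order derivatives of the initial vorticity. -/
theorem l2Tame_curl_initial (hρ : IsInitialDensity ρ₀) {L : List (Option (Fin 3))}
    (hL : ord L = 7) (k l : Fin 3) :
    L2Tame (fun i => (φ i).lam) fun i x => sl (fun _ => 0) L (fun i => gr (φ i).η k l) i x
      - sl (fun _ => 0) L (fun i => gr (φ i).η l k) i x := by
  -- Odd order provides a time derivative. Placed innermost it leaves a word of order 6, to which
  -- the bound for the bracket applies; at t = 0 the bracket is the plain antisymmetric part.
  obtain ⟨M, hM, hM'⟩ := exists_perm_append_none (none_mem_of_odd (L := L) (by rw [hL]; decide))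
  refine (l2Tame_brk hρ (φ := φ) (fun i => (φ i).zero_mem) (L := M) (by omega) k l).congr
    fun i x hx => ?_
  have hg := gr_contDiff (φ i).sol.smooth
  rw [sl, sl, sdL_perm (hg k l) hM, sdL_perm (hg l k) hM, brk]
  simp [gr_initial (φ i).sol (cell_subset_slab hx), Finset.sum_sub_distrib, ite_mul]

variable {L : List (Option (Fin 3))}

theorem Flow.mem_Icc_zero_one : ∀ _ : ι, (0 : ℝ) ∈ Icc (0 : ℝ) 1 := fun _ => ⟨le_rfl, zero_le_one⟩

theorem jacF_initial (f : Flow ρ₀) {x : Pt} (hx : x ∈ cell) : jacF f.η (0, x) = 1 := by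
  simp [jacF, gr_initial f.sol (cell_subset_slab hx)]

theorem accel_initial (f : Flow ρ₀) {x : Pt} (hx : x ∈ cell) (l : Fin 3) :
    accel f.η l (0, x) = sdL [none, none] (comp f.η l) (0, x) := by
  simp [accel, gr_initial f.sol (cell_subset_slab hx), -sdL_cons]

/-- The divergence of the top order derivatives at the initial time. -/
def topDiv (φ : ι → Flow ρ₀) (L : List (Option (Fin 3))) (i : ι) (x : Pt) : ℝ :=
  ∑ k, sl (fun _ => 0) L (fun i => gr (φ i).η k k) i x

/-- The linearisation of the determinant at the identity is the trace. -/
theorem regTop_jacF (hρ : IsInitialDensity ρ₀) (hL : ord L = 7) :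
    RegTop (fun i => (φ i).lam) (fun _ => 0) L (fun i => jacF (φ i).η) (topDiv φ L) := by
  have hΛ := one_le_lam φ
  have G := fun a k => (reg_gr hρ (φ := φ) (fun i => (φ i).zero_mem) a k).regTop L
  have M := fun a b c d e f => ((G a b).mul hΛ hL (G c d)).mul hΛ hL (G e f)
  refine RegTop.congr ((((((M 0 0 1 1 2 2).sub hΛ (M 0 0 1 2 2 1)).sub hΛ (M 0 1 1 0 2 2)).add hΛ
    (M 0 1 1 2 2 0)).add hΛ (M 0 2 1 0 2 1)).sub hΛ (M 0 2 1 1 2 0)) fun i x hx => ?_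
  simp [gr_initial (φ i).sol (cell_subset_slab hx), topDiv, Fin.sum_univ_three]
  ring

theorem regTop_accel (hρ : IsInitialDensity ρ₀) (hL : ord L = 7) (l : Fin 3) :
    RegTop (fun i => (φ i).lam) (fun _ => 0) L (fun i => accel (φ i).η l) fun i x =>
      sl (fun _ => 0) L (fun i => sdL [none, none] (comp (φ i).η l)) i x
        + ∑ a, sdL [none, none] (comp (φ i).η a) (0, x)
          * sl (fun _ => 0) L (fun i => gr (φ i).η a l) i x := by
  have hΛ := one_le_lam φ
  have G := fun a => (reg_gr hρ (φ := φ) (fun i => (φ i).zero_mem) a l).regTop L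
  have A := fun a => (reg_acc hρ (φ := φ) (fun i => (φ i).zero_mem) a).regTop L
  refine RegTop.congr (RegTop.sum hΛ Finset.univ fun a => (G a).mul hΛ hL (A a)) fun i x hx => ?_
  simp [gr_initial (φ i).sol (cell_subset_slab hx), Finset.sum_add_distrib, -sdL_cons]

theorem eqMod_densJac (hρ : IsInitialDensity ρ₀) (hL : ord L = 7) :
    EqMod (fun i => (φ i).lam) (sl (fun _ => 0) L fun i => dens ρ₀ * jacF (φ i).η)
      fun i x => ρ₀ x * topDiv φ L i x := by
  have h := (regTop_fixed (Λ := fun i => (φ i).lam) (dens_contDiff hρ)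
    Flow.mem_Icc_zero_one L).mul (one_le_lam φ) hL (regTop_jacF hρ hL)
  exact (h.congr fun i x _ => by simp [dens]).top

/-- D^L of the momentum equation at t = 0, with J = 1 and Dη = I. The term ½J²η^i,_lη_tt^i
contributes both ½ times the top part of the acceleration and η_tt^l times the divergence; the term
2Jρ₀,_l contributes 2ρ₀,_l times the divergence. -/
theorem eqMod_pd_densJac (hρ : IsInitialDensity ρ₀) (hL : ord L = 7) (l : Fin 3) :
    EqMod (fun i => (φ i).lam)
      (fun i => pd l (sl (fun _ => 0) L (fun i => dens ρ₀ * jacF (φ i).η) i))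
      fun i x => 1 / 2 * (sl (fun _ => 0) L (fun i => sdL [none, none] (comp (φ i).η l)) i x
        + ∑ a, sdL [none, none] (comp (φ i).η a) (0, x)
          * sl (fun _ => 0) L (fun i => gr (φ i).η a l) i x)
        + (sdL [none, none] (comp (φ i).η l) (0, x) + 2 * pd l ρ₀ x) * topDiv φ L i x := by
  have hΛ := one_le_lam φ
  have hJ := regTop_jacF (φ := φ) hρ hL
  have hD := regTop_fixed (Λ := fun i => (φ i).lam) (sd_contDiff (dens_contDiff hρ) (some l))
    Flow.mem_Icc_zero_one L
  have h := (((hJ.mul hΛ hL hJ).mul hΛ hL (regTop_accel hρ hL l)).smul (1 / 2)).add hΛ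
    ((hJ.mul hΛ hL hD).smul 2)
  refine EqMod.congr h.top (fun i x hx => ?_) fun i x hx => ?_
  · have hd := densJac_contDiff hρ (φ i)
    have hJs := jacF_contDiff (φ i).sol.smooth
    have hA := accel_contDiff (φ i).sol.smooth l
    have hds := sd_contDiff (dens_contDiff hρ) (some l)
    have hsm : ContDiff ℝ ∞ ((1 / 2 : ℝ) • (jacF (φ i).η * jacF (φ i).η * accel (φ i).η l)
        + (2 : ℝ) • (jacF (φ i).η * sd (some l) (dens ρ₀))) :=
      (contDiff_const.smul ((hJs.mul hJs).mul hA)).add (contDiff_const.smul (hJs.mul hds))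
    have hz := sdL_momentumF hρ (φ i).sol (φ i).T_pos (φ i).jac_bounds l L (φ i).zero_mem
      (slab_subset_closedSlab (cell_subset_slab hx))
    rw [momentumF, sdL_sub hsm (sd_contDiff hd _), Pi.sub_apply, sub_eq_zero] at hz
    rw [pd_sl (densJac_contDiff hρ <| φ ·)]
    have hp : (some l :: L).Perm (L ++ [some l]) := List.perm_append_comm (l₁ := [some l])
    rw [sl, sdL_perm hd hp, sdL_append]
    exact hz.symm
  · simp only [Pi.mul_apply, jacF_initial _ hx, accel_initial _ hx, sd_dens hρ]
    ring

/-- Horizontal last index: the √ρ₀ part of the energy. Vertical last index and a horizontal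
component: exchange the indices by the initial curl bound. Both vertical: subtract the two
horizontal diagonal entries from the divergence, which is D^L(ρ₀J) after weighting. -/
theorem eqMod_weighted_gr (hρ : IsInitialDensity ρ₀) (hH : IsHor L) (hL : ord L = 7) (a l : Fin 3) :
    EqMod (fun i => (φ i).lam)
      (fun i x => ρ₀ x * sl (fun _ => 0) L (fun i => gr (φ i).η a l) i x)
      fun i x => (if a = 2 ∧ l = 2 then 1 else 0)
        * sl (fun _ => 0) L (fun i => dens ρ₀ * jacF (φ i).η) i x := by
  have hΛ := one_le_lam φ
  have hg := fun a k (i : ι) => gr_contDiff (φ i).sol.smooth a k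
  have hgc : ∀ a k i, Continuous (sl (fun _ => 0) L (fun i => gr (φ i).η a k) i) := fun a k =>
    sl_continuous (hg a k) L
  have hρc : ∀ i : ι, Continuous ρ₀ := fun _ => hρ.smooth.continuous
  have hρt : SupTame (fun i => (φ i).lam) fun _ : ι => ρ₀ :=
    supTame_of_continuous hρ.smooth.continuous
  have hor' : ∀ a α, EqMod (fun i => (φ i).lam)
      (fun i x => ρ₀ x * sl (fun _ => 0) L (fun i => gr (φ i).η a (hor α)) i x)
      fun _ _ => 0 := fun a α => by
    have h₁ := l2Tame_weighted_nine hρ (φ := φ) (fun i => (φ i).zero_mem)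
      (isHor_append hH (isHor_cons_hor (L := []) (by simp [IsHor]) α))
      (by rw [ord_append]; simp; omega) a
    refine (h₁.congr fun i x _ => ?_).eqMod fun i => (hρc i).mul (hgc _ _ i)
    rw [sl, sl, sdL_append]
    rfl
  have h0 : ∀ a l, l ≠ 2 → EqMod (fun i => (φ i).lam)
      (fun i x => ρ₀ x * sl (fun _ => 0) L (fun i => gr (φ i).η a l) i x)
      fun _ _ => 0 := fun a l hl => by
    obtain ⟨α, rfl⟩ : ∃ α, l = hor α := by
      fin_cases l
      · exact ⟨0, rfl⟩
      · exact ⟨1, rfl⟩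
      · exact absurd rfl hl
    exact hor' a α
  by_cases hl : l = 2
  swap
  · exact (h0 a l hl).congr (fun _ _ _ => rfl) fun i x _ => by simp [hl]
  subst hl
  by_cases ha : a = 2
  · subst ha
    have h₁ := ((eqMod_densJac (φ := φ) hρ hL).symm.add hΛ ((h0 0 0 (by decide)).mul
      (c := fun _ _ => -1) (supTame_of_continuous continuous_const)
      fun _ => continuous_const)).add hΛ ((h0 1 1 (by decide)).mul
      (c := fun _ _ => -1) (supTame_of_continuous continuous_const) fun _ => continuous_const)
    refine h₁.congr (fun i x _ => ?_) fun i x _ => by simp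
    simp only [topDiv, Fin.sum_univ_three]
    ring
  · have hcurl := ((l2Tame_curl_initial hρ (φ := φ) hL a 2).eqMod
      fun i => (hgc _ _ i).sub (hgc _ _ i)).mul hρt hρc
    refine ((h0 2 a ha).add hΛ hcurl).congr (fun i x _ => ?_) fun i x _ => by simp [ha]
    ring

end Elliptic

variable {ρ₀ : Pt → ℝ}

theorem exists_density_bound (hρ : IsInitialDensity ρ₀) :
    ∃ R, (∀ x ∈ cell, |ρ₀ x| ≤ R) ∧ ∀ k, ∀ x ∈ cell, |pd k ρ₀ x| ≤ R := by
  obtain ⟨C, hC⟩ := exists_bound_cell hρ.smooth.continuous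
  choose D hD using fun k => exists_bound_cell (pd_contDiff hρ.smooth k).continuous
  have h0 : (fun _ => 1 / 2 : Pt) ∈ cell := fun _ => by norm_num
  have hC0 : 0 ≤ C := (abs_nonneg _).trans (hC _ h0)
  have hD0 : ∀ k, 0 ≤ D k := fun k => (abs_nonneg _).trans (hD k _ h0)
  refine ⟨C + ∑ k, D k, fun x hx => (hC x hx).trans
    (le_add_of_nonneg_right (Finset.sum_nonneg fun k _ => hD0 k)), fun k x hx =>
    (hD k x hx).trans ?_⟩
  have := Finset.single_le_sum (fun k _ => hD0 k) (Finset.mem_univ k)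
  linarith

section Families

variable {ι : Type*} {Λ : ι → ℝ}

theorem tame_ellConst (hΛ : ∀ i, 1 ≤ Λ i) {c R : ℝ} (hc : 0 < c) (hR : 0 ≤ R) {M : ι → ℝ}
    (hM : Tame Λ M) (hM0 : ∀ i, 0 ≤ M i) : Tame Λ fun i => ellConst c R (M i) := by
  have h₁ : Tame Λ fun i => 4 + 2 / c * M i :=
    (Tame.const 4).add hΛ (hM.const_mul (by positivity))
  have h₂ : Tame Λ fun i => (2 * R + 1) + M i := (Tame.const _).add hΛ hM
  have h₁0 : ∀ i, 0 ≤ 4 + 2 / c * M i := fun i => by have := hM0 i; positivity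
  have h₂0 : ∀ i, 0 ≤ (2 * R + 1) + M i := fun i => by have := hM0 i; positivity
  refine ((((h₁.mul h₂ h₁0 h₂0).add hΛ (Tame.const (2 / c))).pow (fun i => ?_) 2).const_mul
    (by norm_num : (0 : ℝ) ≤ 10) |>.add hΛ h₁).mono fun i => le_of_eq ?_
  · have := h₁0 i; have := h₂0 i; positivity
  · rw [ellConst]; ring

variable {φ : ι → Flow ρ₀} {L : List (Option (Fin 3))}

/-- The elliptic estimate for h = D^L(ρ₀J) at t = 0 with w = D^Lη. Multiplying the differentiated
momentum equation by ρ₀ makes the acceleration term an L² error of order 9, and turns the remaining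
top order terms into bounded multiples of h. -/
theorem l2Tame_densJac_initial (hρ : IsInitialDensity ρ₀) (hH : IsHor L) (hL : ord L = 7) :
    L2Tame (fun i => (φ i).lam) (sl (fun _ => 0) L fun i => dens ρ₀ * jacF (φ i).η) := by
  have hΛ := one_le_lam φ
  have hne : L ≠ [] := by rintro rfl; simp at hL
  obtain ⟨c, hc, hρc⟩ := hρ.lower
  obtain ⟨R, hR, hR'⟩ := exists_density_bound hρ
  have h0 : (fun _ => 1 / 2 : Pt) ∈ cell := fun _ => by norm_num
  have hR0 : 0 ≤ R := (abs_nonneg _).trans (hR _ h0)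
  have hcs := fun a (i : ι) => comp_contDiff (φ i).sol.smooth a
  have hd := fun i => densJac_contDiff hρ (φ i)
  have hρt : SupTame (fun i => (φ i).lam) fun _ : ι => ρ₀ :=
    supTame_of_continuous hρ.smooth.continuous
  have hρcont : ∀ _ : ι, Continuous ρ₀ := fun _ => hρ.smooth.continuous
  have hpc := fun l => (pd_contDiff hρ.smooth l).continuous
  -- the coefficients of the equation for the gradient of `h`
  have hat : ∀ a, SupTame (fun i => (φ i).lam) fun i x =>
      sdL [none, none] (comp (φ i).η a) (0, x) := fun a =>
    (reg_acc hρ (φ := φ) (fun i => (φ i).zero_mem) a).sup hΛ (L := []) (by simp)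
  have hac : ∀ a i, Continuous fun x => sdL [none, none] (comp (φ i).η a) (0, x) := fun a i =>
    (sdL_contDiff (hcs a i) _).continuous.comp (Continuous.prodMk_right 0)
  have hbt : ∀ l, SupTame (fun i => (φ i).lam) fun i x =>
      sdL [none, none] (comp (φ i).η l) (0, x) + 2 * pd l ρ₀ x := fun l =>
    (hat l).add hΛ (supTame_of_continuous (continuous_const.mul (hpc l)))
  have hbc : ∀ l i, Continuous fun x =>
      sdL [none, none] (comp (φ i).η l) (0, x) + 2 * pd l ρ₀ x := fun l i =>
    (hac l i).add (continuous_const.mul (hpc l))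
  -- The first summand is the coefficient of ρ₀ times the divergence. The second comes from ½ η_tt^a
  -- ρ₀ D^L η^a,_l, which is a multiple of h only for a = l = 3 (index 2) and an error otherwise.
  set cc : Fin 3 → ι → Pt → ℝ := fun l i x =>
    (sdL [none, none] (comp (φ i).η l) (0, x) + 2 * pd l ρ₀ x)
      + (1 / 2 * if l = 2 then 1 else 0) * sdL [none, none] (comp (φ i).η 2) (0, x) with hccdef
  have hct : ∀ l, SupTame (fun i => (φ i).lam) (cc l) := fun l => (hbt l).add hΛ
    ((supTame_of_continuous (g := fun _ => 1 / 2 * if l = 2 then 1 else 0)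
      continuous_const).mul (hat 2))
  have heq : ∀ l, EqMod (fun i => (φ i).lam)
      (fun i x => ρ₀ x * pd l (sl (fun _ => 0) L (fun i => dens ρ₀ * jacF (φ i).η) i) x)
      fun i x => cc l i x * sl (fun _ => 0) L (fun i => dens ρ₀ * jacF (φ i).η) i x := by
    intro l
    have e₁ := (eqMod_pd_densJac (φ := φ) hρ hL l).mul hρt hρcont
    have e₂ : EqMod (fun i => (φ i).lam)
        (fun i x => ρ₀ x * sl (fun _ => 0) L (fun i => sdL [none, none] (comp (φ i).η l)) i x)
        fun _ _ => 0 :=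
      ((l2Tame_weighted_nine hρ (φ := φ) (fun i => (φ i).zero_mem)
        (isHor_append hH (isHor_replicate_none 2)) (by rw [ord_append, hL]; simp) l).congr
        fun i x _ => by rw [sl, sl, sdL_append]; rfl).eqMod fun i => (hρcont i).mul
          (sl_continuous (fun i => sdL_contDiff (hcs l i) _) L i)
    have e₃ := EqMod.sum hΛ Finset.univ fun a => (eqMod_weighted_gr (φ := φ) hρ hH hL a l).mul
      (hat a) (hac a)
    have e₄ := (eqMod_densJac (φ := φ) hρ hL).symm.mul (hbt l) (hbc l)
    have e₅ := ((e₂.add hΛ e₃).mul (c := fun _ _ => 1 / 2)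
      (supTame_of_continuous continuous_const) fun _ => continuous_const).add hΛ e₄
    refine e₁.trans hΛ (e₅.congr (fun i x _ => ?_) fun i x _ => ?_)
    · simp only [Fin.sum_univ_three]
      ring
    · simp only [hccdef, Fin.sum_univ_three]
      by_cases hl : l = 2 <;> simp [hl]
      ring
  choose M hMt hM using hct
  have hM0 : ∀ l i, 0 ≤ M l i := fun l i => (abs_nonneg _).trans (hM l i _ h0)
  choose g hgt hgc hge using heq
  obtain ⟨g', hgt', hgc', hge'⟩ := eqMod_densJac (φ := φ) hρ hL
  have hwt : ∀ a, L2Tame (fun i => (φ i).lam) (sl (fun _ => 0) L fun i => comp (φ i).η a) :=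
    fun a => l2Tame_comp hρ (fun i => (φ i).zero_mem) (by omega) a
  have hsM : Tame (fun i => (φ i).lam) fun i => ∑ l, M l i := Tame.sum hΛ _ fun l _ => hMt l
  have hsM0 : ∀ i, 0 ≤ ∑ l, M l i := fun i => Finset.sum_nonneg fun l _ => hM0 l i
  refine (Tame.mul (tame_ellConst hΛ hc hR0 hsM hsM0) (((Tame.sum hΛ Finset.univ
    fun a _ => hwt a).add hΛ (Tame.sum hΛ Finset.univ fun a _ => hgt a)).add hΛ hgt')
    (fun i => ?_) fun i => ?_).mono fun i => ?_
  · have := hsM0 i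
    rw [ellConst]; positivity
  · have := setIntegral_sq_nonneg
    refine add_nonneg (add_nonneg (Finset.sum_nonneg fun _ _ => this _ _)
      (Finset.sum_nonneg fun _ _ => this _ _)) (this _ _)
  · refine elliptic_estimate hρ hc hρc hR hR' (cc := fun l => cc l i) (sl_contDiff hd L i)
      (fun a => sl_contDiff (hcs a) L i) (fun l => hgc l i) (hgc' i)
      (fun x hx α => (φ i).sdL_densJac_periodic hρ α hne (φ i).zero_mem hx)
      (fun a x hx α => (φ i).sdL_comp_periodic a α hne (φ i).zero_mem hx)
      (fun l x hx => (hM l i x hx).trans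
        (Finset.single_le_sum (fun l _ => hM0 l i) (Finset.mem_univ l)))
      (fun l x hx => hge l i x hx) fun x hx => ?_
    rw [hge' i x hx]
    simp only [topDiv, sl_gr_eq]

/-- The weighted top order derivatives of the deformation gradient at the initial time. -/
theorem l2Tame_weighted_seven_initial (hρ : IsInitialDensity ρ₀) (hH : IsHor L) (hL : ord L = 7)
    (a l : Fin 3) : L2Tame (fun i => (φ i).lam)
      fun i x => ρ₀ x * sl (fun _ => 0) L (fun i => gr (φ i).η a l) i x := by
  have hd := fun i => densJac_contDiff hρ (φ i)
  exact (eqMod_weighted_gr (φ := φ) hρ hH hL a l).l2Tame (one_le_lam φ)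
    ((l2Tame_densJac_initial hρ hH hL).const_mul _)
    fun i => continuous_const.mul (sl_continuous hd L i)

/-- Below order 7 the weight is not needed. Order 8 has an even number of time derivatives and
belongs to the energy. Order 7 is the gap: its time derivative has order 8, and its initial value is
bounded by the elliptic estimate. -/
theorem regW_gr (hρ : IsInitialDensity ρ₀) {τ : ι → ℝ} (hτ : ∀ i, τ i ∈ Icc 0 (φ i).T)
    (a k : Fin 3) : RegW (fun i => (φ i).lam) τ ρ₀ fun i => gr (φ i).η a k := by
  refine ⟨reg_gr hρ hτ a k, fun L hH hL => ?_⟩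
  have hΛ := one_le_lam φ
  have hgs := fun i => gr_contDiff (φ i).sol.smooth a k
  have heven : ∀ {L : List (Option (Fin 3))}, IsHor L → ord L = 8 → ∀ (i : ι) (t : ℝ),
      t ∈ Icc 0 (φ i).T →
      ∫ x in cell, (ρ₀ x * sdL L (gr (φ i).η a k) (t, x)) ^ 2 ≤ (φ i).lam := by
    intro L hH hL i t ht
    obtain ⟨b, hb⟩ : ∃ b, L.count none = 2 * b := by
      have := ord_eq_sum_mcount L
      exact ⟨4 - ∑ i, mcount L i, by omega⟩
    exact (integral_weighted_le_energy (φ i).sol.smooth ρ₀ hH hb hL k a t).trans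
      ((φ i).energy_le_lam hρ ht)
  rcases Nat.lt_or_ge (ord L) 7 with h | h
  · exact (supTame_of_continuous hρ.smooth.continuous).mul_l2 ((reg_gr hρ hτ a k).bound L (by omega))
      (fun _ => hρ.smooth.continuous) (sl_continuous hgs L)
  rcases h.eq_or_lt with h | h
  · refine ((Tame.const_mul (l2Tame_weighted_seven_initial (φ := φ) hρ hH h.symm a k)
      zero_le_two).add hΛ (Tame.const_mul Tame.self zero_le_two)).mono fun i => ?_
    exact integral_sq_le_of_initial (sdL_contDiff (hgs i) L) hρ.smooth.continuous
      ((φ i).mem_Icc_one (hτ i)) le_rfl fun s hs =>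
      heven (L := none :: L) (isHor_cons_none hH) (by rw [ord_cons_none]; omega) i s
        ⟨hs.1, hs.2.trans (hτ i).2⟩
  · exact Tame.self.mono fun i => heven hH (by omega) i _ (hτ i)

end Families

/-! ### The curl estimate -/

/-- The constant comparing the curl norms with the individual derivatives. -/
def curlCard : ℝ :=
  (∑ a ∈ Finset.range 4, 3 * sobCard (3 - a)) + ∑ l ∈ Finset.range 5, 3 * (2 : ℝ) ^ (4 - l)

theorem curlCard_nonneg : 0 ≤ curlCard :=
  add_nonneg (Finset.sum_nonneg fun _ _ => mul_nonneg zero_le_three (sobCard_nonneg _))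
    (Finset.sum_nonneg fun _ _ => by positivity)

section Solution

variable {ρ₀ : Pt → ℝ} {η : ℝ → Pt → Pt}

/-- The indices i + 1 and i + 2 are taken modulo 3, which encodes the cyclic form of the permutation
symbol. -/
theorem curl_dtv_eq (h : ContDiff ℝ ∞ fun p : ℝ × Pt => η p.1 p.2)
    (m : ℕ) (t : ℝ) (x : Pt) (i : Fin 3) :
    curl (dtv m η t) x i =
      sdL (List.replicate m none) (gr η (i + 2) (i + 1) - gr η (i + 1) (i + 2)) (t, x) := by
  have e : ∀ j k, pd j (fun y => dtv m η t y k) x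
      = sdL (List.replicate m none) (gr η k j) (t, x) := fun j k => by
    have hs := sdL_contDiff (comp_contDiff h k) (List.replicate m none)
    rw [pd_eq_sd isOpen_univ hs.contDiffOn (fun y _ => dtv_eq_sdL h m t y k) j x (mem_univ _)]
    have hp : (some j :: List.replicate m none).Perm (List.replicate m none ++ [some j]) :=
      List.perm_append_comm (l₁ := [some j])
    rw [← sdL_cons, sdL_perm (comp_contDiff h k) hp, sdL_append]
    rfl
  rw [sdL_sub (gr_contDiff h _ _) (gr_contDiff h _ _), curl]
  simp only [e, Fin.sum_univ_three, Pi.sub_apply]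
  fin_cases i <;> simp [eps] <;> ring_nf

theorem curlNorms_le (h : ContDiff ℝ ∞ fun p : ℝ × Pt => η p.1 p.2)
    {t B : ℝ}
    (hU : ∀ L, ord L ≤ 6 → Even (L.count none) → ∀ k l,
      ∫ x in cell, sdL L (gr η k l - gr η l k) (t, x) ^ 2 ≤ B)
    (hW : ∀ L, IsHor L → ord L = 8 → ∀ k l,
      ∫ x in cell, (ρ₀ x * sdL L (gr η k l - gr η l k) (t, x)) ^ 2 ≤ B) :
    curlNorms ρ₀ η t ≤ curlCard * B := by
  have hs : ∀ k l, ContDiff ℝ ∞ (gr η k l - gr η l k) := fun k l =>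
    (gr_contDiff h k l).sub (gr_contDiff h l k)
  have hsm := fun m k l => sdL_contDiff (hs k l) (List.replicate m none)
  rw [curlNorms, curlCard, add_mul, Finset.sum_mul, Finset.sum_mul]
  refine add_le_add (Finset.sum_le_sum fun a ha => ?_) (Finset.sum_le_sum fun l hl => ?_)
  · have ha := Finset.mem_range.1 ha
    calc sobSqV (3 - a) (curl (dtv (2 * a) η t)) ≤ ∑ _i : Fin 3, sobCard (3 - a) * B :=
          Finset.sum_le_sum fun i _ => sobSq_le isOpen_univ
            (hsm (2 * a) (i + 2) (i + 1)).contDiffOn (fun _ _ => mem_univ _)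
            (fun y _ => curl_dtv_eq h (2 * a) t y i) _ fun b hb => by
              rw [← sdL_append]
              refine hU _ ?_ ?_ _ _
              · rw [ord_append, ord_mlist, ord_replicate_none]; omega
              · rw [List.count_append]
                simp [mlist, List.count_replicate]
      _ = _ := by simp; ring
  · have hl := Finset.mem_range.1 hl
    calc tanSqV ρ₀ (4 - l) (curl (dtv (2 * l) η t)) ≤ ∑ _i : Fin 3, 2 ^ (4 - l) * B :=
          Finset.sum_le_sum fun i _ => tanSq_le isOpen_univ
            (hsm (2 * l) (i + 2) (i + 1)).contDiffOn (fun _ _ => mem_univ _)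
            (fun y _ => curl_dtv_eq h (2 * l) t y i) _ _ fun b hb => by
              rw [← sdL_append]
              refine hW _ (isHor_append (isHor_hlist b) (isHor_replicate_none _)) ?_ _ _
              rw [ord_append, ord_hlist, ord_replicate_none]; omega
      _ = _ := by simp; ring

theorem integral_sdL_gr_le_energy (h : ContDiff ℝ ∞ fun p : ℝ × Pt => η p.1 p.2)
    (ρ₀ : Pt → ℝ) {L : List (Option (Fin 3))} (hL : ord L ≤ 6)
    (hc : Even (L.count none)) (a k : Fin 3) (t : ℝ) :
    ∫ x in cell, sdL L (gr η a k) (t, x) ^ 2 ≤ energy ρ₀ η t := by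
  obtain ⟨b, hb⟩ := hc
  have := integral_even_le_energy h ρ₀ (L := L ++ [some k]) (a := b)
    (by rw [List.count_append, hb]; simp; ring) (by rw [ord_append]; simp; omega) a t
  rwa [sdL_append] at this

theorem integral_weighted_gr_le_energy (h : ContDiff ℝ ∞ fun p : ℝ × Pt => η p.1 p.2)
    (ρ₀ : Pt → ℝ) {L : List (Option (Fin 3))} (hH : IsHor L)
    (hL : ord L = 8) (a k : Fin 3) (t : ℝ) :
    ∫ x in cell, (ρ₀ x * sdL L (gr η a k) (t, x)) ^ 2 ≤ energy ρ₀ η t := by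
  have := ord_eq_sum_mcount L
  exact integral_weighted_le_energy h ρ₀ hH (a := 4 - ∑ i, mcount L i) (by omega) hL k a t

theorem integral_curl_le (h : ContDiff ℝ ∞ fun p : ℝ × Pt => η p.1 p.2)
    {w : Pt → ℝ} (hw : Continuous w) {L : List (Option (Fin 3))} {t B : ℝ}
    (hB : ∀ a k, ∫ x in cell, (w x * sdL L (gr η a k) (t, x)) ^ 2 ≤ B) (k l : Fin 3) :
    ∫ x in cell, (w x * sdL L (gr η k l - gr η l k) (t, x)) ^ 2 ≤ 4 * B := by
  have hc : ∀ a k, Continuous fun x => sdL L (gr η a k) (t, x) := fun a k =>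
    (sdL_contDiff (gr_contDiff h a k) L).continuous.comp (Continuous.prodMk_right t)
  have := hc k l; have := hc l k
  have h₁ : ∫ x in cell, (w x * (sdL L (gr η k l) (t, x) - sdL L (gr η l k) (t, x))) ^ 2 ≤
      ∫ x in cell, (2 * (w x * sdL L (gr η k l) (t, x)) ^ 2
        + 2 * (w x * sdL L (gr η l k) (t, x)) ^ 2) :=
    setIntegral_cell_mono (by fun_prop) (by fun_prop) fun x _ => by
      linarith [sq_nonneg (w x * sdL L (gr η k l) (t, x) + w x * sdL L (gr η l k) (t, x))]
  rw [integral_add (integrableOn_cell (by fun_prop)) (integrableOn_cell (by fun_prop)),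
    integral_const_mul, integral_const_mul] at h₁
  rw [sdL_sub (gr_contDiff h k l) (gr_contDiff h l k)]
  exact h₁.trans (by linarith [hB k l, hB l k])

/-- The direct bound, used only for time intervals longer than one. -/
theorem curlNorms_le_energy (h : ContDiff ℝ ∞ fun p : ℝ × Pt => η p.1 p.2)
    (hρ : IsInitialDensity ρ₀) (t : ℝ) :
    curlNorms ρ₀ η t ≤ curlCard * (4 * energy ρ₀ η t) := by
  refine curlNorms_le h (fun L hL hc k l => ?_) fun L hH hL k l =>
    integral_curl_le h hρ.smooth.continuous
      (fun a k => integral_weighted_gr_le_energy h ρ₀ hH hL a k t) k l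
  simpa using integral_curl_le h (w := fun _ => 1) continuous_const (L := L) (t := t)
    (fun a k => by simpa using integral_sdL_gr_le_energy h ρ₀ hL hc a k t) k l

end Solution

variable {ρ₀ : Pt → ℝ}

/-! ### From the conserved brackets to the curl: the two-time argument -/

/-- A solution with two marked times. -/
structure Times (ρ₀ : Pt → ℝ) where
  flow : Flow ρ₀
  s : ℝ
  t : ℝ
  s_mem : s ∈ Icc 0 flow.T
  t_mem : t ∈ Icc 0 flow.T

/-- One integer serves as both constant and exponent, so finitely many tame bounds can share it by
intersecting eventual statements. -/
theorem Tame.eventually {ι : Type*} {Λ F : ι → ℝ} (hΛ : ∀ i, 1 ≤ Λ i) (hF : Tame Λ F) :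
    ∀ᶠ n : ℕ in Filter.atTop, ∀ i, F i ≤ n * Λ i ^ n := by
  obtain ⟨C, N, hC, hb⟩ := hF
  filter_upwards [Filter.eventually_ge_atTop N, Filter.eventually_ge_atTop ⌈C⌉₊] with n h₁ h₂ i
  exact (hb i).trans (mul_le_mul ((Nat.le_ceil C).trans (by exact_mod_cast h₂))
    (pow_le_pow_right₀ (hΛ i) h₁) (pow_nonneg (zero_le_one.trans (hΛ i)) N) (Nat.cast_nonneg n))

/-- The antisymmetric expression with the second factor frozen at the time `t`. -/
def frozenBrk (η : ℝ → Pt → Pt) (k l : Fin 3) (L : List (Option (Fin 3))) (t : ℝ) : ℝ × Pt → ℝ :=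
  ∑ i, (gr η i k * (fun p => sdL L (gr η i l) (t, p.2))
    - gr η i l * fun p => sdL L (gr η i k) (t, p.2))

/-- The product part of the time derivative of the antisymmetric expression. -/
def crossSum (η : ℝ → Pt → Pt) (k l : Fin 3) (L : List (Option (Fin 3))) (s t : ℝ) (x : Pt) : ℝ :=
  ∑ i, (sd none (gr η i k) (s, x) * sdL L (gr η i l) (t, x)
    - sd none (gr η i l) (s, x) * sdL L (gr η i k) (t, x))

section Smooth

variable {η : ℝ → Pt → Pt} {k l : Fin 3} {L : List (Option (Fin 3))}

theorem frozen_contDiff {F : ℝ × Pt → ℝ} (hF : ContDiff ℝ ∞ F) (t : ℝ) :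
    ContDiff ℝ ∞ fun p : ℝ × Pt => F (t, p.2) :=
  hF.comp (contDiff_const.prodMk contDiff_snd)

theorem frozenBrk_contDiff (h : ContDiff ℝ ∞ fun p : ℝ × Pt => η p.1 p.2) (t : ℝ) :
    ContDiff ℝ ∞ (frozenBrk η k l L t) :=
  contDiff_finset_sum fun i =>
    ((gr_contDiff h i k).mul (frozen_contDiff (sdL_contDiff (gr_contDiff h i l) L) t)).sub
      ((gr_contDiff h i l).mul (frozen_contDiff (sdL_contDiff (gr_contDiff h i k) L) t))

theorem sd_none_frozen (G : Pt → ℝ) (p : ℝ × Pt) : sd none (fun p => G p.2) p = 0 := by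
  by_cases hd : DifferentiableAt ℝ (fun p : ℝ × Pt => G p.2) p
  · have h₁ := hd.hasFDerivAt.comp_hasDerivAt p.1
      ((hasDerivAt_id p.1).prodMk (hasDerivAt_const p.1 p.2))
    exact h₁.unique (hasDerivAt_const p.1 (G p.2))
  -- Without differentiability the derivative has its default value zero.
  · rw [sd, fderiv_zero_of_not_differentiableAt hd]; rfl

theorem sd_sum {κ : Type*} (s : Finset κ) {F : κ → ℝ × Pt → ℝ} (hF : ∀ i, ContDiff ℝ ∞ (F i))
    (j : Option (Fin 3)) : sd j (∑ i ∈ s, F i) = ∑ i ∈ s, sd j (F i) := sdL_sum s hF [j]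

theorem sd_none_frozenBrk (h : ContDiff ℝ ∞ fun p : ℝ × Pt => η p.1 p.2) (s t : ℝ) (x : Pt) :
    sd none (frozenBrk η k l L t) (s, x) = crossSum η k l L s t x := by
  have hg := gr_contDiff h
  have hf := fun i k => frozen_contDiff (sdL_contDiff (hg i k) L) t
  have hm := fun i k l => contDiff_mul_fun (hg i k) (hf i l)
  have hd : ∀ i, ContDiff ℝ ∞ (gr η i k * (fun p => sdL L (gr η i l) (t, p.2))
      - gr η i l * fun p => sdL L (gr η i k) (t, p.2)) := fun i => (hm i k l).sub (hm i l k)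
  rw [frozenBrk, sd_sum _ hd, Finset.sum_apply, crossSum]
  refine Finset.sum_congr rfl fun i _ => ?_
  rw [sd_sub (hm i k l) (hm i l k), sd_mul (hg i k) (hf i l), sd_mul (hg i l) (hf i k)]
  have h0 : ∀ k, sd none (fun p => sdL L (gr η i k) (t, p.2)) (s, x) = 0 := fun k =>
    sd_none_frozen (fun x => sdL L (gr η i k) (t, x)) (s, x)
  simp [h0]

/-- The time derivative on the second factor produces the bracket already bounded through the
invariants; on the first factor it produces only ∂_tDη, which is bounded in the supremum. -/
theorem sd_none_brk (h : ContDiff ℝ ∞ fun p : ℝ × Pt => η p.1 p.2) (s : ℝ) (x : Pt) :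
    sd none (brk η k l L) (s, x) = crossSum η k l L s s x + brk η k l (L ++ [none]) (s, x) := by
  have hg := gr_contDiff h
  have hf := fun i k => sdL_contDiff (hg i k) L
  have hm := fun i k l => contDiff_mul_fun (hg i k) (hf i l)
  have hp : (none :: L).Perm (L ++ [none]) := List.perm_append_comm (l₁ := [none])
  have hd : ∀ i, ContDiff ℝ ∞ (gr η i k * sdL L (gr η i l) - gr η i l * sdL L (gr η i k)) :=
    fun i => (hm i k l).sub (hm i l k)
  rw [brk, brk, sd_sum _ hd, Finset.sum_apply, Finset.sum_apply,
    crossSum, ← Finset.sum_add_distrib]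
  refine Finset.sum_congr rfl fun i _ => ?_
  rw [sd_sub (hm i k l) (hm i l k), sd_mul (hg i k) (hf i l), sd_mul (hg i l) (hf i k),
    ← sdL_perm (hg i l) hp, ← sdL_perm (hg i k) hp]
  simp
  ring

end Smooth

section Families

variable {ι : Type*} {φ : ι → Flow ρ₀} {τ σ : ι → ℝ} {L : List (Option (Fin 3))} {w : Pt → ℝ}

theorem crossSum_continuous (f : Flow ρ₀) (k l : Fin 3) (L : List (Option (Fin 3))) (s t : ℝ) :
    Continuous (crossSum f.η k l L s t) := by
  have hg := gr_contDiff f.sol.smooth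
  have h₁ : ∀ a k, Continuous fun x => sd none (gr f.η a k) (s, x) := fun a k =>
    (sd_contDiff (hg a k) none).continuous.comp (Continuous.prodMk_right s)
  have h₂ : ∀ a k, Continuous fun x => sdL L (gr f.η a k) (t, x) := fun a k =>
    (sdL_contDiff (hg a k) L).continuous.comp (Continuous.prodMk_right t)
  exact continuous_finsetSum _ fun a _ => ((h₁ a k).mul (h₂ a l)).sub ((h₁ a l).mul (h₂ a k))

/-- The factor ∂_tDη has order 1 and is bounded on the cell, so only the other factor needs the
weight. The two factors may be taken at different times. -/
theorem l2Tame_crossSum (hρ : IsInitialDensity ρ₀) (hτ : ∀ i, τ i ∈ Icc 0 (φ i).T)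
    (hw : Continuous w)
    (hσ : ∀ a k, L2Tame (fun i => (φ i).lam) fun i x =>
      w x * sl σ L (fun i => gr (φ i).η a k) i x) (k l : Fin 3) :
    L2Tame (fun i => (φ i).lam) fun i x => w x * crossSum (φ i).η k l L (τ i) (σ i) x := by
  have hΛ := one_le_lam φ
  have hg := fun a k (i : ι) => gr_contDiff (φ i).sol.smooth a k
  have h₁ := fun a k => sl_continuous (τ := τ) (hg a k) [none]
  have h₂ := fun a k i => hw.mul (sl_continuous (τ := σ) (hg a k) L i)
  have hm := fun a k l => ((reg_gr hρ hτ a k).sup hΛ (L := [none]) (by simp)).mul_l2 (hσ a l)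
    (h₁ a k) (h₂ a l)
  refine (L2Tame.sum hΛ Finset.univ (fun a _ => (hm a k l).sub hΛ (hm a l k)
    (fun i => (h₁ a k i).mul (h₂ a l i)) fun i => (h₁ a l i).mul (h₂ a k i))
    fun a i => ((h₁ a k i).mul (h₂ a l i)).sub ((h₁ a l i).mul (h₂ a k i))).congr
    fun i x _ => ?_
  rw [crossSum, Finset.mul_sum]
  refine Finset.sum_congr rfl fun a _ => ?_
  simp only [sl, sdL_cons, sdL_nil]
  ring

end Families

theorem brk_initial (f : Flow ρ₀) (k l : Fin 3) (L : List (Option (Fin 3))) {x : Pt}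
    (hx : x ∈ cell) : brk f.η k l L (0, x) = sdL L (gr f.η k l - gr f.η l k) (0, x) := by
  rw [sdL_sub (gr_contDiff f.sol.smooth k l) (gr_contDiff f.sol.smooth l k)]
  simp [brk, gr_initial f.sol (cell_subset_slab hx), Finset.sum_sub_distrib]

theorem frozenBrk_initial (f : Flow ρ₀) (k l : Fin 3) (L : List (Option (Fin 3))) (t : ℝ) {x : Pt}
    (hx : x ∈ cell) :
    frozenBrk f.η k l L t (0, x) = sdL L (gr f.η k l - gr f.η l k) (t, x) := by
  rw [sdL_sub (gr_contDiff f.sol.smooth k l) (gr_contDiff f.sol.smooth l k)]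
  simp [frozenBrk, gr_initial f.sol (cell_subset_slab hx), Finset.sum_sub_distrib]

theorem frozenBrk_self (η : ℝ → Pt → Pt) (k l : Fin 3) (L : List (Option (Fin 3))) (t : ℝ) (x : Pt) :
    frozenBrk η k l L t (t, x) = brk η k l L (t, x) := by
  simp [frozenBrk, brk]

/-- The evolution of a derivative of the curl of the flow map. -/
theorem eventually_integral_curl_le (hρ : IsInitialDensity ρ₀) {w : Pt → ℝ} (hw : Continuous w)
    {L : List (Option (Fin 3))}
    (hgr : ∀ τ : Times ρ₀ → ℝ, (∀ q, τ q ∈ Icc 0 q.flow.T) → ∀ a k,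
      L2Tame (fun q : Times ρ₀ => q.flow.lam) fun q x =>
        w x * sl τ L (fun q : Times ρ₀ => gr q.flow.η a k) q x)
    (hbrk : ∀ k l, L2Tame (fun q : Times ρ₀ => q.flow.lam) fun q x =>
      w x * brk q.flow.η k l (L ++ [none]) (q.s, x))
    (hinit : ∀ (f : Flow ρ₀) a k,
      ∫ x in cell, (w x * sdL L (gr f.η a k) (0, x)) ^ 2 ≤ energy ρ₀ f.η 0) (k l : Fin 3) :
    ∀ᶠ n : ℕ in Filter.atTop, ∀ f : Flow ρ₀, ∀ t ∈ Icc 0 f.T,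
      ∫ x in cell, (w x * sdL L (gr f.η k l - gr f.η l k) (t, x)) ^ 2 ≤
        12 * energy ρ₀ f.η 0 + t * (6 * (n * f.lam ^ n)) := by
  have hΛ := one_le_lam fun q : Times ρ₀ => q.flow
  have hs := l2Tame_crossSum (φ := fun q : Times ρ₀ => q.flow) hρ (fun q => q.s_mem) hw
    (hgr Times.s fun q => q.s_mem) k l
  have ht := l2Tame_crossSum (φ := fun q : Times ρ₀ => q.flow) hρ (fun q => q.s_mem) hw
    (hgr Times.t fun q => q.t_mem) k l
  have hb := hs.add hΛ (hbrk k l) (fun q => hw.mul (crossSum_continuous q.flow k l L _ _))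
    fun q => hw.mul ((brk_contDiff q.flow.sol.smooth k l _).continuous.comp
      (Continuous.prodMk_right q.s))
  filter_upwards [Tame.eventually hΛ ht, Tame.eventually hΛ hb] with n h₁ h₂ f t htT
  have hsm := f.sol.smooth
  have hf := frozenBrk_contDiff (k := k) (l := l) (L := L) hsm t
  have hbr := brk_contDiff hsm k l L
  have hcs : ContDiff ℝ ∞ (sdL L (gr f.η k l - gr f.η l k)) :=
    sdL_contDiff ((gr_contDiff hsm k l).sub (gr_contDiff hsm l k)) L
  have hI : ∀ s ∈ Icc 0 t, s ∈ Icc 0 f.T := fun s hs => ⟨hs.1, hs.2.trans htT.2⟩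
  -- The first increment moves only the undifferentiated factor from time 0 to t; the second moves
  -- the full bracket. The two marked times make their bounds uniform in s, t and the solution.
  have i₁ := integral_time_increment_le hf hw htT.1 (B := n * f.lam ^ n) fun s hs => by
    simp only [sd_none_frozenBrk hsm]
    exact h₁ ⟨f, s, t, hI s hs, htT⟩
  have i₂ := integral_time_increment_le hbr hw htT.1 (B := n * f.lam ^ n) fun s hs => by
    simp only [sd_none_brk hsm, mul_add]
    exact h₂ ⟨f, s, t, hI s hs, htT⟩
  have i₀ := integral_curl_le hsm hw (hinit f) k l
  have hc : ∀ {F : ℝ × Pt → ℝ}, ContDiff ℝ ∞ F → ∀ s, Continuous fun x => F (s, x) :=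
    fun hF s => hF.continuous.comp (Continuous.prodMk_right s)
  have := hc hf t; have := hc hf 0; have := hc hbr t; have := hc hbr 0
  have := hc hcs t; have := hc hcs 0
  -- The curl at time t is the initial curl, plus the increment of the bracket, minus the increment
  -- of the frozen bracket. The square of three terms gives the factor 3, whence 12 = 3 · 4 from the
  -- initial curl and 6 = 3 + 3 from the increments.
  have hmono : ∫ x in cell, (w x * sdL L (gr f.η k l - gr f.η l k) (t, x)) ^ 2 ≤
      ∫ x in cell, (3 * (w x * sdL L (gr f.η k l - gr f.η l k) (0, x)) ^ 2
        + 3 * (w x * (frozenBrk f.η k l L t (t, x) - frozenBrk f.η k l L t (0, x))) ^ 2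
        + 3 * (w x * (brk f.η k l L (t, x) - brk f.η k l L (0, x))) ^ 2) := by
    refine setIntegral_cell_mono (by fun_prop) (by fun_prop) fun x hx => ?_
    rw [frozenBrk_initial f k l L t hx, brk_initial f k l L hx, frozenBrk_self]
    set a := w x * sdL L (gr f.η k l - gr f.η l k) (0, x)
    set c := w x * (brk f.η k l L (t, x) - sdL L (gr f.η k l - gr f.η l k) (t, x)) with hcd
    set b := w x * (brk f.η k l L (t, x) - sdL L (gr f.η k l - gr f.η l k) (0, x)) with hbd
    have e : w x * sdL L (gr f.η k l - gr f.η l k) (t, x) = a + b - c := by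
      rw [hcd, hbd]; ring
    rw [e]
    linarith [sq_nonneg (a - b), sq_nonneg (a + c), sq_nonneg (b + c)]
  rw [integral_add (integrableOn_cell (by fun_prop)) (integrableOn_cell (by fun_prop)),
    integral_add (integrableOn_cell (by fun_prop)) (integrableOn_cell (by fun_prop)),
    integral_const_mul, integral_const_mul, integral_const_mul] at hmono
  have hX : 0 ≤ n * f.lam ^ n :=
    mul_nonneg (Nat.cast_nonneg n) (pow_nonneg (zero_le_one.trans f.one_le_lam) n)
  have htt : t ^ 2 * (n * f.lam ^ n) ≤ t * (n * f.lam ^ n) :=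
    mul_le_mul_of_nonneg_right (by
      have := mul_le_of_le_one_right htT.1 (htT.2.trans f.T_le)
      rwa [sq]) hX
  linarith

theorem eventually_unweighted_curl_le (hρ : IsInitialDensity ρ₀) {L : List (Option (Fin 3))}
    (hL : ord L ≤ 6) (hc : Even (L.count none)) (k l : Fin 3) :
    ∀ᶠ n : ℕ in Filter.atTop, ∀ f : Flow ρ₀, ∀ t ∈ Icc 0 f.T,
      ∫ x in cell, sdL L (gr f.η k l - gr f.η l k) (t, x) ^ 2 ≤
        12 * energy ρ₀ f.η 0 + t * (6 * (n * f.lam ^ n)) := by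
  have := eventually_integral_curl_le hρ (w := fun _ => 1) (L := L) continuous_const
    (fun τ hτ a k => by
      simpa using (reg_gr (φ := fun q : Times ρ₀ => q.flow) hρ hτ a k).bound L hL)
    (fun k l => by
      simpa using l2Tame_brk (φ := fun q : Times ρ₀ => q.flow) hρ (fun q => q.s_mem) hL k l)
    (fun f a k => by
      simpa using integral_sdL_gr_le_energy f.sol.smooth ρ₀ hL hc a k 0) k l
  simpa using this

theorem eventually_weighted_curl_le (hρ : IsInitialDensity ρ₀) {L : List (Option (Fin 3))}
    (hH : IsHor L) (hL : ord L = 8) (k l : Fin 3) :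
    ∀ᶠ n : ℕ in Filter.atTop, ∀ f : Flow ρ₀, ∀ t ∈ Icc 0 f.T,
      ∫ x in cell, (ρ₀ x * sdL L (gr f.η k l - gr f.η l k) (t, x)) ^ 2 ≤
        12 * energy ρ₀ f.η 0 + t * (6 * (n * f.lam ^ n)) :=
  eventually_integral_curl_le hρ hρ.smooth.continuous
    (fun _ hτ a k => (regW_gr (φ := fun q : Times ρ₀ => q.flow) hρ hτ a k).weighted L hH hL.le)
    (fun k l => l2Tame_weighted_brk (φ := fun q : Times ρ₀ => q.flow) hρ (fun q => q.s_mem)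
      (regW_gr hρ fun q => q.s_mem) hL hH k l)
    (fun f a k => integral_weighted_gr_le_energy f.sol.smooth ρ₀ hH hL a k 0) k l

/-! ### Uniform constants and conclusion -/

theorem length_le_ord (L : List (Option (Fin 3))) : L.length ≤ ord L := by
  induction L with
  | nil => simp
  | cons j L ih => cases j <;> simp <;> omega

/-- Only finitely many words occur in the curl norms, so one integer works for all of them. -/
theorem finite_ord_le (m : ℕ) : {L : List (Option (Fin 3)) | ord L ≤ m}.Finite :=
  (List.finite_length_le (Option (Fin 3)) m).subset fun L hL => (length_le_ord L).trans hL

/-- The curl estimate on time intervals of length at most one. -/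
theorem eventually_curlNorms_le (hρ : IsInitialDensity ρ₀) :
    ∀ᶠ n : ℕ in Filter.atTop, ∀ f : Flow ρ₀, ∀ t ∈ Icc 0 f.T,
      curlNorms ρ₀ f.η t ≤
        curlCard * (12 * energy ρ₀ f.η 0 + t * (6 * (n * f.lam ^ n))) := by
  have h₁ := (finite_ord_le 6).eventually_all.2 fun L hL =>
    Filter.eventually_imp_distrib_left.2 fun hc : Even (L.count none) =>
      Filter.eventually_all.2 fun k => Filter.eventually_all.2 fun l =>
        eventually_unweighted_curl_le hρ hL hc k l
  have h₂ := (finite_ord_le 8).eventually_all.2 fun L _ =>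
    Filter.eventually_imp_distrib_left.2 fun hH : IsHor L =>
      Filter.eventually_imp_distrib_left.2 fun hL : ord L = 8 =>
        Filter.eventually_all.2 fun k => Filter.eventually_all.2 fun l =>
          eventually_weighted_curl_le hρ hH hL k l
  filter_upwards [h₁, h₂] with n h₁ h₂ f t ht
  exact curlNorms_le f.sol.smooth (fun L hL hc k l => h₁ L hL hc k l f t ht)
    fun L hH hL k l => h₂ L hL.le hH hL k l f t ht

/-- The exponent depends on ρ₀ alone. Since 1 + |K| + S ≤ (1 + |K|)(1 + S), the dependence on K
separates from that on S = sup E and goes into C. -/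
theorem curl_estimate (hρ : IsInitialDensity ρ₀) :
    ∃ n : ℕ, ∀ K : ℝ, ∃ C : ℝ, 0 < C ∧ ∀ (T : ℝ) (u₀ : Pt → Pt) (η : ℝ → Pt → Pt), 0 < T →
      IsSmoothSolution ρ₀ T u₀ η →
      (∀ t ∈ Icc 0 T, ∀ x ∈ slab, 1 / 2 ≤ jac η t x ∧ jac η t x ≤ 3 / 2) →
      initialSize η ≤ K → ∀ t ∈ Icc 0 T, curlNorms ρ₀ η t ≤ 12 * curlCard * energy ρ₀ η 0
        + C * T * (1 + sSup (energy ρ₀ η '' Icc 0 T)) ^ n := by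
  obtain ⟨n, h1n, hn⟩ := ((Filter.eventually_ge_atTop 1).and (eventually_curlNorms_le hρ)).exists
  -- The term with K serves T ≤ 1, the term 4 serves T > 1, and the final 1 makes the constant
  -- positive. The choice n ≥ 1 ensures S ≤ (1 + S) ^ n.
  refine ⟨n, fun K => ⟨curlCard * (6 * n * (1 + |K|) ^ n + 4) + 1, ?_, ?_⟩⟩
  · have := curlCard_nonneg
    positivity
  intro T u₀ η hT hs hJ hK t ht
  have hD := curlCard_nonneg
  have hbdd := bddAbove_energy hρ hs hJ
  set S := sSup (energy ρ₀ η '' Icc 0 T) with hS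
  have hES : energy ρ₀ η t ≤ S := le_csSup hbdd (mem_image_of_mem _ ht)
  have hS0 : 0 ≤ S := (energy_nonneg ρ₀ η t).trans hES
  have hE0 := energy_nonneg ρ₀ η 0
  have hP : 0 ≤ (1 + S) ^ n := by positivity
  have hK0 : 0 ≤ (1 + |K|) ^ n := by positivity
  -- For T > 1 the factor T on the right makes the direct energy bound sufficient.
  rcases le_or_gt T 1 with hT1 | hT1
  · have h₁ := hn ⟨K, T, u₀, η, hT, hT1, hs, hJ, hK⟩ t ht
    have h₂ : Flow.lam (⟨K, T, u₀, η, hT, hT1, hs, hJ, hK⟩ : Flow ρ₀) ^ n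
        ≤ (1 + |K|) ^ n * (1 + S) ^ n := by
      rw [← mul_pow]
      refine pow_le_pow_left₀ (zero_le_one.trans (Flow.one_le_lam _)) ?_ n
      have : 0 ≤ |K| * S := by positivity
      change 1 + |K| + S ≤ (1 + |K|) * (1 + S)
      linarith
    have h₃ : t * (6 * (n * Flow.lam (⟨K, T, u₀, η, hT, hT1, hs, hJ, hK⟩ : Flow ρ₀) ^ n))
        ≤ T * (6 * (n * ((1 + |K|) ^ n * (1 + S) ^ n))) := by
      have := ht.2
      have := zero_le_one.trans (Flow.one_le_lam (⟨K, T, u₀, η, hT, hT1, hs, hJ, hK⟩ : Flow ρ₀))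
      gcongr
    have h₄ := mul_le_mul_of_nonneg_left h₃ hD
    have h₅ : 0 ≤ (4 * curlCard + 1) * T * (1 + S) ^ n := by positivity
    calc curlNorms ρ₀ η t ≤ _ := h₁
      _ ≤ 12 * curlCard * energy ρ₀ η 0
          + curlCard * (T * (6 * (n * ((1 + |K|) ^ n * (1 + S) ^ n)))) := by
        rw [mul_add]; linarith
      _ ≤ _ := by linarith
  · have h₁ := curlNorms_le_energy hs.smooth hρ t
    have h₂ : energy ρ₀ η t ≤ (1 + S) ^ n :=
      (hES.trans (le_add_of_nonneg_left zero_le_one)).trans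
        (le_self_pow₀ (le_add_of_nonneg_right hS0) (by omega))
    have h₃ : curlCard * (4 * energy ρ₀ η t) ≤ curlCard * (4 * (1 + S) ^ n) := by gcongr
    have h₄ : curlCard * (4 * (1 + S) ^ n) ≤ T * (curlCard * (4 * (1 + S) ^ n)) :=
      le_mul_of_one_le_left (by positivity) hT1.le
    have h₅ : 0 ≤ (curlCard * (6 * n * (1 + |K|) ^ n) + 1) * T * (1 + S) ^ n := by positivity
    have h₆ : 0 ≤ 12 * curlCard * energy ρ₀ η 0 := by positivity
    linarith

end PhysVac

end

theorem mainTheorem2 (ρ₀ : PhysVac.Pt → ℝ) (hρ₀ : PhysVac.IsInitialDensity ρ₀) :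
    ∃ P₀ P : Polynomial ℝ, ∀ K : ℝ, ∃ C : ℝ, 0 < C ∧
      ∀ (T : ℝ) (u₀ : PhysVac.Pt → PhysVac.Pt) (η : ℝ → PhysVac.Pt → PhysVac.Pt),
        0 < T →
        PhysVac.IsSmoothSolution ρ₀ T u₀ η →
        (∀ t ∈ Set.Icc 0 T, ∀ x ∈ PhysVac.slab,
          1 / 2 ≤ PhysVac.jac η t x ∧ PhysVac.jac η t x ≤ 3 / 2) →
        PhysVac.initialSize η ≤ K →
        BddAbove (PhysVac.energy ρ₀ η '' Set.Icc 0 T) ∧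
        ∀ t ∈ Set.Ioo 0 T,
          PhysVac.curlNorms ρ₀ η t ≤
            P₀.eval (PhysVac.energy ρ₀ η 0)
              + C * T * P.eval (sSup (PhysVac.energy ρ₀ η '' Set.Icc 0 T)) := by
  obtain ⟨n, hn⟩ := PhysVac.curl_estimate hρ₀
  refine ⟨Polynomial.C (12 * PhysVac.curlCard) * Polynomial.X, (1 + Polynomial.X) ^ n, fun K => ?_⟩
  obtain ⟨C, hC, hb⟩ := hn K
  refine ⟨C, hC, fun T u₀ η hT hs hJ hK => ⟨PhysVac.bddAbove_energy hρ₀ hs hJ, fun t ht => ?_⟩⟩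
  have := hb T u₀ η hT hs hJ hK t (Set.Ioo_subset_Icc_self ht)
  simpa using this
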